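/- \textbf{Setting.} All algebras are over $\mathbb C$; for an algebra $A$ and $X=\sum a\otimes b\in A\otimes A$ put $X'=\sum b\otimes a$, and for a $*$-algebra use on $A\otimes A$ the conjugation $(a\otimes b)^*=b^*\otimes a^*$. A \emph{ribbon Hopf-$*$-algebra} is a Hopf $*$-algebra $(A,\Delta,\epsilon,S)$ with $\epsilon(\xi^*)=\overline{\epsilon(\xi)}$, $\Delta(\xi^*)=\Delta(\xi)^*$, $S(\xi^*)=S(\xi)^*$, an invertible $R\in A\otimes A$ with $R\Delta(\xi)=\Delta'(\xi)R$, $(\Delta\otimes\mathrm{id})R=R_{13}R_{23}$, $(\mathrm{id}\otimes\Delta)R=R_{13}R_{12}$, $R^*=R^{-1}$, and a central $v\in A$ with $v^2=uS(u)$, $S(v)=v$, $\epsilon(v)=1$, $v^*=v^{-1}$, $\Delta(v)=(R'R)^{-1}(v\otimes v)$, where $u=\sum S(r^2)r^1$ for $R=\sum r^1\otimes r^2$. Let $G$ be a finite simple graph with vertex set $S$ (for instance the graph of a triangulation of an oriented surface), $L$ its set of oriented links, $-i$ the link $i$ with opposite orientation, and let a ciliation be given, i.e. for each vertex a linear order $<$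 on the set of links pointing towards it. Let $\mathcal G_*$ be a finite-dimensional semisimple ribbon Hopf-$*$-algebra, and for every $x\in S$ let $\mathcal G_x$ be a ribbon Hopf-$*$-algebra twist equivalent to $\mathcal G_*$: there are a $*$-isomorphism $\iota_x:\mathcal G_x\to\mathcal G_*$ compatible with co-units and antipodes, and $F_x\in\mathcal G_*\otimes\mathcal G_*$ with $F_x^*=F_x^{-1}$, such that $(\iota_x\otimes\iota_x)\Delta_x(\xi)=F_x^{-1}\Delta_*(\iota_x(\xi))F_x$, $(\iota_x\otimes\iota_x)(R_x)=F_x'^{-1}R_*F_x$, $\iota_x(v_x)=v_*$. Let $\mathcal G=\bigotimes_{x\in S}\mathcal G_x$, with the induced co-product $\Delta$, conjugation $*$, $R$-matrix $R$ and ribbon element $v=\bigotimes_x v_x$. Let $(\tau_*^I)_I$ be unitary matrix representations of $\mathcal G_*$, one from each class of irreducible representations, with $\tau^I_*(v_*)=v^I\cdot 1$. Let $C^a_*[IJ|K]$, $a=1,\dots,N^{IJ}_K$, be bases of the spaces of intertwiners $V^I\otimes V^J\to V^K$ (that is, $C(\tau^I_*\otimes\tau^J_*)(\Delta_*(\xi))=\tau^K_*(\xi)C$),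 and let $\kappa_I\in\mathbb C$ satisfy $\kappa_I^2=v^I$ and $$C^a_*[IJ|K]\,(\tau^I_*\otimes\tau^J_*)(R'_*)\,C^b_*[IJ|L]^*=\delta_{a,b}\,\delta_{K,L}\,\frac{\kappa_I\kappa_J}{\kappa_K}.$$ Put $\tau^I_x=\tau^I_*\circ\iota_x$ and $C^a_x[IJ|K]=C^a_*[IJ|K]\,(\tau^I_*\otimes\tau^J_*)(F_x)$. For a link $i$ from $x$ to $y$ let $\tau^{I,i}$ be the representation of $\mathcal G$ on index pairs $\alpha=(a_1,a_2)$ which is $\tau^I_y$ on the index $a_2$ for $\xi\in\mathcal G_y$, ${}^t\tau^I_x(S_x(\xi))$ on the index $a_1$ for $\xi\in\mathcal G_x$, and $\epsilon_z(\xi)\cdot 1$ for $\xi\in\mathcal G_z$, $z\ne x,y$. The \emph{lattice algebra} $\mathcal B$ is the unital associative algebra generated by the unital algebra $\mathcal G$ and elements $U^I_\alpha(i)=U^I_{a_1a_2}(i)$, $i\in L$, subject to the following relations (summation over repeated indices, $i$ pointing from $x$ to $y$ in 2, 4): \begin{enumerate} \item $\xi\,U^I_\alpha(i)=U^I_\beta(i)\,(\tau^{I,i}_{\beta\alpha}\otimes\mathrm{id})(\Delta(\xi))$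 for all $\xi\in\mathcal G$; \item $U^I_{ab}(i)\,U^J_{a'b'}(i)=\sum_{K,m}\overline{C^m_x[IJ|K]_{c,aa'}}\;U^K_{cd}(i)\;C^m_y[IJ|K]_{d,bb'}$ and $U^I_{ab}(i)\,U^I_{bc}(-i)=\delta_{a,c}$; \item $U^I_\alpha(i)\,U^J_\beta(j)=U^J_\gamma(j)\,U^I_\delta(i)\,(\tau^{I,i}_{\delta\alpha}\otimes\tau^{J,j}_{\gamma\beta})(R)$ if $i<j$ (in particular $i$ and $j$ are different links with a common target) or if $i,j$ have no common endpoints; \item $U^I_{ab}(i)\,U^J_{cd}(i)=(\tau^I_x\otimes\tau^J_x)(R_x)_{ac,a'c'}\;U^J_{c'd'}(i)\,U^I_{a'b'}(i)\;(\tau^I_y\otimes\tau^J_y)((R_y')^{-1})_{b'd',bd}$. \end{enumerate} \textbf{Theorem.} There is a unique central $\kappa_*\in\mathcal G_*$ with $\tau^I_*(\kappa_*)=\kappa_I\cdot 1$ for all $I$. The element $\kappa=\bigotimes_x\iota_x^{-1}(\kappa_*)\in\mathcal G$ is central in $\mathcal G$ and invertible, $\kappa^2=v$ and $\kappa^*=\kappa^{-1}$.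 There is a unique conjugate-linear unital anti-homomorphism $\theta:\mathcal B\to\mathcal B$ with $\theta(\xi)=\xi^*$ for $\xi\in\mathcal G$ and, for every link $i$ from $x$ to $y$, $$\theta(U^I_\alpha(i))=\sum_{\gamma,\beta}U^I_\gamma(-i)\,(\tau^{I,-i}_{\gamma\beta}\otimes\mathrm{id})(R^{-1})\,\eta^{I,i}_{\beta\alpha},\qquad \eta^{I,i}_{(b_1,b_2),(a_1,a_2)}=\delta_{b_2,a_1}\,\tau^I_y(S_y(u_y))_{a_2b_1}.$$ It satisfies $\theta(\theta(B))=vBv^{-1}$ for all $B\in\mathcal B$. With $\sigma_\kappa(B)=\kappa^{-1}B\kappa$, one has $(\sigma_\kappa\circ\theta)^2=\mathrm{id}$, and $B^*:=\sigma_\kappa(\theta(B))$ is a $*$-operation on $\mathcal B$ (a conjugate-linear involutive anti-automorphism) which extends the $*$-operation of $\mathcal G$. -/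

import Mathlib

open scoped TensorProduct Kronecker

noncomputable section

namespace LatticeGauge

/-! ### Ribbon Hopf-*-algebras -/

section Ribbon

variable (A : Type*) [Ring A] [HopfAlgebra ℂ A]

/-- `X ↦ X'`, the exchange of the two tensor factors. -/
def swap : A ⊗[ℂ] A →ₐ[ℂ] A ⊗[ℂ] A :=
  (Algebra.TensorProduct.comm ℂ A A).toAlgHom

/-- The exchange of tensor factors on invertible elements. -/
def swapUnit : (A ⊗[ℂ] A)ˣ →* (A ⊗[ℂ] A)ˣ :=
  Units.map (swap A : A ⊗[ℂ] A →* A ⊗[ℂ] A)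

/-- The conjugation on `A ⊗ A` with `(a ⊗ b)^* = b^* ⊗ a^*`
(Mathlib's `star` on a tensor product is `(a ⊗ b)^* = a^* ⊗ b^*`). -/
def flipStar {A : Type*} [Ring A] [HopfAlgebra ℂ A] [StarRing A] [StarModule ℂ A]
    (X : A ⊗[ℂ] A) : A ⊗[ℂ] A :=
  swap A (star X)

/-- `a ⊗ b ↦ a ⊗ b ⊗ 1`. -/
def leg12 : A ⊗[ℂ] A →ₐ[ℂ] A ⊗[ℂ] (A ⊗[ℂ] A) :=
  Algebra.TensorProduct.map (AlgHom.id ℂ A) Algebra.TensorProduct.includeLeft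

/-- `a ⊗ b ↦ a ⊗ 1 ⊗ b`. -/
def leg13 : A ⊗[ℂ] A →ₐ[ℂ] A ⊗[ℂ] (A ⊗[ℂ] A) :=
  Algebra.TensorProduct.map (AlgHom.id ℂ A) Algebra.TensorProduct.includeRight

/-- `a ⊗ b ↦ 1 ⊗ a ⊗ b`. -/
def leg23 : A ⊗[ℂ] A →ₐ[ℂ] A ⊗[ℂ] (A ⊗[ℂ] A) :=
  Algebra.TensorProduct.includeRight

/-- `id ⊗ Δ`. -/
def idComul : A ⊗[ℂ] A →ₐ[ℂ] A ⊗[ℂ] (A ⊗[ℂ] A) :=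
  Algebra.TensorProduct.map (AlgHom.id ℂ A) (Bialgebra.comulAlgHom ℂ A)

/-- `Δ ⊗ id`. -/
def comulId : A ⊗[ℂ] A →ₐ[ℂ] A ⊗[ℂ] (A ⊗[ℂ] A) :=
  (Algebra.TensorProduct.assoc ℂ ℂ ℂ A A A).toAlgHom.comp
    (Algebra.TensorProduct.map (Bialgebra.comulAlgHom ℂ A) (AlgHom.id ℂ A))

/-- The element `u = ∑ S(r²) r¹` built from `R = ∑ r¹ ⊗ r²`. -/
def drinfeldElt {A : Type*} [Ring A] [HopfAlgebra ℂ A] (R : A ⊗[ℂ] A) : A :=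
  LinearMap.mul' ℂ A ((HopfAlgebra.antipode ℂ (A := A)).rTensor A (swap A R))

/-- A ribbon Hopf-*-algebra over `ℂ`, for the conjugation `(a ⊗ b)^* = b^* ⊗ a^*` on `A ⊗ A`. -/
class RibbonHopfStarAlgebra [StarRing A] [StarModule ℂ A] where
  counit_star : ∀ a : A,
    Coalgebra.counit (R := ℂ) (star a) = star (Coalgebra.counit (R := ℂ) a)
  comul_star : ∀ a : A,
    Coalgebra.comul (R := ℂ) (star a) = flipStar (Coalgebra.comul (R := ℂ) a)
  antipode_star : ∀ a : A,
    HopfAlgebra.antipode ℂ (star a) = star (HopfAlgebra.antipode ℂ a)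
  /-- the `R`-matrix -/
  R : (A ⊗[ℂ] A)ˣ
  R_comul : ∀ a : A,
    (R : A ⊗[ℂ] A) * Coalgebra.comul (R := ℂ) a = swap A (Coalgebra.comul (R := ℂ) a) * R
  comulId_R : comulId A R = leg13 A R * leg23 A R
  idComul_R : idComul A R = leg13 A R * leg12 A R
  R_star : flipStar (R : A ⊗[ℂ] A) = ((R⁻¹ : (A ⊗[ℂ] A)ˣ) : A ⊗[ℂ] A)
  /-- the ribbon element -/
  v : A
  v_central : ∀ a : A, v * a = a * v
  v_sq : v ^ 2 = drinfeldElt (R : A ⊗[ℂ] A) *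
    HopfAlgebra.antipode ℂ (drinfeldElt (R : A ⊗[ℂ] A))
  antipode_v : HopfAlgebra.antipode ℂ v = v
  counit_v : Coalgebra.counit (R := ℂ) v = 1
  star_v_mul : star v * v = 1
  comul_v : Coalgebra.comul (R := ℂ) v =
    (((swapUnit A R * R)⁻¹ : (A ⊗[ℂ] A)ˣ) : A ⊗[ℂ] A) * (v ⊗ₜ[ℂ] v)

end Ribbon

/-- Twist equivalence of the ribbon Hopf-*-algebra `A` to the ribbon Hopf-*-algebra `H`. -/
structure TwistEquiv (A H : Type*)
    [Ring A] [HopfAlgebra ℂ A] [StarRing A] [StarModule ℂ A] [RibbonHopfStarAlgebra A]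
    [Ring H] [HopfAlgebra ℂ H] [StarRing H] [StarModule ℂ H] [RibbonHopfStarAlgebra H] where
  /-- the underlying `*`-isomorphism -/
  iso : A ≃ₐ[ℂ] H
  iso_star : ∀ a, iso (star a) = star (iso a)
  /-- the twist -/
  F : (H ⊗[ℂ] H)ˣ
  F_star : flipStar (F : H ⊗[ℂ] H) = ((F⁻¹ : (H ⊗[ℂ] H)ˣ) : H ⊗[ℂ] H)
  counit_iso : ∀ a, Coalgebra.counit (R := ℂ) (iso a) = Coalgebra.counit (R := ℂ) a
  iso_antipode : ∀ a, iso (HopfAlgebra.antipode ℂ a) = HopfAlgebra.antipode ℂ (iso a)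
  iso_comul : ∀ a, Algebra.TensorProduct.map (iso : A →ₐ[ℂ] H) (iso : A →ₐ[ℂ] H)
      (Coalgebra.comul (R := ℂ) a) =
    ((F⁻¹ : (H ⊗[ℂ] H)ˣ) : H ⊗[ℂ] H) * Coalgebra.comul (R := ℂ) (iso a) * F
  iso_R : Algebra.TensorProduct.map (iso : A →ₐ[ℂ] H) (iso : A →ₐ[ℂ] H)
      (RibbonHopfStarAlgebra.R : (A ⊗[ℂ] A)ˣ) =
    (((swapUnit H F)⁻¹ : (H ⊗[ℂ] H)ˣ) : H ⊗[ℂ] H) *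
      (RibbonHopfStarAlgebra.R : (H ⊗[ℂ] H)ˣ) * F
  iso_v : iso RibbonHopfStarAlgebra.v = RibbonHopfStarAlgebra.v

/-! ### Matrix representations -/

section Rep

variable {A B : Type*} [Ring A] [Algebra ℂ A] [Ring B] [Algebra ℂ B]
variable {m n : Type*} [Fintype m] [DecidableEq m] [Fintype n] [DecidableEq n]

/-- `ρ ⊗ σ` on `A ⊗ B`, with values in the matrices indexed by pairs:
its entry at `((p, q), (p', q'))` is `ρ_{p p'} ⊗ σ_{q q'}`. -/
def tensorMat (ρ : A →ₐ[ℂ] Matrix m m ℂ) (σ : B →ₐ[ℂ] Matrix n n ℂ) :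
    A ⊗[ℂ] B →ₐ[ℂ] Matrix (m × n) (m × n) ℂ :=
  (Matrix.kroneckerAlgEquiv m n ℂ).toAlgHom.comp (Algebra.TensorProduct.map ρ σ)

/-- `ρ_{p q} ⊗ id : A ⊗ B → B`. -/
def slice (ρ : A →ₐ[ℂ] Matrix m m ℂ) (p q : m) : A ⊗[ℂ] B →ₗ[ℂ] B :=
  TensorProduct.lid ℂ B ∘ₗ
    LinearMap.rTensor B (Matrix.entryLinearMap ℂ ℂ p q ∘ₗ ρ.toLinearMap)

/-- Irreducibility of a matrix representation of an algebra. -/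
def IsIrred (ρ : A →ₐ[ℂ] Matrix m m ℂ) : Prop :=
  Nonempty m ∧ ∀ W : Submodule ℂ (m → ℂ),
    (∀ a, ∀ w ∈ W, (ρ a).mulVec w ∈ W) → W = ⊥ ∨ W = ⊤

/-- Equivalence of two matrix representations of an algebra. -/
def IsEquivRep (ρ : A →ₐ[ℂ] Matrix m m ℂ) (σ : A →ₐ[ℂ] Matrix n n ℂ) : Prop :=
  ∃ (T : Matrix n m ℂ) (T' : Matrix m n ℂ), T * T' = 1 ∧ T' * T = 1 ∧ ∀ a, T * ρ a = σ a * T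

end Rep

/-- Representation-theoretic data for the ribbon Hopf-*-algebra `H`: a unitary representative of
every class of irreducible representations (labelled by `ι`), Clebsch-Gordan maps, and square roots
`κ_I` of the values `v^I` of the ribbon element, with respect to which the Clebsch-Gordan maps are
normalized. -/
structure RepData (H : Type*) [Ring H] [HopfAlgebra ℂ H] [StarRing H] [StarModule ℂ H]
    [RibbonHopfStarAlgebra H] (ι : Type*) where
  dim : ι → ℕ
  τ : ∀ I, H →ₐ[ℂ] Matrix (Fin (dim I)) (Fin (dim I)) ℂ
  unitary : ∀ I a, τ I (star a) = (τ I a).conjTranspose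
  irred : ∀ I, IsIrred (τ I)
  complete : ∀ (n : ℕ) (ρ : H →ₐ[ℂ] Matrix (Fin n) (Fin n) ℂ), IsIrred ρ →
    ∃! I, IsEquivRep ρ (τ I)
  /-- the multiplicities `N^{IJ}_K` -/
  mult : ι → ι → ι → ℕ
  /-- the Clebsch-Gordan maps `C^a[IJ|K] : V^I ⊗ V^J → V^K` -/
  C : ∀ I J K, Fin (mult I J K) → Matrix (Fin (dim K)) (Fin (dim I) × Fin (dim J)) ℂ
  C_intertwines : ∀ I J K a (ξ : H),
    C I J K a * tensorMat (τ I) (τ J) (Coalgebra.comul (R := ℂ) ξ) = τ K ξ * C I J K a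
  C_independent : ∀ I J K, LinearIndependent ℂ (C I J K)
  C_span : ∀ I J K (T : Matrix (Fin (dim K)) (Fin (dim I) × Fin (dim J)) ℂ),
    (∀ ξ : H, T * tensorMat (τ I) (τ J) (Coalgebra.comul (R := ℂ) ξ) = τ K ξ * T) →
      T ∈ Submodule.span ℂ (Set.range (C I J K))
  κ : ι → ℂ
  κ_sq : ∀ I, τ I RibbonHopfStarAlgebra.v = (κ I ^ 2) • 1
  C_norm : ∀ I J K a b,
    C I J K a * tensorMat (τ I) (τ J) (swap H (RibbonHopfStarAlgebra.R : (H ⊗[ℂ] H)ˣ)) *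
      (C I J K b).conjTranspose = if a = b then (κ I * κ J / κ K) • 1 else 0
  C_orth : ∀ I J K L a b, K ≠ L →
    C I J K a * tensorMat (τ I) (τ J) (swap H (RibbonHopfStarAlgebra.R : (H ⊗[ℂ] H)ˣ)) *
      (C I J L b).conjTranspose = 0

/-- The characterization of `κ_∗ ∈ H`: it is central and acts as `κ_I` in `τ^I`. -/
def RepData.IsKappa {H : Type*} [Ring H] [HopfAlgebra ℂ H] [StarRing H] [StarModule ℂ H]
    [RibbonHopfStarAlgebra H] {ι : Type*} (D : RepData H ι) (k : H) : Prop :=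
  (∀ a, k * a = a * k) ∧ ∀ I, D.τ I k = D.κ I • 1

/-! ### Homomorphisms out of a tensor product of algebras -/

section PiLift

variable {S : Type*} [Fintype S] [DecidableEq S] {A : S → Type*} [∀ x, Ring (A x)]
  [∀ x, Algebra ℂ (A x)] {B : Type*} [Ring B] [Algebra ℂ B]

/-- `(a_x)_x ↦ ∏_x f_x(a_x)` for commuting homomorphisms `f_x`. -/
def piProd (f : ∀ x, A x →ₐ[ℂ] B)
    (hf : Pairwise fun x y => ∀ a b, Commute (f x a) (f y b)) : (∀ x, A x) →* B :=
  MonoidHom.noncommPiCoprod (fun x => (f x).toRingHom.toMonoidHom) fun _ _ h a b => hf h a b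

theorem piProd_mulSingle (f : ∀ x, A x →ₐ[ℂ] B)
    (hf : Pairwise fun x y => ∀ a b, Commute (f x a) (f y b)) (x : S) (a : A x) :
    piProd f hf (Pi.mulSingle x a) = f x a :=
  MonoidHom.noncommPiCoprod_mulSingle (fun x => (f x).toRingHom.toMonoidHom) x a

theorem piProd_update (f : ∀ x, A x →ₐ[ℂ] B)
    (hf : Pairwise fun x y => ∀ a b, Commute (f x a) (f y b)) (m : ∀ x, A x) (x : S) (a : A x) :
    piProd f hf (Function.update m x a) = piProd f hf (Function.update m x 1) * f x a := by
  have h : Function.update m x a = Function.update m x 1 * Pi.mulSingle x a := by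
    funext y
    by_cases hy : y = x
    · subst hy; simp
    · simp [hy]
  rw [h, map_mul, piProd_mulSingle]

/-- `piProd` as a multilinear map. -/
def piLiftMultilinear (f : ∀ x, A x →ₐ[ℂ] B)
    (hf : Pairwise fun x y => ∀ a b, Commute (f x a) (f y b)) : MultilinearMap ℂ A B where
  toFun := piProd f hf
  map_update_add' {inst} m x a b := by
    rw [Subsingleton.elim inst ‹DecidableEq S›, piProd_update f hf m x (a + b),
      piProd_update f hf m x a, piProd_update f hf m x b, map_add, mul_add]
  map_update_smul' {inst} m x c a := by
    rw [Subsingleton.elim inst ‹DecidableEq S›, piProd_update f hf m x (c • a),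
      piProd_update f hf m x a, map_smul, mul_smul_comm]

/-- The homomorphism `⨂_x A_x → B` determined by commuting homomorphisms `f_x : A_x → B`. -/
def piLift (f : ∀ x, A x →ₐ[ℂ] B)
    (hf : Pairwise fun x y => ∀ a b, Commute (f x a) (f y b)) : (⨂[ℂ] x, A x) →ₐ[ℂ] B :=
  PiTensorProduct.liftAlgHom (piLiftMultilinear f hf)
    (map_one (piProd f hf)) (map_mul (piProd f hf))

theorem piLift_single (f : ∀ x, A x →ₐ[ℂ] B)
    (hf : Pairwise fun x y => ∀ a b, Commute (f x a) (f y b)) (x : S) (a : A x) :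
    piLift f hf (PiTensorProduct.singleAlgHom x a) = f x a := by
  have h : piLift f hf (PiTensorProduct.singleAlgHom x a) =
      piProd f hf (Pi.mulSingle x a) := by
    simp [piLift, piLiftMultilinear]
  rw [h, piProd_mulSingle]

theorem single_commute {x y : S} (h : x ≠ y) (a : A x) (b : A y) :
    Commute (PiTensorProduct.singleAlgHom (R := ℂ) (A := A) x a)
      (PiTensorProduct.singleAlgHom y b) := by
  simp only [PiTensorProduct.singleAlgHom_apply]
  exact Commute.tprod (Pi.mulSingle_commute h a b)

/-- `A_x ⊗ A_x → (⨂ A) ⊗ (⨂ A)`, induced by the embedding of `A_x` into `⨂ A`. -/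
def singleTensor (x : S) :
    A x ⊗[ℂ] A x →ₐ[ℂ] (⨂[ℂ] x, A x) ⊗[ℂ] (⨂[ℂ] x, A x) :=
  Algebra.TensorProduct.map (PiTensorProduct.singleAlgHom x) (PiTensorProduct.singleAlgHom x)

theorem singleTensor_commute {x y : S} (h : x ≠ y) (X : A x ⊗[ℂ] A x) (Y : A y ⊗[ℂ] A y) :
    Commute (singleTensor (A := A) x X) (singleTensor y Y) := by
  induction X with
  | zero => simp
  | add X₁ X₂ h₁ h₂ => rw [map_add]; exact h₁.add_left h₂
  | tmul a b =>
    induction Y with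
    | zero => simp
    | add Y₁ Y₂ h₁ h₂ => rw [map_add]; exact h₁.add_right h₂
    | tmul c d =>
      simp only [singleTensor, Algebra.TensorProduct.map_tmul, Commute, SemiconjBy,
        Algebra.TensorProduct.tmul_mul_tmul]
      rw [(single_commute h a c).eq, (single_commute h b d).eq]

end PiLift

/-! ### The algebra of gauge transformations -/

section Gauge

variable {S : Type*} [Fintype S] [DecidableEq S] (𝒢 : S → Type*)
  [∀ x, Ring (𝒢 x)] [∀ x, HopfAlgebra ℂ (𝒢 x)] [∀ x, StarRing (𝒢 x)]
  [∀ x, StarModule ℂ (𝒢 x)] [∀ x, RibbonHopfStarAlgebra (𝒢 x)]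

/-- The full gauge algebra `⨂_x 𝒢_x`. -/
abbrev GaugeAlg := ⨂[ℂ] x, 𝒢 x

/-- The map `⨂_x (𝒢_x ⊗ 𝒢_x) → 𝒢 ⊗ 𝒢` that reorders the tensor factors. -/
def shuffle : (⨂[ℂ] x, 𝒢 x ⊗[ℂ] 𝒢 x) →ₐ[ℂ] GaugeAlg 𝒢 ⊗[ℂ] GaugeAlg 𝒢 :=
  piLift (fun x => singleTensor x) fun _ _ h X Y => singleTensor_commute h X Y

/-- The co-product of `𝒢`. -/
def gaugeComul : GaugeAlg 𝒢 →ₐ[ℂ] GaugeAlg 𝒢 ⊗[ℂ] GaugeAlg 𝒢 :=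
  piLift (fun x => (singleTensor x).comp (Bialgebra.comulAlgHom ℂ (𝒢 x)))
    fun _ _ h a b => singleTensor_commute h (Bialgebra.comulAlgHom ℂ _ a)
      (Bialgebra.comulAlgHom ℂ _ b)

/-- The `R`-matrix of `𝒢`. -/
def gaugeR : (GaugeAlg 𝒢 ⊗[ℂ] GaugeAlg 𝒢)ˣ :=
  Units.map ((shuffle 𝒢 : _ →* GaugeAlg 𝒢 ⊗[ℂ] GaugeAlg 𝒢).comp
      (PiTensorProduct.tprodMonoidHom ℂ))
    (MulEquiv.piUnits.symm fun x => (RibbonHopfStarAlgebra.R : (𝒢 x ⊗[ℂ] 𝒢 x)ˣ))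

/-- The ribbon element of `𝒢`. -/
def gaugeV : GaugeAlg 𝒢 :=
  PiTensorProduct.tprod ℂ fun _ => RibbonHopfStarAlgebra.v

/-- The `*`-operation of `𝒢` as an additive map, `⊗_x ξ_x ↦ ⊗_x ξ_x^*`. -/
def gaugeStarAux : GaugeAlg 𝒢 →+ GaugeAlg 𝒢 :=
  PiTensorProduct.liftAddHom
    (fun p => star p.1 • PiTensorProduct.tprod ℂ fun x => star (p.2 x))
    (by
      intro r f i hf
      have h : PiTensorProduct.tprod ℂ (fun x => star (f x)) = 0 :=
        MultilinearMap.map_coord_zero _ i (by simp [hf])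
      simp [h])
    (by intro f; simp)
    (by
      intro inst r f i a b
      have h : ∀ c : 𝒢 i, (fun x => star (Function.update f i c x)) =
          Function.update (fun x => star (f x)) i (star c) := by
        intro c; funext y
        by_cases hy : y = i
        · subst hy; simp
        · simp [hy]
      simp only [h, star_add, MultilinearMap.map_update_add, smul_add])
    (by intro r r' f; simp [add_smul])
    (by
      intro inst r f i r'
      have h : ∀ c : 𝒢 i, (fun x => star (Function.update f i c x)) =
          Function.update (fun x => star (f x)) i (star c) := by
        intro c; funext y
        by_cases hy : y = i
        · subst hy; simp
        · simp [hy]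
      simp only [h, star_smul, MultilinearMap.map_update_smul, Function.update_eq_self,
        smul_smul, star_mul])

theorem gaugeStarAux_smul_tprod (c : ℂ) (f : ∀ x, 𝒢 x) :
    gaugeStarAux 𝒢 (c • PiTensorProduct.tprod ℂ f) =
      star c • PiTensorProduct.tprod ℂ fun x => star (f x) := by
  rw [← PiTensorProduct.tprodCoeff_eq_smul_tprod]
  rfl

/-- The `*`-operation of `𝒢`, the conjugate-linear map with `⊗_x ξ_x ↦ ⊗_x ξ_x^*`. -/
def gaugeStar : GaugeAlg 𝒢 →ₗ⋆[ℂ] GaugeAlg 𝒢 where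
  toFun := gaugeStarAux 𝒢
  map_add' := map_add _
  map_smul' := by
    intro c X
    induction X using PiTensorProduct.induction_on with
    | smul_tprod r f =>
      rw [smul_smul, gaugeStarAux_smul_tprod, gaugeStarAux_smul_tprod, smul_smul]
      simp
    | add X Y hX hY => rw [smul_add, map_add, hX, hY, map_add, smul_add]

theorem gaugeStar_tprod (f : ∀ x, 𝒢 x) :
    gaugeStar 𝒢 (PiTensorProduct.tprod ℂ f) = PiTensorProduct.tprod ℂ fun x => star (f x) := by
  have h := gaugeStarAux_smul_tprod 𝒢 1 f
  rw [one_smul, star_one, one_smul] at h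
  exact h

end Gauge

/-! ### Representations on the links -/

section Link

variable {S : Type*} [Fintype S] [DecidableEq S] {G : SimpleGraph S} {𝒢 : S → Type*}
  [∀ x, Ring (𝒢 x)] [∀ x, HopfAlgebra ℂ (𝒢 x)] [∀ x, StarRing (𝒢 x)]
  [∀ x, StarModule ℂ (𝒢 x)] [∀ x, RibbonHopfStarAlgebra (𝒢 x)]
  {H : Type*} [Ring H] [HopfAlgebra ℂ H] [StarRing H] [StarModule ℂ H] [RibbonHopfStarAlgebra H]
  {ι : Type*} (tw : ∀ x, TwistEquiv (𝒢 x) H) (D : RepData H ι)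

/-- `τ^I_x = τ^I_∗ ∘ ι_x`. -/
def repAt (x : S) (I : ι) : 𝒢 x →ₐ[ℂ] Matrix (Fin (D.dim I)) (Fin (D.dim I)) ℂ :=
  (D.τ I).comp ((tw x).iso : 𝒢 x →ₐ[ℂ] H)

/-- The twisted Clebsch-Gordan maps `C^a_x[IJ|K] = C^a_∗[IJ|K] (τ^I_∗ ⊗ τ^J_∗)(F_x)`. -/
def cgAt (x : S) (I J K : ι) (a : Fin (D.mult I J K)) :
    Matrix (Fin (D.dim K)) (Fin (D.dim I) × Fin (D.dim J)) ℂ :=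
  D.C I J K a * tensorMat (D.τ I) (D.τ J) ((tw x).F : H ⊗[ℂ] H)

/-- The indices of `U^I(i)`: the first one belongs to the source, the second one to the target
of the link `i`. -/
abbrev RepData.Ix (D : RepData H ι) (I : ι) : Type := Fin (D.dim I) × Fin (D.dim I)

/-- The contragredient representation `ξ ↦ ᵗτ^I_x(S(ξ))`, acting on the source index. -/
def sourceRep (x : S) (I : ι) : 𝒢 x →ₐ[ℂ] Matrix (D.Ix I) (D.Ix I) ℂ where
  toFun ξ := (repAt tw D x I (HopfAlgebra.antipode ℂ ξ)).transpose ⊗ₖ 1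
  map_one' := by simp
  map_mul' a b := by
    rw [HopfAlgebra.antipode_mul_antidistrib, map_mul, Matrix.transpose_mul,
      ← Matrix.mul_kronecker_mul, mul_one]
  map_zero' := by simp
  map_add' a b := by
    rw [map_add, map_add, Matrix.transpose_add, Matrix.add_kronecker]
  commutes' c := by
    simp only [Algebra.algebraMap_eq_smul_one, map_smul, HopfAlgebra.antipode_one, map_one,
      Matrix.transpose_smul, Matrix.transpose_one, Matrix.smul_kronecker, Matrix.one_kronecker_one]

/-- The representation `τ^I_y`, acting on the target index. -/
def targetRep (y : S) (I : ι) : 𝒢 y →ₐ[ℂ] Matrix (D.Ix I) (D.Ix I) ℂ where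
  toFun ξ := (1 : Matrix (Fin (D.dim I)) (Fin (D.dim I)) ℂ) ⊗ₖ repAt tw D y I ξ
  map_one' := by simp
  map_mul' a b := by rw [map_mul, ← Matrix.mul_kronecker_mul, mul_one]
  map_zero' := by simp
  map_add' a b := by rw [map_add, Matrix.kronecker_add]
  commutes' c := by
    simp only [Algebra.algebraMap_eq_smul_one, map_smul, map_one, Matrix.kronecker_smul,
      Matrix.one_kronecker_one]

theorem source_target_commute (x y : S) (I : ι) (a : 𝒢 x) (b : 𝒢 y) :
    Commute (sourceRep tw D x I a) (targetRep tw D y I b) := by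
  simp only [Commute, SemiconjBy, sourceRep, targetRep, AlgHom.coe_mk, RingHom.coe_mk,
    MonoidHom.coe_mk, OneHom.coe_mk, ← Matrix.mul_kronecker_mul, mul_one, one_mul]

/-- The restriction of `τ^{I,i}` to the local algebra `𝒢_z`. -/
def linkRepAt (I : ι) (i : G.Dart) (z : S) : 𝒢 z →ₐ[ℂ] Matrix (D.Ix I) (D.Ix I) ℂ :=
  if z = i.snd then targetRep tw D z I
  else if z = i.fst then sourceRep tw D z I
  else (Algebra.ofId ℂ _).comp (Bialgebra.counitAlgHom ℂ (𝒢 z))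

theorem linkRepAt_commute (I : ι) (i : G.Dart) :
    Pairwise fun x y => ∀ (a : 𝒢 x) (b : 𝒢 y),
      Commute (linkRepAt tw D I i x a) (linkRepAt tw D I i y b) := by
  intro x y hxy a b
  have hz : ∀ (z : S) (c : ℂ) (M : Matrix (D.Ix I) (D.Ix I) ℂ),
      Commute (Algebra.ofId ℂ (Matrix (D.Ix I) (D.Ix I) ℂ) c) M :=
    fun z c M => Algebra.commutes c M
  unfold linkRepAt
  split_ifs with h₁ h₂ h₃ h₄ h₅ h₆ h₇
  · exact absurd (h₁.trans h₂.symm) hxy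
  · exact (source_target_commute tw D _ _ I _ _).symm
  · exact (hz x _ _).symm
  · exact source_target_commute tw D _ _ I _ _
  · exact absurd (h₄.trans h₆.symm) hxy
  · exact (hz x _ _).symm
  all_goals exact hz x _ _

/-- The representation `τ^{I,i}` of `𝒢`. -/
def linkRep (I : ι) (i : G.Dart) : GaugeAlg 𝒢 →ₐ[ℂ] Matrix (D.Ix I) (D.Ix I) ℂ :=
  piLift (linkRepAt tw D I i) (linkRepAt_commute tw D I i)

/-- The matrix elements `η^{I,i}_{βα}` of `η^{I,i} = e^I_x ⊗ ᵗτ^I_y(S(u_y))`, where `i` points from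
`x` to `y`. Here `β` is an index of `U^I(-i)`, hence lists the `y`-index first, and `α` is an index
of `U^I(i)`, hence lists the `x`-index first. -/
def eta (I : ι) (i : G.Dart) (β α : D.Ix I) : ℂ :=
  (if β.2 = α.1 then 1 else 0) *
    repAt tw D i.snd I (HopfAlgebra.antipode ℂ
      (drinfeldElt ((RibbonHopfStarAlgebra.R : (𝒢 i.snd ⊗[ℂ] 𝒢 i.snd)ˣ) :
        𝒢 i.snd ⊗[ℂ] 𝒢 i.snd))) α.2 β.1

end Link

/-! ### The lattice algebra -/

/-- The generators of the lattice algebra: gauge transformations `ξ ∈ 𝒢` and the matrix elements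
`U^I_α(i)` of the lattice connection. -/
inductive Gen {S : Type*} (G : SimpleGraph S) (𝒢 : S → Type*)
    [∀ x, Ring (𝒢 x)] [∀ x, HopfAlgebra ℂ (𝒢 x)]
    {H : Type*} [Ring H] [HopfAlgebra ℂ H] [StarRing H] [StarModule ℂ H]
    [RibbonHopfStarAlgebra H] {ι : Type*} (D : RepData H ι)
  | gauge (ξ : ⨂[ℂ] x, 𝒢 x)
  | conn (I : ι) (i : G.Dart) (α : D.Ix I)

/-- A ciliation: a linear order on the set of links pointing towards `x`, for every vertex `x`. -/
abbrev Ciliation {S : Type*} (G : SimpleGraph S) := ∀ x : S, LinearOrder {i : G.Dart // i.snd = x}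

/-- `i < j`, i.e. `i` and `j` point towards the same vertex `x`, and `i` precedes `j` there. -/
def Ciliation.Before {S : Type*} {G : SimpleGraph S} (cil : Ciliation G) (i j : G.Dart) : Prop :=
  ∃ (x : S) (hi : i.snd = x) (hj : j.snd = x), (cil x).lt ⟨i, hi⟩ ⟨j, hj⟩

/-- The links `i` and `j` have no common endpoint. -/
def NoCommonEnd {S : Type*} {G : SimpleGraph S} (i j : G.Dart) : Prop :=
  i.fst ≠ j.fst ∧ i.fst ≠ j.snd ∧ i.snd ≠ j.fst ∧ i.snd ≠ j.snd

section Lattice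

variable {S : Type*} [Fintype S] [DecidableEq S] {G : SimpleGraph S} (cil : Ciliation G)
  {𝒢 : S → Type*}
  [∀ x, Ring (𝒢 x)] [∀ x, HopfAlgebra ℂ (𝒢 x)] [∀ x, StarRing (𝒢 x)]
  [∀ x, StarModule ℂ (𝒢 x)] [∀ x, RibbonHopfStarAlgebra (𝒢 x)]
  {H : Type*} [Ring H] [HopfAlgebra ℂ H] [StarRing H] [StarModule ℂ H] [RibbonHopfStarAlgebra H]
  {ι : Type*} [Fintype ι] (tw : ∀ x, TwistEquiv (𝒢 x) H) (D : RepData H ι)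

/-- A generator `ξ ∈ 𝒢` in the free algebra. -/
def freeGauge (G : SimpleGraph S) (D : RepData H ι) (ξ : GaugeAlg 𝒢) :
    FreeAlgebra ℂ (Gen G 𝒢 D) :=
  FreeAlgebra.ι ℂ (Gen.gauge ξ)

/-- A generator `U^I_α(i)` in the free algebra. -/
def freeConn (𝒢 : S → Type*) [∀ x, Ring (𝒢 x)] [∀ x, HopfAlgebra ℂ (𝒢 x)]
    (D : RepData H ι) (I : ι) (i : G.Dart) (α : D.Ix I) : FreeAlgebra ℂ (Gen G 𝒢 D) :=
  FreeAlgebra.ι ℂ (Gen.conn I i α)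

/-- The defining relations of the lattice algebra. -/
inductive Rel : FreeAlgebra ℂ (Gen G 𝒢 D) → FreeAlgebra ℂ (Gen G 𝒢 D) → Prop
  -- `𝒢` is a unital subalgebra
  | gauge_one : Rel (freeGauge G D 1) 1
  | gauge_mul (ξ ξ' : GaugeAlg 𝒢) : Rel (freeGauge G D (ξ * ξ')) (freeGauge G D ξ * freeGauge G D ξ')
  | gauge_add (ξ ξ' : GaugeAlg 𝒢) : Rel (freeGauge G D (ξ + ξ')) (freeGauge G D ξ + freeGauge G D ξ')
  | gauge_smul (c : ℂ) (ξ : GaugeAlg 𝒢) : Rel (freeGauge G D (c • ξ)) (c • freeGauge G D ξ)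
  -- covariance
  | covariance (ξ : GaugeAlg 𝒢) (I : ι) (i : G.Dart) (α : D.Ix I) :
      Rel (freeGauge G D ξ * freeConn 𝒢 D I i α)
        (∑ β, freeConn 𝒢 D I i β *
          freeGauge G D (slice (linkRep tw D I i) β α (gaugeComul 𝒢 ξ)))
  -- functoriality; with `i` pointing from `x` to `y`, the matrix elements of
  -- `C^a[IJ|K]^i = C^a_y[IJ|K] ⊗ ᵗ(C^a_x[IJ|K]^*)` are written out
  | functoriality (I J : ι) (i : G.Dart) (α : D.Ix I) (β : D.Ix J) :
      Rel (freeConn 𝒢 D I i α * freeConn 𝒢 D J i β)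
        (∑ K, ∑ a : Fin (D.mult I J K), ∑ γ : D.Ix K,
          (cgAt tw D i.snd I J K a γ.2 (α.2, β.2) *
            (cgAt tw D i.fst I J K a).conjTranspose.transpose γ.1 (α.1, β.1)) •
              freeConn 𝒢 D K i γ)
  -- `U^I(i) U^I(-i) = 1` as matrices, for all oriented links `i`
  | inverse (I : ι) (i : G.Dart) (a c : Fin (D.dim I)) :
      Rel (∑ b, freeConn 𝒢 D I i (a, b) * freeConn 𝒢 D I i.symm (b, c)) (if a = c then 1 else 0)
  -- braid relations of different links
  | braid (i j : G.Dart) (h : cil.Before i j ∨ NoCommonEnd i j)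
      (I J : ι) (α : D.Ix I) (β : D.Ix J) :
      Rel (freeConn 𝒢 D I i α * freeConn 𝒢 D J j β)
        (∑ δ : D.Ix I, ∑ γ : D.Ix J,
          tensorMat (linkRep tw D I i) (linkRep tw D J j)
              (gaugeR 𝒢 : GaugeAlg 𝒢 ⊗[ℂ] GaugeAlg 𝒢) (δ, γ) (α, β) •
            (freeConn 𝒢 D J j γ * freeConn 𝒢 D I i δ))
  -- braid relations of a link `i` from `x` to `y` with itself:
  -- `U¹(i) U²(i) = R_x U²(i) U¹(i) (R_y')⁻¹`
  | braid_self (i : G.Dart) (I J : ι) (α : D.Ix I) (β : D.Ix J) :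
      Rel (freeConn 𝒢 D I i α * freeConn 𝒢 D J i β)
        (∑ δ : D.Ix I, ∑ γ : D.Ix J,
          (tensorMat (repAt tw D i.fst I) (repAt tw D i.fst J)
              ((RibbonHopfStarAlgebra.R : (𝒢 i.fst ⊗[ℂ] 𝒢 i.fst)ˣ) : 𝒢 i.fst ⊗[ℂ] 𝒢 i.fst)
              (α.1, β.1) (δ.1, γ.1) *
            tensorMat (repAt tw D i.snd I) (repAt tw D i.snd J)
              (((swapUnit (𝒢 i.snd) RibbonHopfStarAlgebra.R)⁻¹ : (𝒢 i.snd ⊗[ℂ] 𝒢 i.snd)ˣ) :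
                𝒢 i.snd ⊗[ℂ] 𝒢 i.snd)
              (δ.2, γ.2) (α.2, β.2)) •
            (freeConn 𝒢 D J i γ * freeConn 𝒢 D I i δ))

/-- The lattice algebra `ℬ` of the ciliated graph. -/
abbrev LatticeAlg := RingQuot (Rel cil tw D)

/-- The image of `ξ ∈ 𝒢` in `ℬ`. -/
def gauge (ξ : GaugeAlg 𝒢) : LatticeAlg cil tw D :=
  RingQuot.mkAlgHom ℂ (Rel cil tw D) (freeGauge G D ξ)

/-- The generator `U^I_α(i)` of `ℬ`. -/
def conn (I : ι) (i : G.Dart) (α : D.Ix I) : LatticeAlg cil tw D :=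
  RingQuot.mkAlgHom ℂ (Rel cil tw D) (freeConn 𝒢 D I i α)

/-- The defining properties of the anti-homomorphism `θ` of `ℬ`. -/
structure IsTheta (θ : LatticeAlg cil tw D →ₗ⋆[ℂ] LatticeAlg cil tw D) : Prop where
  map_one : θ 1 = 1
  map_mul : ∀ A B, θ (A * B) = θ B * θ A
  map_gauge : ∀ ξ, θ (gauge cil tw D ξ) = gauge cil tw D (gaugeStar 𝒢 ξ)
  map_conn : ∀ I i α, θ (conn cil tw D I i α) =
    ∑ γ : D.Ix I, ∑ β : D.Ix I, eta tw D I i β α • (conn cil tw D I i.symm γ *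
      gauge cil tw D (slice (linkRep tw D I i.symm) γ β
        (((gaugeR 𝒢)⁻¹ : (GaugeAlg 𝒢 ⊗[ℂ] GaugeAlg 𝒢)ˣ) : GaugeAlg 𝒢 ⊗[ℂ] GaugeAlg 𝒢)))

/-- `B ↦ g⁻¹ B g` for an invertible `g ∈ 𝒢`. -/
def conjBy (g : (GaugeAlg 𝒢)ˣ) (B : LatticeAlg cil tw D) : LatticeAlg cil tw D :=
  gauge cil tw D ((g⁻¹ : (GaugeAlg 𝒢)ˣ) : GaugeAlg 𝒢) * B * gauge cil tw D (g : GaugeAlg 𝒢)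

/-- `κ = ⊗_x ι_x⁻¹(κ_∗) ∈ 𝒢`. -/
def gaugeKappa (k : H) : GaugeAlg 𝒢 :=
  PiTensorProduct.tprod ℂ fun x => (tw x).iso.symm k

end Lattice

end LatticeGauge

end

/-
For a link `i` from `x` to `y` let `X` be the matrix `(τ_y ⊗ id)(R_y) U(-i) (τ_x ⊗ id)(R_x⁻¹)`. By
the Yang–Baxter equation, quasi-triangularity and the unitarity of `R`, its entries `X_{ba}` satisfy
the complex conjugates of the relations between the `U_{ab}(i)` with the factors of all products
reversed. Hence `ξ ↦ ξ^*`, `U_{ab}(i) ↦ X_{ba}` extends to a conjugate-linear anti-homomorphism `θ`,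
and contracting a leg of `R⁻¹` with the antipode brings `X` into the form with `η`.

Applying `θ` twice to `U(i)` leaves `R'R` at the source and its inverse at the target, which
`Δ(v) = (R'R)⁻¹(v ⊗ v)` turns into conjugation by `v`. An element of the semisimple algebra `𝒢_∗` is
determined by its values in the irreducible representations, and these can be arbitrary scalars by
the density theorem. So `κ_∗` exists, squares to `v_∗`, and is unitary because `|κ_I| = 1`; as a
unitary square root of `v`, it corrects `θ` to an involution.
-/

noncomputable section

namespace LatticeGauge

open Coalgebra HopfAlgebra
open Algebra.TensorProduct (lift lift_tmul)

section Semiconj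

variable {k A A' M : Type*} [CommSemiring k] [Semiring A] [Algebra k A] [Semiring A']
  [Algebra k A'] [Semiring M] [Algebra k M]

theorem semiconjBy_lift {f f' : A →ₐ[k] M} {g g' : A' →ₐ[k] M}
    {h : ∀ a b, Commute (f a) (g b)} {h' : ∀ a b, Commute (f' a) (g' b)} {V : M}
    (hf : ∀ a, SemiconjBy V (f a) (f' a)) (hg : ∀ b, SemiconjBy V (g b) (g' b))
    (X : A ⊗[k] A') : SemiconjBy V (lift f g h X) (lift f' g' h' X) := by
  induction X with
  | zero => simp
  | add X Y hX hY => rw [map_add, map_add]; exact hX.add_right hY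
  | tmul a b => rw [lift_tmul, lift_tmul]; exact (hf a).mul_right (hg b)

theorem commute_lift {f : A →ₐ[k] M} {g : A' →ₐ[k] M} {h : ∀ a b, Commute (f a) (g b)} {x : M}
    (hf : ∀ a, Commute x (f a)) (hg : ∀ b, Commute x (g b)) (X : A ⊗[k] A') :
    Commute x (lift f g h X) :=
  semiconjBy_lift hf hg X

end Semiconj

section Sandwich

variable {k A A' M : Type*} [CommSemiring k] [Semiring M] [Algebra k M]

section Module

variable [AddCommMonoid A] [Module k A] [AddCommMonoid A'] [Module k A']

/-- The contraction `a ⊗ b ↦ p(a) U q(b)` of a tensor around an element `U` of an algebra. -/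
def sandwich (p : A →ₗ[k] M) (q : A' →ₗ[k] M) (U : M) : A ⊗[k] A' →ₗ[k] M :=
  LinearMap.mul' k M ∘ₗ TensorProduct.map (LinearMap.mulRight k U ∘ₗ p) q

@[simp] theorem sandwich_tmul (p : A →ₗ[k] M) (q : A' →ₗ[k] M) (U : M) (a : A) (b : A') :
    sandwich p q U (a ⊗ₜ b) = p a * U * q b := by
  simp [sandwich]

end Module

variable [Semiring A] [HopfAlgebra k A]

theorem sandwich_mul_antipode_comul (f : A →ₐ[k] M) (U : M) (q : A →ₗ[k] M) (X : A ⊗[k] A) :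
    sandwich ((f : A →ₗ[k] M) ∘ₗ LinearMap.mul' k A ∘ₗ (antipode k).lTensor A) q U
      ((comul (R := k)).rTensor A X) =
        U * q (TensorProduct.lid k A ((counit (R := k)).rTensor A X)) := by
  induction X with
  | zero => simp
  | add X Y hX hY => simp only [map_add, mul_add, hX, hY]
  | tmul a b => simp [Algebra.algebraMap_eq_smul_one]

theorem sandwich_comul_mul_antipode (f : A →ₐ[k] M) (U : M) (p : A →ₗ[k] M) (X : A ⊗[k] A) :
    sandwich p ((f : A →ₗ[k] M) ∘ₗ LinearMap.mul' k A ∘ₗ (antipode k).lTensor A) U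
      ((comul (R := k)).lTensor A X) =
        p (TensorProduct.rid k A ((counit (R := k)).lTensor A X)) * U := by
  induction X with
  | zero => simp
  | add X Y hX hY => simp only [map_add, add_mul, hX, hY]
  | tmul a b => simp [Algebra.algebraMap_eq_smul_one]

/-- The antipode moves one tensor factor of `Δ(a)` to the other side of the equation. -/
theorem lift_comul_mul_of_sandwich {f g : A →ₐ[k] M} {h : ∀ a b, Commute (f a) (g b)} {U : M}
    (hU : ∀ a, g a * U =
      sandwich ((f : A →ₗ[k] M) ∘ₗ antipode k) (g : A →ₗ[k] M) U (comul (R := k) a)) (a : A) :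
    lift f g h (comul (R := k) a) * U = U * g a := by
  have lift_mul (X : A ⊗[k] A) : lift f g h X * U =
      sandwich ((f : A →ₗ[k] M) ∘ₗ LinearMap.mul' k A ∘ₗ (antipode k).lTensor A)
        (g : A →ₗ[k] M) U
        ((TensorProduct.assoc k A A A).symm ((comul (R := k)).lTensor A X)) := by
    induction X with
    | zero => simp
    | add X Y hX hY => simp only [map_add, add_mul, hX, hY]
    | tmul a b =>
      simp only [lift_tmul, LinearMap.lTensor_tmul, mul_assoc, hU]
      generalize comul (R := k) b = Y
      induction Y with
      | zero => simp
      | add X Y hX hY => simp only [TensorProduct.tmul_add, map_add, mul_add, hX, hY]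
      | tmul b c => simp [mul_assoc]
  rw [lift_mul, Coalgebra.coassoc_symm_apply, sandwich_mul_antipode_comul]
  simp

theorem sandwich_comul_of_mul_lift {f g : A →ₐ[k] M} {h : ∀ a b, Commute (g a) (f b)} {W : M}
    (hW : ∀ a, g a * W = W * lift g f h (comul (R := k) a)) (a : A) :
    sandwich (g : A →ₗ[k] M) ((f : A →ₗ[k] M) ∘ₗ antipode k) W (comul (R := k) a) = W * g a := by
  have sandwich_eq (X : A ⊗[k] A) :
      sandwich (g : A →ₗ[k] M) ((f : A →ₗ[k] M) ∘ₗ antipode k) W X =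
      W * sandwich (g : A →ₗ[k] M)
        ((f : A →ₗ[k] M) ∘ₗ LinearMap.mul' k A ∘ₗ (antipode k).lTensor A) 1
        (TensorProduct.assoc k A A A ((comul (R := k)).rTensor A X)) := by
    induction X with
    | zero => simp
    | add X Y hX hY => simp only [map_add, mul_add, hX, hY]
    | tmul a b =>
      have expand : sandwich (g : A →ₗ[k] M) ((f : A →ₗ[k] M) ∘ₗ antipode k) W (a ⊗ₜ b) =
          W * lift g f h (comul (R := k) a) * f (antipode k b) := by
        rw [← hW]; simp
      rw [expand, LinearMap.rTensor_tmul]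
      generalize comul (R := k) a = Y
      induction Y with
      | zero => simp
      | add X Y hX hY => simp only [TensorProduct.add_tmul, map_add, mul_add, add_mul, hX, hY]
      | tmul c d => simp [mul_assoc]
  rw [sandwich_eq, Coalgebra.coassoc_apply, sandwich_comul_mul_antipode]
  simp

theorem antipode_antipode_mul_of_sandwich {c : A}
    (hc : ∀ a, sandwich (antipode k) LinearMap.id c
      (TensorProduct.comm k A A (comul (R := k) a)) = counit (R := k) a • c) (a : A) :
    antipode k (antipode k a) * c = c * a := by
  -- Both sides are values of `a ⊗ b ⊗ d ↦ S(b S(d)) c a` at the iterated co-product of `a`.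
  let Φ : A ⊗[k] (A ⊗[k] A) →ₗ[k] A :=
    sandwich (antipode k ∘ₗ LinearMap.mul' k A ∘ₗ (antipode k).lTensor A) LinearMap.id c ∘ₗ
      (TensorProduct.comm k A (A ⊗[k] A)).toLinearMap
  have contract_left (X : A ⊗[k] A) :
      Φ (TensorProduct.assoc k A A A ((comul (R := k)).rTensor A X)) =
        antipode k (antipode k (TensorProduct.lid k A ((counit (R := k)).rTensor A X))) * c := by
    induction X with
    | zero => simp
    | add X Y hX hY => simp only [map_add, add_mul, hX, hY]
    | tmul a b =>
      have expand : antipode k (antipode k (TensorProduct.lid k A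
          ((counit (R := k)).rTensor A (a ⊗ₜ b)))) * c =
          antipode k (antipode k b) * sandwich (antipode k) LinearMap.id c
            (TensorProduct.comm k A A (comul (R := k) a)) := by
        rw [hc]; simp
      rw [expand, LinearMap.rTensor_tmul]
      generalize comul (R := k) a = Y
      induction Y with
      | zero => simp
      | add X Y hX hY => simp only [TensorProduct.add_tmul, map_add, mul_add, hX, hY]
      | tmul c d => simp [Φ, antipode_mul_antidistrib, mul_assoc]
  have contract_right (X : A ⊗[k] A) : Φ ((comul (R := k)).lTensor A X) =
      c * TensorProduct.rid k A ((counit (R := k)).lTensor A X) := by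
    induction X with
    | zero => simp
    | add X Y hX hY => simp only [map_add, mul_add, hX, hY]
    | tmul a b => simp [Φ, Algebra.algebraMap_eq_smul_one]
  have h := contract_left (comul (R := k) a)
  rw [Coalgebra.coassoc_apply, contract_right] at h
  simpa using h.symm

end Sandwich

section ComulLift

variable {k A M : Type*} [CommSemiring k] [Semiring A] [Bialgebra k A] [Semiring M] [Algebra k M]

/-- The convolution product `a ↦ (f₁ ⊗ f₂)(Δ(a))` of two homomorphisms with commuting images. -/
def comulLift (f₁ f₂ : A →ₐ[k] M) (h : ∀ a b, Commute (f₁ a) (f₂ b)) : A →ₐ[k] M :=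
  (lift f₁ f₂ h).comp (Bialgebra.comulAlgHom k A)

theorem comulLift_apply (f₁ f₂ : A →ₐ[k] M) (h : ∀ a b, Commute (f₁ a) (f₂ b)) (a : A) :
    comulLift f₁ f₂ h a = lift f₁ f₂ h (comul (R := k) a) :=
  rfl

theorem commute_comulLift {f₁ f₂ : A →ₐ[k] M} {h : ∀ a b, Commute (f₁ a) (f₂ b)} {x : M}
    (h₁ : ∀ a, Commute x (f₁ a)) (h₂ : ∀ a, Commute x (f₂ a)) (a : A) :
    Commute x (comulLift f₁ f₂ h a) :=
  commute_lift (h := h) h₁ h₂ _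

variable (k A M) in
/-- The co-unit as a homomorphism into an arbitrary algebra: the neutral element for `comulLift`. -/
def counitHom : A →ₐ[k] M :=
  (Algebra.ofId k M).comp (Bialgebra.counitAlgHom k A)

theorem counitHom_apply (a : A) : counitHom k A M a = algebraMap k M (counit (R := k) a) :=
  rfl

theorem counitHom_commute (a : A) (x : M) : Commute (counitHom k A M a) x :=
  Algebra.commutes _ _

theorem lift_counitHom_left (g : A →ₐ[k] M) (h : ∀ a b, Commute (counitHom k A M a) (g b))
    (X : A ⊗[k] A) :
    lift (counitHom k A M) g h X = g (TensorProduct.lid k A ((counit (R := k)).rTensor A X)) := by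
  induction X with
  | zero => simp
  | add X Y hX hY => simp only [map_add, hX, hY]
  | tmul a b => simp [counitHom_apply, Algebra.algebraMap_eq_smul_one]

theorem comulLift_counitHom_left (g : A →ₐ[k] M)
    (h : ∀ a b, Commute (counitHom k A M a) (g b)) : comulLift (counitHom k A M) g h = g := by
  ext a
  rw [comulLift_apply, lift_counitHom_left]
  simp

end ComulLift

section Legs

variable {A : Type*} [Ring A] [HopfAlgebra ℂ A]

@[simp] theorem swap_tmul (a b : A) : swap A (a ⊗ₜ b) = b ⊗ₜ a :=
  rfl

@[simp] theorem swap_swap (X : A ⊗[ℂ] A) : swap A (swap A X) = X :=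
  (TensorProduct.comm ℂ A A).symm_apply_apply X

theorem swap_star [StarRing A] [StarModule ℂ A] (X : A ⊗[ℂ] A) :
    swap A (star X) = star (swap A X) := by
  induction X with
  | zero => simp
  | add X Y hX hY => simp only [map_add, star_add, hX, hY]
  | tmul a b => simp

variable {M : Type*} [Ring M] [Algebra ℂ M]

theorem lift_swap (f g : A →ₐ[ℂ] M) (h : ∀ a b, Commute (f a) (g b)) (X : A ⊗[ℂ] A) :
    lift f g h (swap A X) = lift g f (fun a b => (h b a).symm) X := by
  induction X with
  | zero => simp
  | add X Y hX hY => simp only [map_add, hX, hY]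
  | tmul a b => simpa using (h b a).eq

variable (f₁ f₂ f₃ : A →ₐ[ℂ] M) (h₁₂ : ∀ a b, Commute (f₁ a) (f₂ b))
  (h₁₃ : ∀ a b, Commute (f₁ a) (f₃ b)) (h₂₃ : ∀ a b, Commute (f₂ a) (f₃ b))

/-- The homomorphism `a ⊗ (b ⊗ c) ↦ f₁(a) f₂(b) f₃(c)`, which turns identities between the legs of
an `R`-matrix into identities in `M`. -/
def tripleLift : A ⊗[ℂ] (A ⊗[ℂ] A) →ₐ[ℂ] M :=
  lift f₁ (lift f₂ f₃ h₂₃) fun a => commute_lift (h₁₂ a) (h₁₃ a)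

theorem tripleLift_leg12 (X : A ⊗[ℂ] A) :
    tripleLift f₁ f₂ f₃ h₁₂ h₁₃ h₂₃ (leg12 A X) = lift f₁ f₂ h₁₂ X := by
  induction X with
  | zero => simp
  | add X Y hX hY => simp only [map_add, hX, hY]
  | tmul a b => simp [tripleLift, leg12]

theorem tripleLift_leg13 (X : A ⊗[ℂ] A) :
    tripleLift f₁ f₂ f₃ h₁₂ h₁₃ h₂₃ (leg13 A X) = lift f₁ f₃ h₁₃ X := by
  induction X with
  | zero => simp
  | add X Y hX hY => simp only [map_add, hX, hY]
  | tmul a b => simp [tripleLift, leg13]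

theorem tripleLift_leg23 (X : A ⊗[ℂ] A) :
    tripleLift f₁ f₂ f₃ h₁₂ h₁₃ h₂₃ (leg23 A X) = lift f₂ f₃ h₂₃ X := by
  simp [tripleLift, leg23]

theorem tripleLift_comulId (X : A ⊗[ℂ] A) :
    tripleLift f₁ f₂ f₃ h₁₂ h₁₃ h₂₃ (comulId A X) =
      lift (comulLift f₁ f₂ h₁₂) f₃
        (fun a b => (commute_comulLift (fun c => (h₁₃ c b).symm) (fun c => (h₂₃ c b).symm) a).symm)
        X := by
  induction X with
  | zero => simp
  | add X Y hX hY => simp only [map_add, hX, hY]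
  | tmul a b =>
    simp only [lift_tmul, comulLift_apply, comulId, AlgHom.comp_apply,
      Algebra.TensorProduct.map_tmul, Bialgebra.comulAlgHom_apply, AlgHom.id_apply]
    generalize comul (R := ℂ) a = Y
    induction Y with
    | zero => simp
    | add X Y hX hY => simp only [TensorProduct.add_tmul, map_add, add_mul, hX, hY]
    | tmul b c => simp [tripleLift, mul_assoc]

theorem tripleLift_idComul (X : A ⊗[ℂ] A) :
    tripleLift f₁ f₂ f₃ h₁₂ h₁₃ h₂₃ (idComul A X) =
      lift f₁ (comulLift f₂ f₃ h₂₃) (fun a => commute_comulLift (h₁₂ a) (h₁₃ a)) X := by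
  induction X with
  | zero => simp
  | add X Y hX hY => simp only [map_add, hX, hY]
  | tmul a b => simp [comulLift_apply, idComul, tripleLift]

end Legs

/-! ### Quasitriangular Hopf algebras -/

section Drinfeld

variable {A : Type*} [Ring A] [HopfAlgebra ℂ A]

variable (A) in
/-- The contraction `a ⊗ b ↦ S(a) b`. -/
def antipodeMul : A ⊗[ℂ] A →ₗ[ℂ] A :=
  LinearMap.mul' ℂ A ∘ₗ (antipode ℂ).rTensor A

@[simp] theorem antipodeMul_tmul (a b : A) : antipodeMul A (a ⊗ₜ b) = antipode ℂ a * b := by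
  simp [antipodeMul]

variable (A) in
/-- The contraction `a ⊗ (b ⊗ c) ↦ S(a) b ⊗ c` of the first two legs. -/
def antipodeMulLeft : A ⊗[ℂ] (A ⊗[ℂ] A) →ₗ[ℂ] A ⊗[ℂ] A :=
  (antipodeMul A).rTensor A ∘ₗ (TensorProduct.assoc ℂ A A A).symm.toLinearMap

@[simp] theorem antipodeMulLeft_tmul (a b c : A) :
    antipodeMulLeft A (a ⊗ₜ (b ⊗ₜ c)) = (antipode ℂ a * b) ⊗ₜ c := by
  simp [antipodeMulLeft]

theorem antipodeMul_mul_tmul (X : A ⊗[ℂ] A) (c b : A) :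
    antipodeMul A (X * (c ⊗ₜ b)) = antipode ℂ c * antipodeMul A X * b := by
  induction X with
  | zero => simp
  | add X Y hX hY => simp only [add_mul, mul_add, map_add, hX, hY]
  | tmul r s => simp [antipode_mul_antidistrib, mul_assoc]

theorem antipodeMul_comul (a : A) :
    antipodeMul A (comul (R := ℂ) a) = algebraMap ℂ A (counit (R := ℂ) a) :=
  mul_antipode_rTensor_comul_apply a

theorem antipodeMul_comul_mul (a : A) (X : A ⊗[ℂ] A) :
    antipodeMul A (comul (R := ℂ) a * X) = counit (R := ℂ) a • antipodeMul A X := by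
  induction X with
  | zero => simp
  | add X Y hX hY => simp only [mul_add, map_add, hX, hY, smul_add]
  | tmul r s =>
    rw [antipodeMul_mul_tmul, antipodeMul_comul, Algebra.algebraMap_eq_smul_one]
    simp

theorem antipodeMulLeft_comulId (X : A ⊗[ℂ] A) :
    antipodeMulLeft A (comulId A X) =
      1 ⊗ₜ TensorProduct.lid ℂ A ((counit (R := ℂ)).rTensor A X) := by
  induction X with
  | zero => simp
  | add X Y hX hY => simp only [map_add, hX, hY, TensorProduct.tmul_add]
  | tmul a b =>
    have contract : antipodeMulLeft A (comulId A (a ⊗ₜ b)) =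
        antipodeMul A (comul (R := ℂ) a) ⊗ₜ b := by
      simp only [comulId, AlgHom.comp_apply, Algebra.TensorProduct.map_tmul,
        Bialgebra.comulAlgHom_apply, AlgHom.id_apply]
      generalize comul (R := ℂ) a = Y
      induction Y with
      | zero => simp
      | add X Y hX hY => simp only [TensorProduct.add_tmul, map_add, hX, hY]
      | tmul b c => simp
    rw [contract, antipodeMul_comul, Algebra.algebraMap_eq_smul_one, TensorProduct.smul_tmul]
    simp

theorem antipodeMulLeft_leg13_mul_leg23 (X Y : A ⊗[ℂ] A) :
    antipodeMulLeft A (leg13 A X * leg23 A Y) = (antipode ℂ).rTensor A X * Y := by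
  induction X with
  | zero => simp
  | add X X' hX hX' => simp only [map_add, add_mul, hX, hX']
  | tmul a b =>
    induction Y with
    | zero => simp
    | add Y Y' hY hY' => simp only [map_add, mul_add, hY, hY']
    | tmul c d => simp [leg13, leg23]

theorem antipodeMulLeft_leg12_mul_leg13 (X Y : A ⊗[ℂ] A) :
    antipodeMulLeft A (leg12 A X * leg13 A Y) =
      (LinearMap.mulRight ℂ (antipodeMul A X) ∘ₗ antipode ℂ).rTensor A Y := by
  induction Y with
  | zero => simp
  | add Y Y' hY hY' => simp only [map_add, mul_add, hY, hY']
  | tmul c d =>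
    induction X with
    | zero => simp
    | add X X' hX hX' =>
      simp only [map_add, add_mul, hX, hX', LinearMap.rTensor_tmul, LinearMap.comp_apply,
        LinearMap.mulRight_apply, mul_add, TensorProduct.add_tmul]
    | tmul a b => simp [leg12, leg13, antipode_mul_antidistrib, mul_assoc]

end Drinfeld

/-- `R` is a universal `R`-matrix of the Hopf algebra `A`. This is the part of the structure of a
ribbon Hopf-*-algebra that involves neither the conjugation nor the ribbon element. -/
structure IsQuasitriangular {A : Type*} [Ring A] [HopfAlgebra ℂ A] (R : (A ⊗[ℂ] A)ˣ) : Prop where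
  R_comul : ∀ a : A,
    (R : A ⊗[ℂ] A) * comul (R := ℂ) a = swap A (comul (R := ℂ) a) * R
  comulId_R : comulId A R = leg13 A R * leg23 A R
  idComul_R : idComul A R = leg13 A R * leg12 A R

/-- The element `∑ S(r¹) r²` for `R⁻¹ = ∑ r¹ ⊗ r²`; it is the inverse of `S(u)`. -/
def antipodeDrinfeldInv {A : Type*} [Ring A] [HopfAlgebra ℂ A] (R : (A ⊗[ℂ] A)ˣ) : A :=
  antipodeMul A ((R⁻¹ : (A ⊗[ℂ] A)ˣ) : A ⊗[ℂ] A)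

namespace IsQuasitriangular

variable {A M : Type*} [Ring A] [HopfAlgebra ℂ A] {R : (A ⊗[ℂ] A)ˣ} [Ring M] [Algebra ℂ M]

theorem inv_mul_swap_comul (hR : IsQuasitriangular R) (a : A) :
    (↑R⁻¹ : A ⊗[ℂ] A) * swap A (comul (R := ℂ) a) = comul (R := ℂ) a * ↑R⁻¹ := by
  rw [Units.inv_mul_eq_iff_eq_mul, ← mul_assoc, hR.R_comul, mul_assoc, Units.mul_inv, mul_one]

section Fusion

variable {f₁ f₂ f₃ : A →ₐ[ℂ] M} {h₁₂ : ∀ a b, Commute (f₁ a) (f₂ b)}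
  {h₁₃ : ∀ a b, Commute (f₁ a) (f₃ b)} {h₂₃ : ∀ a b, Commute (f₂ a) (f₃ b)}

theorem lift_comulLift_left (hR : IsQuasitriangular R)
    (h : ∀ a b, Commute (comulLift f₁ f₂ h₁₂ a) (f₃ b)) :
    lift (comulLift f₁ f₂ h₁₂) f₃ h (R : A ⊗[ℂ] A) = lift f₁ f₃ h₁₃ ↑R * lift f₂ f₃ h₂₃ ↑R := by
  rw [← tripleLift_comulId f₁ f₂ f₃ h₁₂ h₁₃ h₂₃, hR.comulId_R, map_mul, tripleLift_leg13,
    tripleLift_leg23]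

theorem lift_comulLift_right (hR : IsQuasitriangular R)
    (h : ∀ a b, Commute (f₁ a) (comulLift f₂ f₃ h₂₃ b)) :
    lift f₁ (comulLift f₂ f₃ h₂₃) h (R : A ⊗[ℂ] A) = lift f₁ f₃ h₁₃ ↑R * lift f₁ f₂ h₁₂ ↑R := by
  rw [← tripleLift_idComul f₁ f₂ f₃ h₁₂ h₁₃ h₂₃, hR.idComul_R, map_mul, tripleLift_leg13,
    tripleLift_leg12]

theorem yang_baxter (hR : IsQuasitriangular R) :
    lift f₁ f₂ h₁₂ (R : A ⊗[ℂ] A) * (lift f₁ f₃ h₁₃ ↑R * lift f₂ f₃ h₂₃ ↑R) =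
      lift f₂ f₃ h₂₃ ↑R * lift f₁ f₃ h₁₃ ↑R * lift f₁ f₂ h₁₂ ↑R := by
  have h₂₁ (a b) : Commute (f₂ a) (f₁ b) := (h₁₂ b a).symm
  have commute_f₃ (f f' : A →ₐ[ℂ] M) (h : ∀ a b, Commute (f a) (f' b))
      (hf : ∀ a b, Commute (f a) (f₃ b)) (hf' : ∀ a b, Commute (f' a) (f₃ b)) (a b) :
      Commute (comulLift f f' h a) (f₃ b) :=
    (commute_comulLift (fun c => (hf c b).symm) (fun c => (hf' c b).symm) a).symm
  rw [← hR.lift_comulLift_left (commute_f₃ f₁ f₂ h₁₂ h₁₃ h₂₃),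
    ← hR.lift_comulLift_left (commute_f₃ f₂ f₁ h₂₁ h₂₃ h₁₃)]
  refine semiconjBy_lift (fun a => ?_) (fun b => ?_) _
  · rw [SemiconjBy, comulLift_apply, comulLift_apply, ← map_mul, hR.R_comul, map_mul, lift_swap]
  · exact (commute_lift (fun a => (h₁₃ a b).symm) (fun a => (h₂₃ a b).symm) _).symm

theorem mul_lift (hR : IsQuasitriangular R) {V : M} (hV₁ : ∀ a, Commute V (f₁ a))
    (hV₃ : ∀ a, V * f₃ a = lift f₂ f₃ h₂₃ (comul (R := ℂ) a) * V) :
    V * lift f₁ f₃ h₁₃ (R : A ⊗[ℂ] A) = lift f₁ f₃ h₁₃ ↑R * lift f₁ f₂ h₁₂ ↑R * V := by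
  rw [← hR.lift_comulLift_right (h₂₃ := h₂₃) fun a => commute_comulLift (h₁₂ a) (h₁₃ a)]
  exact semiconjBy_lift hV₁ hV₃ _

theorem lift_mul (hR : IsQuasitriangular R) {V : M} (hV₂ : ∀ a, Commute V (f₂ a))
    (hV₃ : ∀ a, f₃ a * V = V * lift f₁ f₃ h₁₃ (comul (R := ℂ) a)) :
    lift f₂ f₃ h₂₃ (R : A ⊗[ℂ] A) * V =
      V * (lift f₂ f₃ h₂₃ ↑R * lift f₁ f₂ h₁₂ (swap A R)) := by
  have h₂₁ (a b) : Commute (f₂ a) (f₁ b) := (h₁₂ b a).symm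
  rw [lift_swap, ← hR.lift_comulLift_right (h₂₃ := h₁₃)
    fun a => commute_comulLift (h₂₁ a) (h₂₃ a)]
  exact (semiconjBy_lift (g := comulLift f₁ f₃ h₁₃) hV₂ (fun a => (hV₃ a).symm) _).symm

end Fusion

section Counit

variable {f : A →ₐ[ℂ] M}

/-- The fusion rules make these values of `R` idempotent, and they are invertible. -/
theorem lift_counitHom_left (hR : IsQuasitriangular R)
    (h : ∀ a b, Commute (counitHom ℂ A M a) (f b)) :
    lift (counitHom ℂ A M) f h (R : A ⊗[ℂ] A) = 1 := by
  let E : Mˣ := Units.map (lift (counitHom ℂ A M) f h : A ⊗[ℂ] A →* M) R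
  have idem : E * E = E := by
    have fusion := hR.lift_comulLift_left (f₁ := counitHom ℂ A M) (f₂ := counitHom ℂ A M)
      (h₁₂ := fun a b => counitHom_commute a _) (h₁₃ := h) (h₂₃ := h)
      (by simpa only [comulLift_counitHom_left] using h)
    simp only [comulLift_counitHom_left] at fusion
    exact Units.ext fusion.symm
  exact congrArg Units.val (mul_eq_left.mp idem)

theorem lift_counitHom_right (hR : IsQuasitriangular R)
    (h : ∀ a b, Commute (f a) (counitHom ℂ A M b)) :
    lift f (counitHom ℂ A M) h (R : A ⊗[ℂ] A) = 1 := by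
  let E : Mˣ := Units.map (lift f (counitHom ℂ A M) h : A ⊗[ℂ] A →* M) R
  have idem : E * E = E := by
    have fusion := hR.lift_comulLift_right (f₂ := counitHom ℂ A M) (f₃ := counitHom ℂ A M)
      (h₂₃ := fun a b => counitHom_commute a _) (h₁₃ := h) (h₁₂ := h)
      (by simpa only [comulLift_counitHom_left] using h)
    simp only [comulLift_counitHom_left] at fusion
    exact Units.ext fusion.symm
  exact congrArg Units.val (mul_eq_left.mp idem)

theorem counit_rTensor (hR : IsQuasitriangular R) :
    TensorProduct.lid ℂ A ((counit (R := ℂ)).rTensor A (R : A ⊗[ℂ] A)) = 1 :=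
  (LatticeGauge.lift_counitHom_left (AlgHom.id ℂ A) _ _).symm.trans
    (hR.lift_counitHom_left fun a b => counitHom_commute a b)

end Counit

theorem antipode_rTensor (hR : IsQuasitriangular R) :
    (antipode ℂ).rTensor A (R : A ⊗[ℂ] A) = ↑R⁻¹ := by
  refine Units.eq_inv_of_mul_eq_one_right ?_
  rw [← antipodeMulLeft_leg13_mul_leg23, ← hR.comulId_R, antipodeMulLeft_comulId,
    hR.counit_rTensor, Algebra.TensorProduct.one_def]

theorem idComul_inv (hR : IsQuasitriangular R) :
    idComul A (↑R⁻¹ : A ⊗[ℂ] A) = leg12 A ↑R⁻¹ * leg13 A ↑R⁻¹ := by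
  refine left_inv_eq_right_inv (a := idComul A R) ?_ ?_
  · rw [← map_mul, Units.inv_mul, map_one]
  · rw [hR.idComul_R, mul_assoc, ← mul_assoc (leg12 A R), ← map_mul (leg12 A), Units.mul_inv,
      map_one, one_mul, ← map_mul, Units.mul_inv, map_one]

theorem antipode_antipode_mul_antipodeDrinfeldInv (hR : IsQuasitriangular R) (a : A) :
    antipode ℂ (antipode ℂ a) * antipodeDrinfeldInv R = antipodeDrinfeldInv R * a := by
  refine antipode_antipode_mul_of_sandwich (fun a => ?_) a
  have sandwich_eq (X : A ⊗[ℂ] A) :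
      sandwich (antipode ℂ) LinearMap.id (antipodeDrinfeldInv R) X =
        antipodeMul A (↑R⁻¹ * X) := by
    induction X with
    | zero => simp
    | add X Y hX hY => simp only [map_add, mul_add, hX, hY]
    | tmul a b => simp [antipodeMul_mul_tmul, antipodeDrinfeldInv]
  exact (sandwich_eq _).trans <| (congrArg _ (hR.inv_mul_swap_comul a)).trans
    (antipodeMul_comul_mul a _)

theorem antipode_drinfeldElt_mul_antipodeDrinfeldInv (hR : IsQuasitriangular R) :
    antipode ℂ (drinfeldElt (R : A ⊗[ℂ] A)) * antipodeDrinfeldInv R = 1 := by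
  have move_inside (X : A ⊗[ℂ] A) :
      antipode ℂ (drinfeldElt X) * antipodeDrinfeldInv R = antipodeMul A (↑R⁻¹ * X) := by
    induction X with
    | zero => simp [drinfeldElt]
    | add X Y hX hY =>
      simp only [drinfeldElt] at hX hY
      simp only [drinfeldElt, map_add, add_mul, mul_add, hX, hY]
    | tmul a b =>
      simp only [drinfeldElt, swap_tmul, LinearMap.rTensor_tmul, LinearMap.mul'_apply,
        antipode_mul_antidistrib, mul_assoc, antipodeMul_mul_tmul,
        hR.antipode_antipode_mul_antipodeDrinfeldInv]
      rw [antipodeDrinfeldInv]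
  rw [move_inside, Units.inv_mul, Algebra.TensorProduct.one_def]
  simp

/-- In Sweedler notation, `∑ S(u) S(r¹) r²₍₁₎ ⊗ r²₍₂₎ = R` for `R⁻¹ = ∑ r¹ ⊗ r²`. -/
theorem antipode_drinfeldElt_mul_antipodeMulLeft (hR : IsQuasitriangular R) :
    (antipode ℂ (drinfeldElt (R : A ⊗[ℂ] A)) ⊗ₜ[ℂ] (1 : A)) * antipodeMulLeft A (idComul A ↑R⁻¹) =
      R := by
  have cancel (X : A ⊗[ℂ] A) : (antipode ℂ (drinfeldElt (R : A ⊗[ℂ] A)) ⊗ₜ[ℂ] (1 : A)) *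
      (LinearMap.mulRight ℂ (antipodeDrinfeldInv R) ∘ₗ antipode ℂ).rTensor A
        ((antipode ℂ).rTensor A X) = X := by
    induction X with
    | zero => simp
    | add X Y hX hY => simp only [map_add, mul_add, hX, hY]
    | tmul a b =>
      simp [hR.antipode_antipode_mul_antipodeDrinfeldInv, ← mul_assoc,
        hR.antipode_drinfeldElt_mul_antipodeDrinfeldInv]
  rw [hR.idComul_inv, antipodeMulLeft_leg12_mul_leg13, ← antipodeDrinfeldInv]
  conv_lhs => rw [← hR.antipode_rTensor]
  exact cancel _

theorem antipode_drinfeldElt_mul_sandwich (hR : IsQuasitriangular R) {f g : A →ₐ[ℂ] M}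
    (h : ∀ a b, Commute (f a) (g b)) {V : M}
    (hV : ∀ a, V * g a = lift f g h (comul (R := ℂ) a) * V) :
    f (antipode ℂ (drinfeldElt (R : A ⊗[ℂ] A))) *
        sandwich ((f : A →ₗ[ℂ] M) ∘ₗ antipode ℂ) (g : A →ₗ[ℂ] M) V ↑R⁻¹ =
      lift f g h ↑R * V := by
  have sandwich_eq (X : A ⊗[ℂ] A) :
      sandwich ((f : A →ₗ[ℂ] M) ∘ₗ antipode ℂ) (g : A →ₗ[ℂ] M) V X =
        lift f g h (antipodeMulLeft A (idComul A X)) * V := by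
    induction X with
    | zero => simp
    | add X Y hX hY => simp only [map_add, add_mul, hX, hY]
    | tmul a b =>
      have expand : sandwich ((f : A →ₗ[ℂ] M) ∘ₗ antipode ℂ) (g : A →ₗ[ℂ] M) V (a ⊗ₜ b) =
          f (antipode ℂ a) * (lift f g h (comul (R := ℂ) b) * V) := by
        rw [← hV]; simp [mul_assoc]
      simp only [expand, idComul, Algebra.TensorProduct.map_tmul, AlgHom.id_apply,
        Bialgebra.comulAlgHom_apply]
      generalize comul (R := ℂ) b = Y
      induction Y with
      | zero => simp
      | add X Y hX hY => simp only [TensorProduct.tmul_add, map_add, mul_add, add_mul, hX, hY]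
      | tmul c d => simp [mul_assoc]
  have on_left : f (antipode ℂ (drinfeldElt (R : A ⊗[ℂ] A))) =
      lift f g h (antipode ℂ (drinfeldElt (R : A ⊗[ℂ] A)) ⊗ₜ 1) := by simp
  rw [sandwich_eq, on_left, ← mul_assoc, ← map_mul, hR.antipode_drinfeldElt_mul_antipodeMulLeft]

end IsQuasitriangular

section Ribbon

variable (A : Type*) [Ring A] [HopfAlgebra ℂ A] [StarRing A] [StarModule ℂ A]
  [RibbonHopfStarAlgebra A]

/-- The `R`-matrix as a tensor, for use under homomorphisms out of `A ⊗ A`. -/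
abbrev rMatrix : A ⊗[ℂ] A :=
  ((RibbonHopfStarAlgebra.R : (A ⊗[ℂ] A)ˣ) : A ⊗[ℂ] A)

/-- The inverse of the `R`-matrix as a tensor. -/
abbrev rMatrixInv : A ⊗[ℂ] A :=
  (((RibbonHopfStarAlgebra.R : (A ⊗[ℂ] A)ˣ)⁻¹ : (A ⊗[ℂ] A)ˣ) : A ⊗[ℂ] A)

theorem isQuasitriangular : IsQuasitriangular (RibbonHopfStarAlgebra.R : (A ⊗[ℂ] A)ˣ) where
  R_comul := RibbonHopfStarAlgebra.R_comul
  comulId_R := RibbonHopfStarAlgebra.comulId_R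
  idComul_R := RibbonHopfStarAlgebra.idComul_R

variable {A}

theorem rMatrix_mul_rMatrixInv : rMatrix A * rMatrixInv A = 1 :=
  Units.mul_inv _

theorem rMatrixInv_mul_rMatrix : rMatrixInv A * rMatrix A = 1 :=
  Units.inv_mul _

theorem star_rMatrix : star (rMatrix A) = swap A (rMatrixInv A) := by
  rw [rMatrixInv, ← RibbonHopfStarAlgebra.R_star, flipStar, swap_swap]

theorem star_rMatrixInv : star (rMatrixInv A) = swap A (rMatrix A) := by
  rw [eq_comm, ← star_inj, star_star, ← swap_star, star_rMatrix, swap_swap]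

theorem star_comul (a : A) : star (comul (R := ℂ) a) = swap A (comul (R := ℂ) (star a)) := by
  rw [RibbonHopfStarAlgebra.comul_star, flipStar, swap_swap]

end Ribbon

/-! ### Matrices over an algebra -/

section MatrixOver

variable {A A' B : Type*} [Ring A] [Algebra ℂ A] [Ring A'] [Algebra ℂ A'] [Ring B] [Algebra ℂ B]
variable {m n : Type*}

section Rectangular

/-- A complex matrix, read as a matrix with entries in the algebra `B`. Rectangular matrices are
needed for the intertwiners. -/
def constMap (B : Type*) [Ring B] [Algebra ℂ B] (T : Matrix n m ℂ) : Matrix n m B :=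
  T.map (algebraMap ℂ B)

theorem constMap_mul [Fintype m] (T : Matrix n m ℂ) {k : Type*} (T' : Matrix m k ℂ) :
    constMap B (T * T') = constMap B T * constMap B T' :=
  Matrix.map_mul

theorem constMap_mul_mul_constMap_apply [Fintype m] [Fintype n] {k l : Type*} (T : Matrix k m ℂ)
    (X : Matrix m n B) (T' : Matrix n l ℂ) (p : k) (q : l) :
    (constMap B T * X * constMap B T') p q = ∑ d, ∑ c, (T p c * T' d q) • X c d := by
  rw [Matrix.mul_apply]
  refine Finset.sum_congr rfl fun d _ => ?_
  rw [Matrix.mul_apply, Finset.sum_mul]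
  refine Finset.sum_congr rfl fun c _ => ?_
  rw [constMap, constMap, Matrix.map_apply, Matrix.map_apply, ← Algebra.commutes,
    ← Algebra.smul_def, ← Algebra.smul_def, smul_smul, mul_comm]

end Rectangular

variable [Fintype m] [DecidableEq m] [Fintype n] [DecidableEq n]

/-- The inclusion of the complex matrices into the matrices over the algebra `B`. -/
def constHom (B m : Type*) [Ring B] [Algebra ℂ B] [Fintype m] [DecidableEq m] :
    Matrix m m ℂ →ₐ[ℂ] Matrix m m B :=
  (Algebra.ofId ℂ B).mapMatrix

@[simp] theorem constHom_apply (P : Matrix m m ℂ) (a b : m) :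
    constHom B m P a b = algebraMap ℂ B (P a b) := rfl

/-- The elements of `B` as multiples of the unit matrix. -/
def diagHom (B m : Type*) [Ring B] [Algebra ℂ B] [Fintype m] [DecidableEq m] :
    B →ₐ[ℂ] Matrix m m B :=
  Matrix.scalarAlgHom m ℂ

theorem diagHom_mul_apply (b : B) (X : Matrix m m B) (p q : m) :
    (diagHom B m b * X) p q = b * X p q := by
  simp [diagHom, Matrix.scalar_apply]

theorem mul_diagHom_apply (b : B) (X : Matrix m m B) (p q : m) :
    (X * diagHom B m b) p q = X p q * b := by
  simp [diagHom, Matrix.scalar_apply]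

theorem diagHom_commute_iff {b : B} {X : Matrix m m B} :
    Commute (diagHom B m b) X ↔ ∀ p q, Commute b (X p q) := by
  simp only [commute_iff_eq, ← Matrix.ext_iff, diagHom_mul_apply, mul_diagHom_apply]

theorem constHom_commute_diagHom (P : Matrix m m ℂ) (b : B) :
    Commute (constHom B m P) (diagHom B m b) := by
  refine (diagHom_commute_iff.2 fun p q => ?_).symm
  exact (Algebra.commutes _ b).symm

/-- `ρ ⊗ g`, with values in the matrices over `B`: the paper writes `(ρ ⊗ id)(R)` for such a matrix
of algebra elements. -/
def matLift (ρ : A →ₐ[ℂ] Matrix m m ℂ) (g : A' →ₐ[ℂ] B) : A ⊗[ℂ] A' →ₐ[ℂ] Matrix m m B :=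
  lift ((constHom B m).comp ρ) ((diagHom B m).comp g)
    fun _ _ => constHom_commute_diagHom _ _

theorem matLift_tmul (ρ : A →ₐ[ℂ] Matrix m m ℂ) (g : A' →ₐ[ℂ] B) (a : A) (b : A') :
    matLift ρ g (a ⊗ₜ b) = constHom B m (ρ a) * diagHom B m (g b) :=
  lift_tmul _ _ _ a b

theorem matLift_tmul_apply (ρ : A →ₐ[ℂ] Matrix m m ℂ) (g : A' →ₐ[ℂ] B) (a : A) (b : A')
    (p q : m) : matLift ρ g (a ⊗ₜ b) p q = ρ a p q • g b := by
  rw [matLift_tmul, mul_diagHom_apply, constHom_apply, Algebra.smul_def]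

theorem matLift_apply (ρ : A →ₐ[ℂ] Matrix m m ℂ) (g : A' →ₐ[ℂ] B) (X : A ⊗[ℂ] A') (p q : m) :
    matLift ρ g X p q = g (slice ρ p q X) := by
  induction X with
  | zero => simp
  | add X Y hX hY => simp only [map_add, Matrix.add_apply, hX, hY]
  | tmul a b => rw [matLift_tmul_apply]; simp [slice]

theorem slice_mul (ρ : A →ₐ[ℂ] Matrix m m ℂ) (X Y : A ⊗[ℂ] B) (p q : m) :
    slice ρ p q (X * Y) = ∑ k, slice ρ p k X * slice ρ k q Y := by
  have slice_eq (Z : A ⊗[ℂ] B) (p q : m) : slice ρ p q Z = matLift ρ (AlgHom.id ℂ B) Z p q :=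
    (matLift_apply ρ (AlgHom.id ℂ B) Z p q).symm
  simp only [slice_eq, map_mul, Matrix.mul_apply]

theorem slice_algebraMap (ρ : A →ₐ[ℂ] Matrix m m ℂ) (c : ℂ) (p q : m) :
    slice ρ p q (algebraMap ℂ (A ⊗[ℂ] B) c) = if p = q then algebraMap ℂ B c else 0 := by
  have h := matLift_apply ρ (AlgHom.id ℂ B) (algebraMap ℂ (A ⊗[ℂ] B) c) p q
  rw [AlgHom.commutes, Matrix.algebraMap_matrix_apply] at h
  exact h.symm

theorem constMap_mul_diagHom (T : Matrix n m ℂ) (b : B) :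
    constMap B T * diagHom B m b = diagHom B n b * constMap B T := by
  ext p q
  simp [diagHom, Matrix.scalar_apply, constMap, Algebra.commutes]

theorem constMap_mul_matLift {T : Matrix n m ℂ} {ρ : A →ₐ[ℂ] Matrix m m ℂ}
    {σ : A →ₐ[ℂ] Matrix n n ℂ} (h : ∀ a, T * ρ a = σ a * T) (g : A' →ₐ[ℂ] B) (X : A ⊗[ℂ] A') :
    constMap B T * matLift ρ g X = matLift σ g X * constMap B T := by
  induction X with
  | zero => simp
  | add X Y hX hY => simp only [map_add, Matrix.mul_add, Matrix.add_mul, hX, hY]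
  | tmul a b =>
    have intertwine : constMap B T * constHom B m (ρ a) = constHom B n (σ a) * constMap B T :=
      (constMap_mul T (ρ a)).symm.trans ((congrArg (constMap B) (h a)).trans (constMap_mul _ _))
    rw [matLift_tmul, matLift_tmul, ← Matrix.mul_assoc, intertwine, Matrix.mul_assoc,
      constMap_mul_diagHom, ← Matrix.mul_assoc]

variable (B m n) in
/-- The embedding `X ↦ X ⊗ 1`. The entries of `B` need not commute, so `X ⊗ Y` has to be written as
one of the products `kronLeft X * kronRight Y` and `kronRight Y * kronLeft X`. -/
def kronLeft : Matrix m m B →ₐ[ℂ] Matrix (m × n) (m × n) B :=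
  AlgHom.ofLinearMap
    { toFun := fun X => X ⊗ₖ (1 : Matrix n n B)
      map_add' := fun X Y => Matrix.add_kronecker X Y 1
      map_smul' := fun c X => Matrix.smul_kronecker c X 1 }
    Matrix.one_kronecker_one
    (fun X Y => by
      ext ⟨a, c⟩ ⟨b, d⟩
      simp [Matrix.mul_apply, Matrix.one_apply, Fintype.sum_prod_type])

variable (B m n) in
/-- The embedding `Y ↦ 1 ⊗ Y`; see `kronLeft`. -/
def kronRight : Matrix n n B →ₐ[ℂ] Matrix (m × n) (m × n) B :=
  AlgHom.ofLinearMap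
    { toFun := fun Y => (1 : Matrix m m B) ⊗ₖ Y
      map_add' := fun X Y => Matrix.kronecker_add 1 X Y
      map_smul' := fun c Y => Matrix.kronecker_smul c 1 Y }
    Matrix.one_kronecker_one
    (fun X Y => by
      ext ⟨a, c⟩ ⟨b, d⟩
      simp [Matrix.mul_apply, Matrix.one_apply, Fintype.sum_prod_type])

theorem kronLeft_apply (X : Matrix m m B) (p q : m × n) :
    kronLeft B m n X p q = if p.2 = q.2 then X p.1 q.1 else 0 := by
  change X p.1 q.1 * (1 : Matrix n n B) p.2 q.2 = _
  rw [Matrix.one_apply, mul_ite, mul_one, mul_zero]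

theorem kronRight_apply (X : Matrix n n B) (p q : m × n) :
    kronRight B m n X p q = if p.1 = q.1 then X p.2 q.2 else 0 := by
  change (1 : Matrix m m B) p.1 q.1 * X p.2 q.2 = _
  rw [Matrix.one_apply, ite_mul, one_mul, zero_mul]

theorem kronLeft_mul_kronRight_apply (X : Matrix m m B) (Y : Matrix n n B) (p q : m × n) :
    (kronLeft B m n X * kronRight B m n Y) p q = X p.1 q.1 * Y p.2 q.2 := by
  simp [Matrix.mul_apply, Fintype.sum_prod_type, kronLeft_apply, kronRight_apply]

theorem kronRight_mul_kronLeft_apply (X : Matrix m m B) (Y : Matrix n n B) (p q : m × n) :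
    (kronRight B m n Y * kronLeft B m n X) p q = Y p.2 q.2 * X p.1 q.1 := by
  simp [Matrix.mul_apply, Fintype.sum_prod_type, kronLeft_apply, kronRight_apply]

theorem kronLeft_commute_kronRight {X : Matrix m m B} {Y : Matrix n n B}
    (h : ∀ a b c d, Commute (X a b) (Y c d)) : Commute (kronLeft B m n X) (kronRight B m n Y) := by
  ext p q
  rw [kronLeft_mul_kronRight_apply, kronRight_mul_kronLeft_apply, (h _ _ _ _).eq]

theorem kronLeft_constHom_commute (P : Matrix m m ℂ) (Y : Matrix n n B) :
    Commute (kronLeft B m n (constHom B m P)) (kronRight B m n Y) :=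
  kronLeft_commute_kronRight fun _ _ _ _ => Algebra.commutes _ _

theorem kronRight_constHom_commute (P : Matrix n n ℂ) (X : Matrix m m B) :
    Commute (kronRight B m n (constHom B n P)) (kronLeft B m n X) :=
  (kronLeft_commute_kronRight fun _ _ _ _ => (Algebra.commutes _ _).symm).symm

theorem kronLeft_diagHom (b : B) : kronLeft B m n (diagHom B m b) = diagHom B (m × n) b := by
  ext ⟨a, c⟩ ⟨a', d⟩
  by_cases h : c = d <;> by_cases h' : a = a' <;>
    simp [kronLeft_apply, diagHom, Matrix.scalar_apply, h, h']

theorem kronRight_diagHom (b : B) : kronRight B m n (diagHom B n b) = diagHom B (m × n) b := by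
  ext ⟨a, c⟩ ⟨a', d⟩
  simp [kronRight_apply, diagHom, Matrix.scalar_apply, Matrix.diagonal_apply, ite_and]

variable (B m n) in
/-- The representation `ρ ⊗ 1` on the first tensor factor, over `B`. -/
def repLeft (ρ : A →ₐ[ℂ] Matrix m m ℂ) : A →ₐ[ℂ] Matrix (m × n) (m × n) B :=
  (kronLeft B m n).comp ((constHom B m).comp ρ)

variable (B m n) in
/-- The representation `1 ⊗ σ` on the second tensor factor, over `B`. -/
def repRight (σ : A →ₐ[ℂ] Matrix n n ℂ) : A →ₐ[ℂ] Matrix (m × n) (m × n) B :=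
  (kronRight B m n).comp ((constHom B n).comp σ)

variable (ρ : A →ₐ[ℂ] Matrix m m ℂ) (σ : A' →ₐ[ℂ] Matrix n n ℂ)

theorem repLeft_commute_repRight (a : A) (b : A') :
    Commute (repLeft B m n ρ a) (repRight B m n σ b) :=
  kronLeft_constHom_commute _ _

theorem repLeft_commute_diagHom (g : A' →ₐ[ℂ] B) (a : A) (b : A') :
    Commute (repLeft B m n ρ a) ((diagHom B (m × n)).comp g b) := by
  rw [AlgHom.comp_apply, ← kronLeft_diagHom]
  exact (constHom_commute_diagHom _ _).map (kronLeft B m n)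

theorem repRight_commute_diagHom (g : A →ₐ[ℂ] B) (a : A') (b : A) :
    Commute (repRight B m n σ a) ((diagHom B (m × n)).comp g b) := by
  rw [AlgHom.comp_apply, ← kronRight_diagHom]
  exact (constHom_commute_diagHom _ _).map (kronRight B m n)

theorem constHom_tensorMat (X : A ⊗[ℂ] A') :
    constHom B (m × n) (tensorMat ρ σ X) =
      lift (repLeft B m n ρ) (repRight B m n σ) (repLeft_commute_repRight ρ σ) X := by
  induction X with
  | zero => simp
  | add X Y hX hY => simp only [map_add, hX, hY]
  | tmul a b =>
    ext p q
    rw [lift_tmul]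
    simp only [repLeft, repRight, AlgHom.comp_apply, kronLeft_mul_kronRight_apply]
    simp [tensorMat, Matrix.kroneckerMap_apply]

theorem kronLeft_matLift (g : A' →ₐ[ℂ] B) (X : A ⊗[ℂ] A') :
    kronLeft B m n (matLift ρ g X) = lift (repLeft B m n ρ)
      ((diagHom B (m × n)).comp g) (repLeft_commute_diagHom ρ g) X := by
  induction X with
  | zero => simp
  | add X Y hX hY => simp only [map_add, hX, hY]
  | tmul a b => rw [matLift_tmul, map_mul, kronLeft_diagHom]; simp [repLeft]

theorem kronRight_matLift (g : A →ₐ[ℂ] B) (X : A' ⊗[ℂ] A) :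
    kronRight B m n (matLift σ g X) = lift (repRight B m n σ)
      ((diagHom B (m × n)).comp g) (repRight_commute_diagHom σ g) X := by
  induction X with
  | zero => simp
  | add X Y hX hY => simp only [map_add, hX, hY]
  | tmul a b => rw [matLift_tmul, map_mul, kronRight_diagHom]; simp [repRight]

end MatrixOver

theorem inv_mul_eq_of_mul_eq {M : Type*} [Monoid M] {s s' t t' x : M} (hs : s' * s = 1)
    (hs' : s * s' = 1) (ht : t * t' = 1) (h : s * x = x * (s * t)) : s' * x = x * t' * s' :=
  calc s' * x = s' * (x * (s * t) * t' * s') := by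
        rw [mul_assoc x, mul_assoc s, ht, mul_one, mul_assoc x, hs', mul_one]
    _ = x * t' * s' := by rw [← h, ← mul_assoc, ← mul_assoc, ← mul_assoc, hs, one_mul]

namespace IsQuasitriangular

variable {A B : Type*} [Ring A] [HopfAlgebra ℂ A] {R : (A ⊗[ℂ] A)ˣ} [Ring B] [Algebra ℂ B]
variable {m n : Type*} [Fintype m] [DecidableEq m] [Fintype n] [DecidableEq n]
variable {ρ : A →ₐ[ℂ] Matrix m m ℂ} {σ : A →ₐ[ℂ] Matrix n n ℂ} {g : A →ₐ[ℂ] B}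

theorem matLift_of_comul (hR : IsQuasitriangular R) {T : A →ₐ[ℂ] Matrix (m × n) (m × n) ℂ}
    (hT : ∀ a, T a = tensorMat ρ σ (comul (R := ℂ) a)) :
    matLift T g (R : A ⊗[ℂ] A) =
      kronLeft B m n (matLift ρ g ↑R) * kronRight B m n (matLift σ g ↑R) := by
  have const_comp : (constHom B (m × n)).comp T =
      comulLift (repLeft B m n ρ) (repRight B m n σ) (repLeft_commute_repRight ρ σ) := by
    ext1 a
    rw [AlgHom.comp_apply, hT, constHom_tensorMat, comulLift_apply]
  rw [kronLeft_matLift, kronRight_matLift,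
    ← hR.lift_comulLift_left (h₁₂ := repLeft_commute_repRight ρ σ)
      fun a b => const_comp ▸ constHom_commute_diagHom (T a) (g b)]
  simp only [matLift, const_comp]

theorem matLift_of_swap_comul (hR : IsQuasitriangular R) {T : A →ₐ[ℂ] Matrix (m × n) (m × n) ℂ}
    (hT : ∀ a, T a = tensorMat ρ σ (swap A (comul (R := ℂ) a))) :
    matLift T g (R : A ⊗[ℂ] A) =
      kronRight B m n (matLift σ g ↑R) * kronLeft B m n (matLift ρ g ↑R) := by
  have comm (b a) : Commute (repRight B m n σ b) (repLeft B m n ρ a) :=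
    (repLeft_commute_repRight ρ σ a b).symm
  have const_comp : (constHom B (m × n)).comp T =
      comulLift (repRight B m n σ) (repLeft B m n ρ) comm := by
    ext1 a
    rw [AlgHom.comp_apply, hT, constHom_tensorMat, lift_swap, comulLift_apply]
  rw [kronLeft_matLift, kronRight_matLift, ← hR.lift_comulLift_left (h₁₂ := comm)
    fun a b => const_comp ▸ constHom_commute_diagHom (T a) (g b)]
  simp only [matLift, const_comp]

theorem matLift_inv_of_comul (hR : IsQuasitriangular R) {T : A →ₐ[ℂ] Matrix (m × n) (m × n) ℂ}
    (hT : ∀ a, T a = tensorMat ρ σ (comul (R := ℂ) a)) :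
    matLift T g (↑R⁻¹ : A ⊗[ℂ] A) =
      kronRight B m n (matLift σ g ↑R⁻¹) * kronLeft B m n (matLift ρ g ↑R⁻¹) := by
  refine left_inv_eq_right_inv (a := matLift T g (R : A ⊗[ℂ] A)) ?_ ?_
  · rw [← map_mul, Units.inv_mul, map_one]
  · rw [hR.matLift_of_comul hT, mul_assoc, ← mul_assoc (kronRight B m n _), ← map_mul, ← map_mul,
      Units.mul_inv, map_one, map_one, one_mul, ← map_mul, ← map_mul, Units.mul_inv, map_one,
      map_one]

theorem matLift_yang_baxter (hR : IsQuasitriangular R) :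
    constHom B (m × n) (tensorMat ρ σ (R : A ⊗[ℂ] A)) *
        (kronLeft B m n (matLift ρ g ↑R) * kronRight B m n (matLift σ g ↑R)) =
      kronRight B m n (matLift σ g ↑R) * kronLeft B m n (matLift ρ g ↑R) *
        constHom B (m × n) (tensorMat ρ σ ↑R) := by
  rw [constHom_tensorMat, kronLeft_matLift, kronRight_matLift]
  exact hR.yang_baxter

theorem kronRight_mul_kronLeft_matLift (hR : IsQuasitriangular R) {V : Matrix n n B}
    (hV : ∀ a, V * diagHom B n (g a) = matLift σ g (comul (R := ℂ) a) * V) :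
    kronRight B m n V * kronLeft B m n (matLift ρ g (R : A ⊗[ℂ] A)) =
      kronLeft B m n (matLift ρ g ↑R) * constHom B (m × n) (tensorMat ρ σ ↑R) *
        kronRight B m n V := by
  rw [constHom_tensorMat, kronLeft_matLift]
  refine hR.mul_lift (h₂₃ := repRight_commute_diagHom σ g)
    (fun a => (kronLeft_constHom_commute _ _).symm) fun a => ?_
  have h := congrArg (kronRight B m n) (hV a)
  rwa [map_mul, map_mul, kronRight_diagHom, kronRight_matLift] at h

theorem kronRight_matLift_mul_kronLeft (hR : IsQuasitriangular R) {V : Matrix m m B}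
    (hV : ∀ a, diagHom B m (g a) * V = V * matLift ρ g (comul (R := ℂ) a)) :
    kronRight B m n (matLift σ g (R : A ⊗[ℂ] A)) * kronLeft B m n V =
      kronLeft B m n V * (kronRight B m n (matLift σ g ↑R) *
        constHom B (m × n) (tensorMat ρ σ (swap A ↑R))) := by
  rw [constHom_tensorMat, kronRight_matLift]
  refine hR.lift_mul (h₁₃ := repLeft_commute_diagHom ρ g)
    (fun a => (kronRight_constHom_commute _ _).symm) fun a => ?_
  have h := congrArg (kronLeft B m n) (hV a)
  rwa [map_mul, map_mul, kronLeft_diagHom, kronLeft_matLift] at h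

theorem kronRight_matLift_inv_mul_kronLeft (hR : IsQuasitriangular R) {V : Matrix m m B}
    (hV : ∀ a, diagHom B m (g a) * V = V * matLift ρ g (comul (R := ℂ) a)) :
    kronRight B m n (matLift σ g (↑R⁻¹ : A ⊗[ℂ] A)) * kronLeft B m n V =
      kronLeft B m n V * constHom B (m × n) (tensorMat ρ σ (swap A ↑R⁻¹)) *
        kronRight B m n (matLift σ g ↑R⁻¹) :=
  inv_mul_eq_of_mul_eq (by rw [← map_mul, ← map_mul, Units.inv_mul, map_one, map_one])
    (by rw [← map_mul, ← map_mul, Units.mul_inv, map_one, map_one])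
    (by simp only [← map_mul, Units.mul_inv, map_one])
    (hR.kronRight_matLift_mul_kronLeft hV)

end IsQuasitriangular

/-! ### Evaluation of the `R`-matrix of the gauge algebra -/

theorem monoidHom_apply_eq_of_mulSingle {S M : Type*} [Finite S] [DecidableEq S] {N : S → Type*}
    [∀ z, Monoid (N z)] [Monoid M] (φ : (∀ z, N z) →* M) {m m' : ∀ z, N z}
    (h : ∀ z, φ (Pi.mulSingle z (m z)) = φ (Pi.mulSingle z (m' z))) : φ m = φ m' := by
  cases nonempty_fintype S
  have comm (m : ∀ z, N z) : ((Finset.univ : Finset S) : Set S).Pairwise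
      (Function.onFun Commute fun z => φ (Pi.mulSingle z (m z))) := fun i _ j _ _ =>
    (Pi.mulSingle_apply_commute m i j).map φ
  have apply_eq_noncommProd (m : ∀ z, N z) :
      φ m = Finset.univ.noncommProd (fun z => φ (Pi.mulSingle z (m z))) (comm m) :=
    (congrArg φ (Finset.noncommProd_mulSingle m)).symm.trans
      (Finset.univ.map_noncommProd (fun z => Pi.mulSingle z (m z))
        (fun i _ j _ _ => Pi.mulSingle_apply_commute m i j) φ)
  rw [apply_eq_noncommProd m, apply_eq_noncommProd m']
  exact Finset.noncommProd_congr rfl (fun z _ => h z) _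

namespace IsQuasitriangular

variable {A M : Type*} [Ring A] [HopfAlgebra ℂ A] {R : (A ⊗[ℂ] A)ˣ} [Ring M] [Algebra ℂ M]

theorem algHom_eq_one_left (hR : IsQuasitriangular R) (Ψ : A ⊗[ℂ] A →ₐ[ℂ] M)
    (h : ∀ a : A, Ψ (a ⊗ₜ 1) = algebraMap ℂ M (counit (R := ℂ) a)) : Ψ R = 1 := by
  rw [← hR.lift_counitHom_left (f := Ψ.comp Algebra.TensorProduct.includeRight)
    fun a b => counitHom_commute a _]
  congr 1
  ext a
  · simp [h, counitHom_apply]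
  · simp

theorem algHom_eq_one_right (hR : IsQuasitriangular R) (Ψ : A ⊗[ℂ] A →ₐ[ℂ] M)
    (h : ∀ a : A, Ψ (1 ⊗ₜ a) = algebraMap ℂ M (counit (R := ℂ) a)) : Ψ R = 1 := by
  rw [← hR.lift_counitHom_right (f := Ψ.comp Algebra.TensorProduct.includeLeft)
    fun a b => (counitHom_commute b _).symm]
  congr 1
  ext a
  · simp
  · simp [h, counitHom_apply]

variable {m n : Type*} [Fintype m] [DecidableEq m] [Fintype n] [DecidableEq n]

theorem tensorMat_counitHom_left (hR : IsQuasitriangular R) (σ : A →ₐ[ℂ] Matrix n n ℂ) :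
    tensorMat (counitHom ℂ A (Matrix m m ℂ)) σ (R : A ⊗[ℂ] A) = 1 := by
  refine hR.algHom_eq_one_left _ fun a => ?_
  ext p q
  by_cases h₁ : p.1 = q.1 <;> by_cases h₂ : p.2 = q.2 <;>
    simp [tensorMat, counitHom_apply, Matrix.kroneckerMap_apply, Matrix.algebraMap_matrix_apply,
      Matrix.one_apply, Prod.ext_iff, h₁, h₂]

theorem tensorMat_counitHom_right (hR : IsQuasitriangular R) (ρ : A →ₐ[ℂ] Matrix m m ℂ) :
    tensorMat ρ (counitHom ℂ A (Matrix n n ℂ)) (R : A ⊗[ℂ] A) = 1 := by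
  refine hR.algHom_eq_one_right _ fun a => ?_
  ext p q
  by_cases h₁ : p.1 = q.1 <;> by_cases h₂ : p.2 = q.2 <;>
    simp [tensorMat, counitHom_apply, Matrix.kroneckerMap_apply, Matrix.algebraMap_matrix_apply,
      Matrix.one_apply, Prod.ext_iff, h₁, h₂]

end IsQuasitriangular

section ShuffleEval

variable {S : Type*} [Fintype S] [DecidableEq S] {𝒢 : S → Type*} [∀ x, Ring (𝒢 x)]
  [∀ x, HopfAlgebra ℂ (𝒢 x)] {M : Type*} [Ring M] [Algebra ℂ M]

theorem gaugeComul_single (z : S) (ξ : 𝒢 z) :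
    gaugeComul 𝒢 (PiTensorProduct.singleAlgHom z ξ) = singleTensor z (comul (R := ℂ) ξ) :=
  piLift_single _ _ z ξ

/-- The value of a homomorphism on `⊗_z X_z`, up to the reordering of tensor factors by `shuffle`,
as a homomorphism of monoids in the family `X`. -/
def shuffleEval (Ψ : GaugeAlg 𝒢 ⊗[ℂ] GaugeAlg 𝒢 →ₐ[ℂ] M) : (∀ z, 𝒢 z ⊗[ℂ] 𝒢 z) →* M :=
  ((Ψ.comp (shuffle 𝒢) : _ →* M)).comp (PiTensorProduct.tprodMonoidHom ℂ)


theorem shuffleEval_mulSingle (Ψ : GaugeAlg 𝒢 ⊗[ℂ] GaugeAlg 𝒢 →ₐ[ℂ] M) (z : S)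
    (X : 𝒢 z ⊗[ℂ] 𝒢 z) : shuffleEval Ψ (Pi.mulSingle z X) = Ψ (singleTensor z X) :=
  congrArg Ψ (piLift_single (fun x => singleTensor (A := 𝒢) x)
    (fun _ _ h X Y => singleTensor_commute h X Y) z X)


theorem shuffleEval_eq_one (Ψ : GaugeAlg 𝒢 ⊗[ℂ] GaugeAlg 𝒢 →ₐ[ℂ] M) (m : ∀ z, 𝒢 z ⊗[ℂ] 𝒢 z)
    (h : ∀ z, Ψ (singleTensor z (m z)) = 1) : shuffleEval Ψ m = 1 := by
  rw [← map_one (shuffleEval Ψ)]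
  refine monoidHom_apply_eq_of_mulSingle _ fun z => ?_
  rw [shuffleEval_mulSingle, h, Pi.one_apply, Pi.mulSingle_one, map_one]

theorem shuffleEval_eq_single (Ψ : GaugeAlg 𝒢 ⊗[ℂ] GaugeAlg 𝒢 →ₐ[ℂ] M)
    (m : ∀ z, 𝒢 z ⊗[ℂ] 𝒢 z) (y : S) (h : ∀ z, z ≠ y → Ψ (singleTensor z (m z)) = 1) :
    shuffleEval Ψ m = Ψ (singleTensor y (m y)) := by
  rw [← shuffleEval_mulSingle]
  refine monoidHom_apply_eq_of_mulSingle _ fun z => ?_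
  by_cases hz : z = y
  · subst hz; simp
  · rw [shuffleEval_mulSingle, h z hz, Pi.mulSingle_eq_of_ne hz, Pi.mulSingle_one, map_one]

theorem shuffleEval_eq_pair (Ψ : GaugeAlg 𝒢 ⊗[ℂ] GaugeAlg 𝒢 →ₐ[ℂ] M)
    (m : ∀ z, 𝒢 z ⊗[ℂ] 𝒢 z) {x y : S} (hxy : x ≠ y)
    (h : ∀ z, z ≠ x → z ≠ y → Ψ (singleTensor z (m z)) = 1) :
    shuffleEval Ψ m = Ψ (singleTensor x (m x)) * Ψ (singleTensor y (m y)) := by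
  rw [← shuffleEval_mulSingle, ← shuffleEval_mulSingle, ← map_mul]
  refine monoidHom_apply_eq_of_mulSingle _ fun z => ?_
  by_cases hx : z = x
  · subst hx; simp [hxy]
  by_cases hy : z = y
  · subst hy; simp [hxy.symm]
  rw [shuffleEval_mulSingle, h z hx hy, Pi.mul_apply, Pi.mulSingle_eq_of_ne hx,
    Pi.mulSingle_eq_of_ne hy, one_mul, Pi.mulSingle_one, map_one]

variable [∀ x, StarRing (𝒢 x)] [∀ x, StarModule ℂ (𝒢 x)] [∀ x, RibbonHopfStarAlgebra (𝒢 x)]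

theorem apply_gaugeR (Ψ : GaugeAlg 𝒢 ⊗[ℂ] GaugeAlg 𝒢 →ₐ[ℂ] M) :
    Ψ (gaugeR 𝒢 : GaugeAlg 𝒢 ⊗[ℂ] GaugeAlg 𝒢) = shuffleEval Ψ fun z => rMatrix (𝒢 z) := rfl

theorem apply_gaugeR_inv (Ψ : GaugeAlg 𝒢 ⊗[ℂ] GaugeAlg 𝒢 →ₐ[ℂ] M) :
    Ψ (((gaugeR 𝒢)⁻¹ : (GaugeAlg 𝒢 ⊗[ℂ] GaugeAlg 𝒢)ˣ) : GaugeAlg 𝒢 ⊗[ℂ] GaugeAlg 𝒢) =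
      shuffleEval Ψ fun z => rMatrixInv (𝒢 z) := rfl

end ShuffleEval

theorem Ciliation.Before.snd_eq {S : Type*} {G : SimpleGraph S} {cil : Ciliation G} {i j : G.Dart}
    (h : cil.Before i j) : i.snd = j.snd :=
  let ⟨_, hi, hj, _⟩ := h
  hi.trans hj.symm

theorem Ciliation.Before.fst_ne {S : Type*} {G : SimpleGraph S} {cil : Ciliation G} {i j : G.Dart}
    (h : cil.Before i j) : i.fst ≠ j.fst := by
  obtain ⟨x, hi, hj, hlt⟩ := h
  intro same_source
  obtain rfl : i = j := SimpleGraph.Dart.ext _ _ (Prod.ext same_source (hi.trans hj.symm))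
  exact @lt_irrefl _ (cil x).toPreorder _ hlt

section LinkRep

variable {S : Type*} {G : SimpleGraph S} {𝒢 : S → Type*}
  [∀ x, Ring (𝒢 x)] [∀ x, HopfAlgebra ℂ (𝒢 x)] [∀ x, StarRing (𝒢 x)]
  [∀ x, StarModule ℂ (𝒢 x)] [∀ x, RibbonHopfStarAlgebra (𝒢 x)]
  {H : Type*} [Ring H] [HopfAlgebra ℂ H] [StarRing H] [StarModule ℂ H] [RibbonHopfStarAlgebra H]
  {ι : Type*} (tw : ∀ x, TwistEquiv (𝒢 x) H) (D : RepData H ι)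

theorem tensorMat_targetRep (I J : ι) (y : S) (X : 𝒢 y ⊗[ℂ] 𝒢 y) (δ α : D.Ix I) (γ β : D.Ix J) :
    tensorMat (targetRep tw D y I) (targetRep tw D y J) X (δ, γ) (α, β) =
      if δ.1 = α.1 then if γ.1 = β.1 then
        tensorMat (repAt tw D y I) (repAt tw D y J) X (δ.2, γ.2) (α.2, β.2) else 0 else 0 := by
  induction X with
  | zero => simp
  | add X Y hX hY =>
    simp only [map_add, Matrix.add_apply, hX, hY]
    split_ifs <;> simp
  | tmul a b =>
    by_cases h : δ.1 = α.1 <;> by_cases h' : γ.1 = β.1 <;>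
      simp [tensorMat, targetRep, Matrix.kroneckerMap_apply, Matrix.one_apply, h, h']

variable [DecidableEq S]

theorem linkRepAt_target (I : ι) (i : G.Dart) {y : S} (h : i.snd = y) :
    linkRepAt tw D I i y = targetRep tw D y I := by
  simp [linkRepAt, h]

theorem linkRepAt_source (I : ι) (i : G.Dart) {x : S} (h : i.fst = x) :
    linkRepAt tw D I i x = sourceRep tw D x I := by
  subst h
  simp [linkRepAt, i.adj.ne]

theorem linkRepAt_other (I : ι) (i : G.Dart) {z : S} (h₁ : z ≠ i.fst) (h₂ : z ≠ i.snd) :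
    linkRepAt tw D I i z = counitHom ℂ (𝒢 z) _ := by
  simp [linkRepAt, h₁, h₂, counitHom]

variable [Fintype S]

theorem tensorMat_linkRep_singleTensor (I J : ι) (i j : G.Dart) (z : S) (X : 𝒢 z ⊗[ℂ] 𝒢 z) :
    tensorMat (linkRep tw D I i) (linkRep tw D J j) (singleTensor z X) =
      tensorMat (linkRepAt tw D I i z) (linkRepAt tw D J j z) X := by
  induction X with
  | zero => simp
  | add X Y hX hY => simp only [map_add, hX, hY]
  | tmul a b =>
    simp only [singleTensor, Algebra.TensorProduct.map_tmul, tensorMat, AlgHom.comp_apply, linkRep,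
      piLift_single]
theorem tensorMat_linkRep_gaugeR_of_noCommonEnd (I J : ι) {i j : G.Dart} (h : NoCommonEnd i j) :
    tensorMat (linkRep tw D I i) (linkRep tw D J j)
      (gaugeR 𝒢 : GaugeAlg 𝒢 ⊗[ℂ] GaugeAlg 𝒢) = 1 := by
  rw [apply_gaugeR]
  refine shuffleEval_eq_one _ _ fun z => ?_
  rw [tensorMat_linkRep_singleTensor]
  by_cases hz : z = i.fst ∨ z = i.snd
  · rw [linkRepAt_other tw D J j, (isQuasitriangular _).tensorMat_counitHom_right]
    · rcases hz with rfl | rfl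
      · exact h.1
      · exact h.2.2.1
    · rcases hz with rfl | rfl
      · exact h.2.1
      · exact h.2.2.2
  · rw [not_or] at hz
    rw [linkRepAt_other tw D I i hz.1 hz.2, (isQuasitriangular _).tensorMat_counitHom_left]

theorem tensorMat_linkRep_gaugeR_of_target (I J : ι) {i j : G.Dart} {y : S} (hi : i.snd = y)
    (hj : j.snd = y) (hij : i.fst ≠ j.fst) :
    tensorMat (linkRep tw D I i) (linkRep tw D J j) (gaugeR 𝒢 : GaugeAlg 𝒢 ⊗[ℂ] GaugeAlg 𝒢) =
      tensorMat (targetRep tw D y I) (targetRep tw D y J) (rMatrix (𝒢 y)) := by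
  rw [apply_gaugeR, shuffleEval_eq_single _ _ y, tensorMat_linkRep_singleTensor,
    linkRepAt_target tw D I i hi, linkRepAt_target tw D J j hj]
  intro z hz
  rw [tensorMat_linkRep_singleTensor]
  by_cases hz' : z = i.fst
  · rw [linkRepAt_other tw D J j (hz' ▸ hij) (hj ▸ hz),
      (isQuasitriangular _).tensorMat_counitHom_right]
  · rw [linkRepAt_other tw D I i hz' (hi ▸ hz), (isQuasitriangular _).tensorMat_counitHom_left]

end LinkRep

/-! ### The relations of the lattice algebra in matrix form -/

section LatticeRelations

variable {S : Type*} [Fintype S] [DecidableEq S] {G : SimpleGraph S} (cil : Ciliation G)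
  {𝒢 : S → Type*}
  [∀ x, Ring (𝒢 x)] [∀ x, HopfAlgebra ℂ (𝒢 x)] [∀ x, StarRing (𝒢 x)]
  [∀ x, StarModule ℂ (𝒢 x)] [∀ x, RibbonHopfStarAlgebra (𝒢 x)]
  {H : Type*} [Ring H] [HopfAlgebra ℂ H] [StarRing H] [StarModule ℂ H] [RibbonHopfStarAlgebra H]
  {ι : Type*} [Fintype ι] (tw : ∀ x, TwistEquiv (𝒢 x) H) (D : RepData H ι)

/-- The canonical homomorphism from the gauge algebra to the lattice algebra. -/
def gaugeHom : GaugeAlg 𝒢 →ₐ[ℂ] LatticeAlg cil tw D :=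
  AlgHom.ofLinearMap
    { toFun := gauge cil tw D
      map_add' := fun ξ ξ' => by
        rw [gauge, RingQuot.mkAlgHom_rel ℂ (Rel.gauge_add ξ ξ'), map_add]; rfl
      map_smul' := fun c ξ => by
        rw [gauge, RingQuot.mkAlgHom_rel ℂ (Rel.gauge_smul c ξ), map_smul]; rfl }
    (by
      change gauge cil tw D 1 = 1
      rw [gauge, RingQuot.mkAlgHom_rel ℂ Rel.gauge_one, map_one])
    (fun ξ ξ' => by
      change gauge cil tw D (ξ * ξ') = gauge cil tw D ξ * gauge cil tw D ξ'
      rw [gauge, RingQuot.mkAlgHom_rel ℂ (Rel.gauge_mul ξ ξ'), map_mul]; rfl)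

theorem gauge_one : gauge cil tw D (1 : GaugeAlg 𝒢) = 1 := map_one (gaugeHom cil tw D)

theorem gauge_mul (ξ ξ' : GaugeAlg 𝒢) :
    gauge cil tw D (ξ * ξ') = gauge cil tw D ξ * gauge cil tw D ξ' :=
  map_mul (gaugeHom cil tw D) ξ ξ'

theorem gauge_add (ξ ξ' : GaugeAlg 𝒢) :
    gauge cil tw D (ξ + ξ') = gauge cil tw D ξ + gauge cil tw D ξ' :=
  map_add (gaugeHom cil tw D) ξ ξ'

theorem gauge_smul (c : ℂ) (ξ : GaugeAlg 𝒢) :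
    gauge cil tw D (c • ξ) = c • gauge cil tw D ξ :=
  map_smul (gaugeHom cil tw D) c ξ

/-- The canonical homomorphism from the gauge algebra at the site `x` to the lattice algebra. -/
def gaugeAt (x : S) : 𝒢 x →ₐ[ℂ] LatticeAlg cil tw D :=
  (gaugeHom cil tw D).comp (PiTensorProduct.singleAlgHom x)

theorem gaugeAt_apply (x : S) (ξ : 𝒢 x) :
    gaugeAt cil tw D x ξ = gauge cil tw D (PiTensorProduct.singleAlgHom x ξ) := rfl

theorem gaugeAt_commute {x y : S} (h : x ≠ y) (a : 𝒢 x) (b : 𝒢 y) :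
    Commute (gaugeAt cil tw D x a) (gaugeAt cil tw D y b) :=
  (single_commute h a b).map (gaugeHom cil tw D)

/-- The elements `U^I_{ab}(i)` as a matrix. -/
def connMat (I : ι) (i : G.Dart) :
    Matrix (Fin (D.dim I)) (Fin (D.dim I)) (LatticeAlg cil tw D) :=
  Matrix.of fun a b => conn cil tw D I i (a, b)

theorem connMat_apply (I : ι) (i : G.Dart) (a b : Fin (D.dim I)) :
    connMat cil tw D I i a b = conn cil tw D I i (a, b) := rfl

/-- The matrix `(τ^I_x ⊗ id)(X)`. -/
abbrev siteMat (x : S) (I : ι) :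
    𝒢 x ⊗[ℂ] 𝒢 x →ₐ[ℂ] Matrix (Fin (D.dim I)) (Fin (D.dim I)) (LatticeAlg cil tw D) :=
  matLift (repAt tw D x I) (gaugeAt cil tw D x)

/-- A gauge transformation at the site `x`, as a multiple of the unit matrix. -/
abbrev siteDiag (x : S) (I : ι) :
    𝒢 x →ₐ[ℂ] Matrix (Fin (D.dim I)) (Fin (D.dim I)) (LatticeAlg cil tw D) :=
  (diagHom _ _).comp (gaugeAt cil tw D x)

theorem matLift_linkRep_singleTensor (I : ι) (i : G.Dart) (z : S) (X : 𝒢 z ⊗[ℂ] 𝒢 z) :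
    matLift (linkRep tw D I i) (gaugeHom cil tw D) (singleTensor z X) =
      matLift (linkRepAt tw D I i z) (gaugeAt cil tw D z) X := by
  induction X with
  | zero => simp
  | add X Y hX hY => simp only [map_add, hX, hY]
  | tmul a b =>
    rw [singleTensor, Algebra.TensorProduct.map_tmul, matLift_tmul, matLift_tmul, linkRep,
      piLift_single]
    rfl

theorem covariance_at (I : ι) (i : G.Dart) (z : S) (ξ : 𝒢 z) (α : D.Ix I) :
    gaugeAt cil tw D z ξ * conn cil tw D I i α =
      ∑ β, conn cil tw D I i β *
        matLift (linkRepAt tw D I i z) (gaugeAt cil tw D z) (comul (R := ℂ) ξ) β α := by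
  rw [gaugeAt_apply, gauge, conn, ← map_mul,
    RingQuot.mkAlgHom_rel ℂ (Rel.covariance (PiTensorProduct.singleAlgHom z ξ) I i α), map_sum]
  refine Finset.sum_congr rfl fun β _ => ?_
  rw [map_mul, ← matLift_linkRep_singleTensor, matLift_apply, gaugeComul_single]
  rfl

theorem matLift_targetRep (I : ι) (y : S) (X : 𝒢 y ⊗[ℂ] 𝒢 y) (β α : D.Ix I) :
    matLift (targetRep tw D y I) (gaugeAt cil tw D y) X β α =
      if β.1 = α.1 then siteMat cil tw D y I X β.2 α.2 else 0 := by
  induction X with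
  | zero => simp
  | add X Y hX hY =>
    simp only [map_add, Matrix.add_apply, hX, hY]
    split_ifs <;> simp
  | tmul a b =>
    rw [matLift_tmul_apply, matLift_tmul_apply]
    by_cases h : β.1 = α.1 <;> simp [targetRep, Matrix.kroneckerMap_apply, Matrix.one_apply, h]

/-- `a ⊗ b ↦ τ^I_x(S(a)) U b`. -/
abbrev sourceAct (x : S) (I : ι)
    (U : Matrix (Fin (D.dim I)) (Fin (D.dim I)) (LatticeAlg cil tw D)) :
    𝒢 x ⊗[ℂ] 𝒢 x →ₗ[ℂ] Matrix (Fin (D.dim I)) (Fin (D.dim I)) (LatticeAlg cil tw D) :=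
  sandwich ((((constHom (LatticeAlg cil tw D) _).comp (repAt tw D x I) : _ →ₐ[ℂ] _) : _ →ₗ[ℂ] _) ∘ₗ
    antipode ℂ) (siteDiag cil tw D x I : _ →ₗ[ℂ] _) U

theorem sourceAct_apply (x : S) (I : ι)
    (U : Matrix (Fin (D.dim I)) (Fin (D.dim I)) (LatticeAlg cil tw D)) (X : 𝒢 x ⊗[ℂ] 𝒢 x)
    (a b : Fin (D.dim I)) :
    sourceAct cil tw D x I U X a b =
      ∑ β : D.Ix I, U β.1 β.2 * matLift (sourceRep tw D x I) (gaugeAt cil tw D x) X β (a, b) := by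
  induction X with
  | zero => simp
  | add X Y hX hY =>
    simp only [map_add, Matrix.add_apply, hX, hY, mul_add, Finset.sum_add_distrib]
  | tmul p q =>
    simp only [sandwich_tmul, LinearMap.comp_apply]
    change (constHom (LatticeAlg cil tw D) (Fin (D.dim I)) (repAt tw D x I (antipode ℂ p)) * U *
      diagHom (LatticeAlg cil tw D) (Fin (D.dim I)) (gaugeAt cil tw D x q)) a b = _
    rw [mul_diagHom_apply, Fintype.sum_prod_type, Matrix.mul_apply, Finset.sum_mul]
    refine Finset.sum_congr rfl fun c _ => ?_
    rw [Finset.sum_eq_single b]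
    · rw [matLift_tmul_apply]
      simp [sourceRep, Matrix.kroneckerMap_apply, ← Algebra.smul_def]
    · intro d _ hd
      rw [matLift_tmul_apply]
      simp [sourceRep, Matrix.kroneckerMap_apply, hd]
    · simp

theorem target_covariance (I : ι) (i : G.Dart) {y : S} (h : i.snd = y) (ξ : 𝒢 y) :
    siteDiag cil tw D y I ξ * connMat cil tw D I i =
      connMat cil tw D I i * siteMat cil tw D y I (comul (R := ℂ) ξ) := by
  ext a b
  rw [AlgHom.comp_apply, diagHom_mul_apply, connMat_apply, covariance_at,
    linkRepAt_target tw D I i h, Fintype.sum_prod_type, Finset.sum_eq_single a, Matrix.mul_apply]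
  · simp [matLift_targetRep, connMat_apply]
  · intro c _ hc
    simp [matLift_targetRep, hc]
  · simp

theorem source_covariance (I : ι) (i : G.Dart) {x : S} (h : i.fst = x) (ξ : 𝒢 x) :
    siteMat cil tw D x I (comul (R := ℂ) ξ) * connMat cil tw D I i =
      connMat cil tw D I i * siteDiag cil tw D x I ξ := by
  refine lift_comul_mul_of_sandwich (fun ξ => ?_) ξ
  ext a b
  rw [AlgHom.comp_apply, diagHom_mul_apply, connMat_apply, covariance_at,
    linkRepAt_source tw D I i h]
  exact (sourceAct_apply cil tw D x I (connMat cil tw D I i) _ a b).symm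

theorem other_covariance (I : ι) (i : G.Dart) {z : S} (h₁ : z ≠ i.fst) (h₂ : z ≠ i.snd)
    (ξ : 𝒢 z) (α : D.Ix I) :
    Commute (gaugeAt cil tw D z ξ) (conn cil tw D I i α) := by
  have const_counit : (constHom (LatticeAlg cil tw D) (D.Ix I)).comp (counitHom ℂ (𝒢 z) _) =
      counitHom ℂ (𝒢 z) _ := by
    ext1 a
    exact (constHom (LatticeAlg cil tw D) (D.Ix I)).commutes _
  have matLift_comul : matLift (linkRepAt tw D I i z) (gaugeAt cil tw D z) (comul (R := ℂ) ξ) =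
      diagHom _ _ (gaugeAt cil tw D z ξ) := by
    rw [linkRepAt_other tw D I i h₁ h₂]
    simp only [matLift, const_counit]
    exact DFunLike.congr_fun (comulLift_counitHom_left _ fun a _ => counitHom_commute a _) ξ
  rw [Commute, SemiconjBy, covariance_at, matLift_comul]
  simp only [diagHom, Matrix.scalarAlgHom_apply, Matrix.scalar_apply, Matrix.diagonal_apply,
    mul_ite, mul_zero]
  simp

theorem connMat_mul_connMat_symm (I : ι) (i : G.Dart) :
    connMat cil tw D I i * connMat cil tw D I i.symm = 1 := by
  ext a c
  have h := RingQuot.mkAlgHom_rel ℂ (Rel.inverse (cil := cil) (tw := tw) (D := D) I i a c)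
  rw [map_sum] at h
  simp only [map_mul] at h
  rw [Matrix.mul_apply, Matrix.one_apply]
  refine h.trans ?_
  split_ifs <;> simp

theorem connMat_functoriality (I J : ι) (i : G.Dart) :
    kronLeft _ _ _ (connMat cil tw D I i) * kronRight _ _ _ (connMat cil tw D J i) =
      ∑ K, ∑ a, constMap (LatticeAlg cil tw D) (cgAt tw D i.fst I J K a).conjTranspose *
        connMat cil tw D K i * constMap (LatticeAlg cil tw D) (cgAt tw D i.snd I J K a) := by
  ext ⟨a, a'⟩ ⟨b, b'⟩
  have h := RingQuot.mkAlgHom_rel ℂ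
    (Rel.functoriality (cil := cil) (tw := tw) (D := D) I J i (a, b) (a', b'))
  rw [kronLeft_mul_kronRight_apply]
  simp only [map_mul, map_sum, map_smul] at h
  refine h.trans ?_
  simp only [Matrix.sum_apply]
  refine Finset.sum_congr rfl fun K _ => Finset.sum_congr rfl fun a _ => ?_
  refine (Fintype.sum_prod_type_right _).trans ?_
  rw [constMap_mul_mul_constMap_apply]
  refine Finset.sum_congr rfl fun d _ => Finset.sum_congr rfl fun c _ => ?_
  rw [mul_comm]
  rfl

theorem connMat_braid_self (I J : ι) (i : G.Dart) :
    kronLeft _ _ _ (connMat cil tw D I i) * kronRight _ _ _ (connMat cil tw D J i) =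
      constHom _ _ (tensorMat (repAt tw D i.fst I) (repAt tw D i.fst J) (rMatrix (𝒢 i.fst))) *
        (kronRight _ _ _ (connMat cil tw D J i) * kronLeft _ _ _ (connMat cil tw D I i)) *
        constHom _ _ (tensorMat (repAt tw D i.snd I) (repAt tw D i.snd J)
          (swap _ (rMatrixInv (𝒢 i.snd)))) := by
  ext ⟨a, a'⟩ ⟨b, b'⟩
  have h := RingQuot.mkAlgHom_rel ℂ
    (Rel.braid_self (cil := cil) (tw := tw) (D := D) i I J (a, b) (a', b'))
  have coe_swapUnit_inv :
      (((swapUnit (𝒢 i.snd) RibbonHopfStarAlgebra.R)⁻¹ : (𝒢 i.snd ⊗[ℂ] 𝒢 i.snd)ˣ) :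
        𝒢 i.snd ⊗[ℂ] 𝒢 i.snd) = swap _ (rMatrixInv (𝒢 i.snd)) := rfl
  rw [kronLeft_mul_kronRight_apply]
  simp only [map_mul, map_sum, map_smul, coe_swapUnit_inv] at h
  refine h.trans ?_
  generalize tensorMat (repAt tw D i.fst I) (repAt tw D i.fst J) (rMatrix (𝒢 i.fst)) = P
  generalize tensorMat (repAt tw D i.snd I) (repAt tw D i.snd J) (swap _ (rMatrixInv (𝒢 i.snd))) = Q
  change _ = (constMap (LatticeAlg cil tw D) P *
    (kronRight _ (Fin (D.dim I)) (Fin (D.dim J)) (connMat cil tw D J i) *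
      kronLeft _ (Fin (D.dim I)) (Fin (D.dim J)) (connMat cil tw D I i)) *
    constMap (LatticeAlg cil tw D) Q) (a, a') (b, b')
  rw [constMap_mul_mul_constMap_apply]
  simp only [kronRight_mul_kronLeft_apply]
  refine (Fintype.sum_prod_type' _).symm.trans
    (.trans ?_ ((Fintype.sum_prod_type' _).trans Finset.sum_comm))
  exact Fintype.sum_equiv (Equiv.prodProdProdComm _ _ _ _) _ _ fun _ => rfl

theorem conn_braid (i j : G.Dart) (h : cil.Before i j ∨ NoCommonEnd i j) (I J : ι)
    (α : D.Ix I) (β : D.Ix J) :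
    conn cil tw D I i α * conn cil tw D J j β =
      ∑ δ : D.Ix I, ∑ γ : D.Ix J,
        tensorMat (linkRep tw D I i) (linkRep tw D J j)
          (gaugeR 𝒢 : GaugeAlg 𝒢 ⊗[ℂ] GaugeAlg 𝒢) (δ, γ) (α, β) •
        (conn cil tw D J j γ * conn cil tw D I i δ) := by
  have h := RingQuot.mkAlgHom_rel ℂ (Rel.braid (cil := cil) (tw := tw) (D := D) i j h I J α β)
  simp only [map_mul, map_sum, map_smul] at h
  exact h

theorem conn_commute_of_noCommonEnd (I J : ι) {i j : G.Dart} (h : NoCommonEnd i j) (α : D.Ix I)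
    (β : D.Ix J) : Commute (conn cil tw D I i α) (conn cil tw D J j β) := by
  rw [Commute, SemiconjBy, conn_braid cil tw D i j (Or.inr h) I J,
    tensorMat_linkRep_gaugeR_of_noCommonEnd tw D I J h]
  simp only [Matrix.one_apply, Prod.mk.injEq, ite_and, ite_smul, one_smul, zero_smul]
  simp

theorem connMat_braid_target (I J : ι) {i j : G.Dart} (h : cil.Before i j) {y : S}
    (hi : i.snd = y) (hj : j.snd = y) :
    kronLeft _ _ _ (connMat cil tw D I i) * kronRight _ _ _ (connMat cil tw D J j) =
      kronRight _ _ _ (connMat cil tw D J j) * kronLeft _ _ _ (connMat cil tw D I i) *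
        constHom _ _ (tensorMat (repAt tw D y I) (repAt tw D y J) (rMatrix (𝒢 y))) := by
  ext ⟨a, a'⟩ ⟨b, b'⟩
  rw [kronLeft_mul_kronRight_apply, connMat_apply, connMat_apply,
    conn_braid cil tw D i j (Or.inl h), tensorMat_linkRep_gaugeR_of_target tw D I J hi hj h.fst_ne,
    Matrix.mul_apply]
  simp only [kronRight_mul_kronLeft_apply, tensorMat_targetRep, connMat_apply, constHom_apply,
    ite_smul, zero_smul, Fintype.sum_prod_type]
  rw [Finset.sum_eq_single a]
  · refine Finset.sum_congr rfl fun c _ => ?_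
    rw [Finset.sum_eq_single a']
    · refine Finset.sum_congr rfl fun d _ => ?_
      simp [Algebra.smul_def, Algebra.commutes]
    · intro d _ hd
      simp [hd]
    · simp
  · intro c _ hc
    simp [hc]
  · simp

end LatticeRelations

/-! ### Exchange of the Kronecker factors -/

section Exchange

variable {B : Type*} [Ring B] [Algebra ℂ B]
  {m n : Type*} [Fintype m] [DecidableEq m] [Fintype n] [DecidableEq n]

variable (B m n) in
/-- The flip of the two Kronecker factors, relating `kronLeft` to `kronRight`. -/
def exchange : Matrix (m × n) (m × n) B ≃ₐ[ℂ] Matrix (n × m) (n × m) B :=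
  Matrix.reindexAlgEquiv ℂ B (Equiv.prodComm m n)

theorem exchange_apply (X : Matrix (m × n) (m × n) B) (p q : n × m) :
    exchange B m n X p q = X p.swap q.swap := rfl

theorem exchange_kronLeft (X : Matrix m m B) :
    exchange B m n (kronLeft B m n X) = kronRight B n m X := by
  ext p q
  rw [exchange_apply, kronLeft_apply, kronRight_apply]
  rfl

theorem exchange_kronRight (X : Matrix n n B) :
    exchange B m n (kronRight B m n X) = kronLeft B n m X := by
  ext p q
  rw [exchange_apply, kronLeft_apply, kronRight_apply]
  rfl

theorem exchange_tensorMat {A : Type*} [Ring A] [HopfAlgebra ℂ A] (ρ : A →ₐ[ℂ] Matrix m m ℂ)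
    (σ : A →ₐ[ℂ] Matrix n n ℂ) (X : A ⊗[ℂ] A) :
    exchange B m n (constHom B (m × n) (tensorMat ρ σ X)) =
      constHom B (n × m) (tensorMat σ ρ (swap A X)) := by
  induction X with
  | zero => simp
  | add X Y hX hY => simp only [map_add, hX, hY]
  | tmul a b =>
    ext p q
    simp [exchange_apply, tensorMat, Matrix.kroneckerMap_apply, mul_comm]

variable {A A' : Type*} [Ring A] [Algebra ℂ A] [Ring A'] [Algebra ℂ A']

theorem kronLeft_matLift_commute_kronRight (ρ : A →ₐ[ℂ] Matrix m m ℂ) (g : A' →ₐ[ℂ] B)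
    (X : A ⊗[ℂ] A') {V : Matrix n n B} (h : ∀ a b c, Commute (g a) (V b c)) :
    Commute (kronLeft B m n (matLift ρ g X)) (kronRight B m n V) :=
  kronLeft_commute_kronRight fun a b c d => by rw [matLift_apply]; exact h _ _ _

theorem kronRight_matLift_commute_kronLeft (σ : A →ₐ[ℂ] Matrix n n ℂ) (g : A' →ₐ[ℂ] B)
    (X : A ⊗[ℂ] A') {V : Matrix m m B} (h : ∀ a b c, Commute (g a) (V b c)) :
    Commute (kronRight B m n (matLift σ g X)) (kronLeft B m n V) :=
  (kronLeft_commute_kronRight fun a b c d => by rw [matLift_apply]; exact (h _ _ _).symm).symm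

end Exchange

section MonoidIdentities

variable {M : Type*} [Monoid M]

theorem mul_triple_interleave {a₁ a₂ v₁ v₂ c₁ c₂ r s : M} (h₁ : c₂ * a₁ = a₁ * c₂)
    (h₂ : v₂ * a₁ = a₁ * r * v₂) (h₃ : c₂ * v₁ = v₁ * s * c₂) :
    a₂ * v₂ * c₂ * (a₁ * v₁ * c₁) = a₂ * a₁ * r * (v₂ * v₁) * s * (c₂ * c₁) := by
  calc _ = a₂ * (v₂ * (c₂ * a₁)) * v₁ * c₁ := by simp only [mul_assoc]
    _ = a₂ * (v₂ * a₁) * (c₂ * v₁) * c₁ := by rw [h₁]; simp only [mul_assoc]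
    _ = _ := by rw [h₂, h₃]; simp only [mul_assoc]

theorem inv_mul_inv_eq_of_braid {a a' b b' r r' : M} (a_inv : a * a' = 1) (inv_a : a' * a = 1)
    (b_inv : b * b' = 1) (inv_b : b' * b = 1) (r_inv : r * r' = 1) (inv_r : r' * r = 1)
    (braid : a * b * r = r * (b * a)) : a' * b' * r' = r' * (b' * a') := by
  refine left_inv_eq_right_inv (a := a * b * r) ?_ ?_
  · calc a' * b' * r' * (a * b * r) = a' * (b' * (r' * r) * b) * a := by
          rw [braid]; simp only [mul_assoc]
      _ = 1 := by rw [inv_r, mul_one, inv_b, mul_one, inv_a]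
  · calc a * b * r * (r' * (b' * a')) = a * (b * (r * r') * b') * a' := by simp only [mul_assoc]
      _ = 1 := by rw [r_inv, mul_one, b_inv, mul_one, a_inv]

theorem inv_mul_inv_eq_of_mul_eq {u u' v v' r : M} (u_inv : u * u' = 1) (inv_u : u' * u = 1)
    (v_inv : v * v' = 1) (inv_v : v' * v = 1) (braid : u * v = v * u * r) :
    u' * v' = r * (v' * u') := by
  calc u' * v' = u' * v' * (u * (v * v') * u') := by rw [v_inv, mul_one, u_inv, mul_one]
    _ = u' * v' * (u * v) * v' * u' := by simp only [mul_assoc]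
    _ = u' * (v' * v) * u * r * v' * u' := by rw [braid]; simp only [mul_assoc]
    _ = r * (v' * u') := by rw [inv_v, mul_one, inv_u, one_mul, mul_assoc]

end MonoidIdentities

/-! ### Unitarity of the representations and the Clebsch-Gordan maps -/

section Unitary

variable {S : Type*} {𝒢 : S → Type*}
  [∀ x, Ring (𝒢 x)] [∀ x, HopfAlgebra ℂ (𝒢 x)] [∀ x, StarRing (𝒢 x)]
  [∀ x, StarModule ℂ (𝒢 x)] [∀ x, RibbonHopfStarAlgebra (𝒢 x)]
  {H : Type*} [Ring H] [HopfAlgebra ℂ H] [StarRing H] [StarModule ℂ H] [RibbonHopfStarAlgebra H]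
  {ι : Type*} (tw : ∀ x, TwistEquiv (𝒢 x) H) (D : RepData H ι)

theorem repAt_star (x : S) (I : ι) (a : 𝒢 x) :
    repAt tw D x I (star a) = (repAt tw D x I a).conjTranspose := by
  simp only [repAt, AlgHom.comp_apply]
  rw [← D.unitary]
  congr 1
  exact (tw x).iso_star a

theorem tensorMat_star {A A' m n : Type*} [Ring A] [Algebra ℂ A] [StarRing A] [StarModule ℂ A]
    [Ring A'] [Algebra ℂ A'] [StarRing A'] [StarModule ℂ A']
    [Fintype m] [DecidableEq m] [Fintype n] [DecidableEq n]
    {ρ : A →ₐ[ℂ] Matrix m m ℂ} {σ : A' →ₐ[ℂ] Matrix n n ℂ}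
    (hρ : ∀ a, ρ (star a) = (ρ a).conjTranspose) (hσ : ∀ a, σ (star a) = (σ a).conjTranspose)
    (X : A ⊗[ℂ] A') :
    tensorMat ρ σ (star X) = (tensorMat ρ σ X).conjTranspose := by
  induction X with
  | zero => simp
  | add X Y hX hY => simp only [star_add, map_add, Matrix.conjTranspose_add, hX, hY]
  | tmul a b =>
    ext p q
    simp [tensorMat, hρ, hσ, Matrix.kroneckerMap_apply]

theorem star_tensorMat_repAt_apply (x : S) (I J : ι) (X : 𝒢 x ⊗[ℂ] 𝒢 x)
    (p q : Fin (D.dim I) × Fin (D.dim J)) :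
    star (tensorMat (repAt tw D x I) (repAt tw D x J) X p q) =
      tensorMat (repAt tw D x I) (repAt tw D x J) (star X) q p := by
  rw [tensorMat_star (repAt_star tw D x I) (repAt_star tw D x J)]
  rfl

theorem cgAt_intertwines (x : S) (I J K : ι) (a : Fin (D.mult I J K)) (ξ : 𝒢 x) :
    cgAt tw D x I J K a * tensorMat (repAt tw D x I) (repAt tw D x J) (comul (R := ℂ) ξ) =
      repAt tw D x K ξ * cgAt tw D x I J K a := by
  have tensorMat_repAt (X : 𝒢 x ⊗[ℂ] 𝒢 x) : tensorMat (repAt tw D x I) (repAt tw D x J) X =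
      tensorMat (D.τ I) (D.τ J) (Algebra.TensorProduct.map ((tw x).iso : 𝒢 x →ₐ[ℂ] H)
        ((tw x).iso : 𝒢 x →ₐ[ℂ] H) X) := by
    induction X with
    | zero => simp
    | add X Y hX hY => simp only [map_add, hX, hY]
    | tmul a b => rfl
  have F_mul_F_inv : tensorMat (D.τ I) (D.τ J) ((tw x).F : H ⊗[ℂ] H) *
      tensorMat (D.τ I) (D.τ J) (((tw x).F⁻¹ : (H ⊗[ℂ] H)ˣ) : H ⊗[ℂ] H) = 1 :=
    map_mul_eq_one _ (Units.mul_inv _)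
  rw [tensorMat_repAt, (tw x).iso_comul, map_mul, map_mul, cgAt, Matrix.mul_assoc,
    ← Matrix.mul_assoc _ (_ * _), ← Matrix.mul_assoc _ (tensorMat _ _ _),
    F_mul_F_inv, Matrix.one_mul, ← Matrix.mul_assoc, D.C_intertwines, Matrix.mul_assoc]
  rfl

theorem cgAt_conjTranspose_intertwines (x : S) (I J K : ι) (a : Fin (D.mult I J K)) (ξ : 𝒢 x) :
    (cgAt tw D x I J K a).conjTranspose * repAt tw D x K ξ =
      tensorMat (repAt tw D x I) (repAt tw D x J) (swap _ (comul (R := ℂ) ξ)) *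
        (cgAt tw D x I J K a).conjTranspose := by
  have h := congrArg Matrix.conjTranspose (cgAt_intertwines tw D x I J K a (star ξ))
  rw [Matrix.conjTranspose_mul, Matrix.conjTranspose_mul, ← repAt_star,
    ← tensorMat_star (repAt_star tw D x I) (repAt_star tw D x J), star_comul, star_star] at h
  exact h.symm

end Unitary

/-! ### The conjugate of the connection -/

section ConnStar

variable {S : Type*} [Fintype S] [DecidableEq S] {G : SimpleGraph S} (cil : Ciliation G)
  {𝒢 : S → Type*}
  [∀ x, Ring (𝒢 x)] [∀ x, HopfAlgebra ℂ (𝒢 x)] [∀ x, StarRing (𝒢 x)]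
  [∀ x, StarModule ℂ (𝒢 x)] [∀ x, RibbonHopfStarAlgebra (𝒢 x)]
  {H : Type*} [Ring H] [HopfAlgebra ℂ H] [StarRing H] [StarModule ℂ H] [RibbonHopfStarAlgebra H]
  {ι : Type*} [Fintype ι] (tw : ∀ x, TwistEquiv (𝒢 x) H) (D : RepData H ι)

theorem gaugeAt_commute_siteMat {x y : S} (h : x ≠ y) (J : ι) (a : 𝒢 x) (X : 𝒢 y ⊗[ℂ] 𝒢 y)
    (b c : Fin (D.dim J)) : Commute (gaugeAt cil tw D x a) (siteMat cil tw D y J X b c) := by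
  rw [siteMat, matLift_apply]
  exact gaugeAt_commute cil tw D h _ _

theorem siteMat_rMatrix_mul_rMatrixInv (x : S) (I : ι) :
    siteMat cil tw D x I (rMatrix _) * siteMat cil tw D x I (rMatrixInv _) = 1 :=
  map_mul_eq_one _ rMatrix_mul_rMatrixInv

theorem siteMat_rMatrixInv_mul_rMatrix (x : S) (I : ι) :
    siteMat cil tw D x I (rMatrixInv _) * siteMat cil tw D x I (rMatrix _) = 1 :=
  map_mul_eq_one _ rMatrixInv_mul_rMatrix

theorem siteMat_yang_baxter (y : S) (I J : ι) :
    constHom _ _ (tensorMat (repAt tw D y I) (repAt tw D y J) (rMatrix _)) *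
        (kronLeft _ _ _ (siteMat cil tw D y I (rMatrix _)) *
          kronRight _ _ _ (siteMat cil tw D y J (rMatrix _))) =
      kronRight _ _ _ (siteMat cil tw D y J (rMatrix _)) *
        kronLeft _ _ _ (siteMat cil tw D y I (rMatrix _)) *
        constHom _ _ (tensorMat (repAt tw D y I) (repAt tw D y J) (rMatrix _)) :=
  (isQuasitriangular _).matLift_yang_baxter

theorem siteMat_yang_baxter_swap (y : S) (I J : ι) :
    kronLeft _ _ _ (siteMat cil tw D y I (rMatrix _)) *
        kronRight _ _ _ (siteMat cil tw D y J (rMatrix _)) *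
        constHom _ _ (tensorMat (repAt tw D y I) (repAt tw D y J) (swap _ (rMatrix _))) =
      constHom _ _ (tensorMat (repAt tw D y I) (repAt tw D y J) (swap _ (rMatrix _))) *
        (kronRight _ _ _ (siteMat cil tw D y J (rMatrix _)) *
          kronLeft _ _ _ (siteMat cil tw D y I (rMatrix _))) := by
  have h := congrArg (exchange _ _ _) (siteMat_yang_baxter cil tw D y J I)
  simp only [map_mul, exchange_kronLeft, exchange_kronRight, exchange_tensorMat] at h
  exact h.symm

theorem siteMat_inv_yang_baxter_swap (x : S) (I J : ι) :
    kronLeft _ _ _ (siteMat cil tw D x I (rMatrixInv _)) *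
        kronRight _ _ _ (siteMat cil tw D x J (rMatrixInv _)) *
        constHom _ _ (tensorMat (repAt tw D x I) (repAt tw D x J) (swap _ (rMatrixInv _))) =
      constHom _ _ (tensorMat (repAt tw D x I) (repAt tw D x J) (swap _ (rMatrixInv _))) *
        (kronRight _ _ _ (siteMat cil tw D x J (rMatrixInv _)) *
          kronLeft _ _ _ (siteMat cil tw D x I (rMatrixInv _))) := by
  refine inv_mul_inv_eq_of_braid ?_ ?_ ?_ ?_ ?_ ?_ (siteMat_yang_baxter_swap cil tw D x I J)
  · exact map_mul_eq_one _ (siteMat_rMatrix_mul_rMatrixInv cil tw D x I)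
  · exact map_mul_eq_one _ (siteMat_rMatrixInv_mul_rMatrix cil tw D x I)
  · exact map_mul_eq_one _ (siteMat_rMatrix_mul_rMatrixInv cil tw D x J)
  · exact map_mul_eq_one _ (siteMat_rMatrixInv_mul_rMatrix cil tw D x J)
  · exact map_mul_eq_one _ (map_mul_eq_one _ (map_mul_eq_one _ rMatrix_mul_rMatrixInv))
  · exact map_mul_eq_one _ (map_mul_eq_one _ (map_mul_eq_one _ rMatrixInv_mul_rMatrix))

/-- The matrix `(τ_y ⊗ id)(R_y) U^I(-i) (τ_x ⊗ id)(R_x⁻¹)`, for a link `i` from `x` to `y`. It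
is the conjugate transpose of `U^I(i)`: its entry at `(b, a)` will be `θ(U^I_{ab}(i))`. -/
def connStar (I : ι) (i : G.Dart) :
    Matrix (Fin (D.dim I)) (Fin (D.dim I)) (LatticeAlg cil tw D) :=
  siteMat cil tw D i.snd I (rMatrix (𝒢 i.snd)) * connMat cil tw D I i.symm *
    siteMat cil tw D i.fst I (rMatrixInv (𝒢 i.fst))

theorem connStar_symm (I : ι) (i : G.Dart) :
    connStar cil tw D I i.symm =
      siteMat cil tw D i.fst I (rMatrix _) * connMat cil tw D I i *
        siteMat cil tw D i.snd I (rMatrixInv _) := by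
  conv_lhs => rw [connStar, SimpleGraph.Dart.symm_symm]
  rfl

theorem connStar_symm_mul_connStar (I : ι) (i : G.Dart) :
    connStar cil tw D I i.symm * connStar cil tw D I i = 1 := by
  calc _ = siteMat cil tw D i.fst I (rMatrix _) * (connMat cil tw D I i *
        ((siteMat cil tw D i.snd I (rMatrixInv _) * siteMat cil tw D i.snd I (rMatrix _)) *
          connMat cil tw D I i.symm)) * siteMat cil tw D i.fst I (rMatrixInv _) := by
        rw [connStar_symm, connStar]; simp only [mul_assoc]
    _ = 1 := by
        rw [siteMat_rMatrixInv_mul_rMatrix, one_mul, connMat_mul_connMat_symm, mul_one,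
          siteMat_rMatrix_mul_rMatrixInv]

theorem connMat_symm_mul_connMat (I : ι) (i : G.Dart) :
    connMat cil tw D I i.symm * connMat cil tw D I i = 1 := by
  have h := connMat_mul_connMat_symm cil tw D I i.symm
  rwa [SimpleGraph.Dart.symm_symm] at h

theorem kronRight_connStar_mul_kronLeft_connStar_braided (I J : ι) (i : G.Dart) :
    kronRight _ _ _ (connStar cil tw D J i) * kronLeft _ _ _ (connStar cil tw D I i) =
      kronRight _ _ _ (siteMat cil tw D i.snd J (rMatrix _)) *
        kronLeft _ _ _ (siteMat cil tw D i.snd I (rMatrix _)) *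
        constHom _ _ (tensorMat (repAt tw D i.snd I) (repAt tw D i.snd J) (rMatrix _)) *
        (kronRight _ _ _ (connMat cil tw D J i.symm) * kronLeft _ _ _ (connMat cil tw D I i.symm)) *
        constHom _ _ (tensorMat (repAt tw D i.fst I) (repAt tw D i.fst J) (swap _ (rMatrixInv _))) *
        (kronRight _ _ _ (siteMat cil tw D i.fst J (rMatrixInv _)) *
          kronLeft _ _ _ (siteMat cil tw D i.fst I (rMatrixInv _))) := by
  simp only [connStar, map_mul]
  refine mul_triple_interleave ?_ ?_ ?_
  · exact kronRight_matLift_commute_kronLeft _ _ _ fun a b c =>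
      gaugeAt_commute_siteMat cil tw D i.adj.ne I a _ b c
  · exact (isQuasitriangular _).kronRight_mul_kronLeft_matLift
      fun a => (source_covariance cil tw D J i.symm rfl a).symm
  · exact (isQuasitriangular _).kronRight_matLift_inv_mul_kronLeft
      (target_covariance cil tw D I i.symm rfl)

theorem kronRight_connStar_mul_kronLeft_connStar (I J : ι) (i : G.Dart) :
    kronRight _ _ _ (connStar cil tw D J i) * kronLeft _ _ _ (connStar cil tw D I i) =
      kronRight _ _ _ (siteMat cil tw D i.snd J (rMatrix _)) *
        kronLeft _ _ _ (siteMat cil tw D i.snd I (rMatrix _)) *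
        (kronLeft _ _ _ (connMat cil tw D I i.symm) * kronRight _ _ _ (connMat cil tw D J i.symm)) *
        (kronRight _ _ _ (siteMat cil tw D i.fst J (rMatrixInv _)) *
          kronLeft _ _ _ (siteMat cil tw D i.fst I (rMatrixInv _))) := by
  rw [kronRight_connStar_mul_kronLeft_connStar_braided, connMat_braid_self cil tw D I J i.symm]
  simp only [mul_assoc]
  rfl

theorem kronLeft_connStar_mul_kronRight_connStar (I J : ι) (i : G.Dart) :
    kronLeft _ _ _ (connStar cil tw D I i) * kronRight _ _ _ (connStar cil tw D J i) =
      kronLeft _ _ _ (siteMat cil tw D i.snd I (rMatrix _)) *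
        kronRight _ _ _ (siteMat cil tw D i.snd J (rMatrix _)) *
        (kronRight _ _ _ (connMat cil tw D J i.symm) * kronLeft _ _ _ (connMat cil tw D I i.symm)) *
        (kronLeft _ _ _ (siteMat cil tw D i.fst I (rMatrixInv _)) *
          kronRight _ _ _ (siteMat cil tw D i.fst J (rMatrixInv _))) := by
  have h := congrArg (exchange _ _ _) (kronRight_connStar_mul_kronLeft_connStar cil tw D J I i)
  simp only [map_mul, exchange_kronLeft, exchange_kronRight] at h
  exact h


theorem connStar_braid_self (I J : ι) (i : G.Dart) :
    kronRight _ _ _ (connStar cil tw D J i) * kronLeft _ _ _ (connStar cil tw D I i) =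
      constHom _ _ (tensorMat (repAt tw D i.snd I) (repAt tw D i.snd J) (rMatrix _)) *
        (kronLeft _ _ _ (connStar cil tw D I i) * kronRight _ _ _ (connStar cil tw D J i)) *
        constHom _ _
          (tensorMat (repAt tw D i.fst I) (repAt tw D i.fst J) (swap _ (rMatrixInv _))) := by
  rw [kronRight_connStar_mul_kronLeft_connStar_braided, kronLeft_connStar_mul_kronRight_connStar,
    ← siteMat_yang_baxter cil tw D i.snd I J]
  simp only [mul_assoc]
  rw [← siteMat_inv_yang_baxter_swap cil tw D i.fst I J]
  simp only [mul_assoc]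

theorem kronRight_connMat_mul_kronLeft_siteMat (I J : ι) (j : G.Dart) {y : S} (h : j.fst = y) :
    kronRight _ _ _ (connMat cil tw D J j) * kronLeft _ _ _ (siteMat cil tw D y I (rMatrix _)) =
      kronLeft _ _ _ (siteMat cil tw D y I (rMatrix _)) *
        constHom _ _ (tensorMat (repAt tw D y I) (repAt tw D y J) (rMatrix _)) *
        kronRight _ _ _ (connMat cil tw D J j) :=
  (isQuasitriangular _).kronRight_mul_kronLeft_matLift
    fun a => (source_covariance cil tw D J j h a).symm

theorem kronLeft_connMat_mul_kronRight_siteMat (I J : ι) (j : G.Dart) {y : S} (h : j.fst = y) :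
    kronLeft _ _ _ (connMat cil tw D I j) * kronRight _ _ _ (siteMat cil tw D y J (rMatrix _)) =
      kronRight _ _ _ (siteMat cil tw D y J (rMatrix _)) *
        constHom _ _ (tensorMat (repAt tw D y I) (repAt tw D y J) (swap _ (rMatrix _))) *
        kronLeft _ _ _ (connMat cil tw D I j) := by
  have h := congrArg (exchange _ _ _) (kronRight_connMat_mul_kronLeft_siteMat cil tw D J I j h)
  simp only [map_mul, exchange_kronLeft, exchange_kronRight, exchange_tensorMat] at h
  exact h

theorem connMat_symm_braid_target (I J : ι) {i j : G.Dart} (h : cil.Before i j) {y : S}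
    (hi : i.snd = y) (hj : j.snd = y) :
    kronLeft _ _ _ (connMat cil tw D I i.symm) * kronRight _ _ _ (connMat cil tw D J j.symm) =
      constHom _ _ (tensorMat (repAt tw D y I) (repAt tw D y J) (rMatrix (𝒢 y))) *
        (kronRight _ _ _ (connMat cil tw D J j.symm) *
          kronLeft _ _ _ (connMat cil tw D I i.symm)) := by
  refine inv_mul_inv_eq_of_mul_eq ?_ ?_ ?_ ?_ (connMat_braid_target cil tw D I J h hi hj)
  · exact map_mul_eq_one _ (connMat_mul_connMat_symm cil tw D I i)
  · exact map_mul_eq_one _ (connMat_symm_mul_connMat cil tw D I i)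
  · exact map_mul_eq_one _ (connMat_mul_connMat_symm cil tw D J j)
  · exact map_mul_eq_one _ (connMat_symm_mul_connMat cil tw D J j)

theorem connStar_of_snd_eq (I : ι) (i : G.Dart) {y : S} (h : i.snd = y) :
    connStar cil tw D I i = siteMat cil tw D y I (rMatrix _) * connMat cil tw D I i.symm *
      siteMat cil tw D i.fst I (rMatrixInv _) := by
  subst h; rfl

theorem connStar_braid_target (I J : ι) {i j : G.Dart} (h : cil.Before i j) {y : S}
    (hi : i.snd = y) (hj : j.snd = y) :
    kronRight _ _ _ (connStar cil tw D J j) * kronLeft _ _ _ (connStar cil tw D I i) =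
      constHom _ _ (tensorMat (repAt tw D y I) (repAt tw D y J) (swap _ (rMatrixInv _))) *
        (kronLeft _ _ _ (connStar cil tw D I i) * kronRight _ _ _ (connStar cil tw D J j)) := by
  have hx : i.fst ≠ y := hi ▸ i.adj.ne
  have hz : j.fst ≠ y := hj ▸ j.adj.ne
  have site_comm : Commute
      (kronLeft _ _ (Fin (D.dim J)) (siteMat cil tw D i.fst I (rMatrixInv _)))
      (kronRight _ (Fin (D.dim I)) _ (siteMat cil tw D j.fst J (rMatrixInv _))) :=
    kronLeft_matLift_commute_kronRight _ _ _
      fun a b c => gaugeAt_commute_siteMat cil tw D h.fst_ne J a _ b c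
  have swap_rMatrixInv_mul :
      constHom (LatticeAlg cil tw D) _
          (tensorMat (repAt tw D y I) (repAt tw D y J) (swap _ (rMatrixInv _))) *
        constHom (LatticeAlg cil tw D) _
          (tensorMat (repAt tw D y I) (repAt tw D y J) (swap _ (rMatrix _))) = 1 :=
    map_mul_eq_one _ (map_mul_eq_one _ (map_mul_eq_one _ rMatrixInv_mul_rMatrix))
  rw [connStar_of_snd_eq cil tw D I i hi, connStar_of_snd_eq cil tw D J j hj]
  simp only [map_mul (kronLeft _ _ _), map_mul (kronRight _ _ _)]
  rw [mul_triple_interleave (s := 1) ?_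
      (kronRight_connMat_mul_kronLeft_siteMat cil tw D I J j.symm hj) ?_,
    mul_triple_interleave (s := 1) ?_
      (kronLeft_connMat_mul_kronRight_siteMat cil tw D I J i.symm hi) ?_,
    siteMat_yang_baxter_swap cil tw D y I J, connMat_symm_braid_target cil tw D I J h hi hj,
    site_comm.eq]
  · simp only [← mul_assoc]
    rw [swap_rMatrixInv_mul]
    simp only [mul_assoc, one_mul, mul_one]
  · exact (kronLeft_matLift_commute_kronRight _ _ _
      fun a b c => gaugeAt_commute_siteMat cil tw D hx J a _ b c).eq
  · rw [mul_one]
    exact (kronLeft_matLift_commute_kronRight _ _ _ fun a b c =>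
      other_covariance cil tw D J j.symm (hj.symm ▸ hx :) h.fst_ne a (b, c)).eq
  · exact (kronRight_matLift_commute_kronLeft _ _ _
      fun a b c => gaugeAt_commute_siteMat cil tw D hz I a _ b c).eq
  · rw [mul_one]
    exact (kronRight_matLift_commute_kronLeft _ _ _ fun a b c =>
      other_covariance cil tw D I i.symm (hi.symm ▸ hz :) h.fst_ne.symm a (b, c)).eq

theorem kronLeft_siteMat_commute_connStar (I J : ι) (j : G.Dart) {x : S} (h₁ : x ≠ j.fst)
    (h₂ : x ≠ j.snd) (X : 𝒢 x ⊗[ℂ] 𝒢 x) :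
    Commute (kronLeft _ _ (Fin (D.dim J)) (siteMat cil tw D x I X))
      (kronRight _ (Fin (D.dim I)) _ (connStar cil tw D J j)) := by
  rw [connStar, map_mul, map_mul]
  refine Commute.mul_right (Commute.mul_right ?_ ?_) ?_
  · exact kronLeft_matLift_commute_kronRight _ _ _
      fun a b c => gaugeAt_commute_siteMat cil tw D h₂ J a _ b c
  · exact kronLeft_matLift_commute_kronRight _ _ _
      fun a b c => other_covariance cil tw D J j.symm h₂ h₁ a (b, c)
  · exact kronLeft_matLift_commute_kronRight _ _ _
      fun a b c => gaugeAt_commute_siteMat cil tw D h₁ J a _ b c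

theorem kronLeft_connMat_symm_commute_siteMat (I J : ι) (i : G.Dart) {x : S} (h₁ : x ≠ i.fst)
    (h₂ : x ≠ i.snd) (X : 𝒢 x ⊗[ℂ] 𝒢 x) :
    Commute (kronLeft _ _ (Fin (D.dim J)) (connMat cil tw D I i.symm))
      (kronRight _ (Fin (D.dim I)) _ (siteMat cil tw D x J X)) :=
  (kronRight_matLift_commute_kronLeft _ _ _
    fun a b c => other_covariance cil tw D I i.symm h₂ h₁ a (b, c)).symm

theorem connStar_commute (I J : ι) {i j : G.Dart} (h : NoCommonEnd i j) :
    Commute (kronLeft _ _ _ (connStar cil tw D I i)) (kronRight _ _ _ (connStar cil tw D J j)) := by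
  obtain ⟨fst_ne_fst, fst_ne_snd, snd_ne_fst, snd_ne_snd⟩ := h
  rw [connStar, map_mul, map_mul]
  refine Commute.mul_left (Commute.mul_left ?_ ?_) ?_
  · exact kronLeft_siteMat_commute_connStar cil tw D I J j snd_ne_fst snd_ne_snd _
  · rw [connStar, map_mul, map_mul]
    refine Commute.mul_right (Commute.mul_right ?_ ?_) ?_
    · exact kronLeft_connMat_symm_commute_siteMat cil tw D I J i fst_ne_snd.symm
        snd_ne_snd.symm _
    · exact kronLeft_commute_kronRight fun a b c d =>
        conn_commute_of_noCommonEnd cil tw D I J ⟨snd_ne_snd, snd_ne_fst, fst_ne_snd, fst_ne_fst⟩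
          (a, b) (c, d)
    · exact kronLeft_connMat_symm_commute_siteMat cil tw D I J i fst_ne_fst.symm
        snd_ne_fst.symm _
  · exact kronLeft_siteMat_commute_connStar cil tw D I J j fst_ne_fst fst_ne_snd _

theorem connStar_functoriality (I J : ι) (i : G.Dart) :
    kronRight _ _ _ (connStar cil tw D J i) * kronLeft _ _ _ (connStar cil tw D I i) =
      ∑ K, ∑ a, constMap (LatticeAlg cil tw D) (cgAt tw D i.snd I J K a).conjTranspose *
        connStar cil tw D K i * constMap (LatticeAlg cil tw D) (cgAt tw D i.fst I J K a) := by
  rw [kronRight_connStar_mul_kronLeft_connStar, connMat_functoriality,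
    Finset.mul_sum, Finset.sum_mul]
  refine Finset.sum_congr rfl fun K _ => ?_
  rw [Finset.mul_sum, Finset.sum_mul]
  refine Finset.sum_congr rfl fun a _ => ?_
  let ρσcop := (tensorMat (repAt tw D i.snd I) (repAt tw D i.snd J)).comp
    ((swap _).comp (Bialgebra.comulAlgHom ℂ _))
  let ρσ := (tensorMat (repAt tw D i.fst I) (repAt tw D i.fst J)).comp
    (Bialgebra.comulAlgHom ℂ _)
  rw [← (isQuasitriangular _).matLift_of_swap_comul (T := ρσcop) fun _ => rfl,
    ← (isQuasitriangular _).matLift_inv_of_comul (T := ρσ) fun _ => rfl]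
  have cgAt_star_naturality := constMap_mul_matLift (ρ := repAt tw D i.snd K) (σ := ρσcop)
    (cgAt_conjTranspose_intertwines tw D i.snd I J K a) (gaugeAt cil tw D i.snd) (rMatrix _)
  have cgAt_naturality := constMap_mul_matLift (ρ := ρσ) (σ := repAt tw D i.fst K)
    (cgAt_intertwines tw D i.fst I J K a) (gaugeAt cil tw D i.fst) (rMatrixInv _)
  calc _ = matLift ρσcop (gaugeAt cil tw D i.snd) (rMatrix _) *
        constMap (LatticeAlg cil tw D) (cgAt tw D i.snd I J K a).conjTranspose *
        connMat cil tw D K i.symm *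
        (constMap (LatticeAlg cil tw D) (cgAt tw D i.fst I J K a) *
          matLift ρσ (gaugeAt cil tw D i.fst) (rMatrixInv _)) := by
        simp only [Matrix.mul_assoc]; rfl
    _ = _ := by
        rw [← cgAt_star_naturality, cgAt_naturality, connStar]
        simp only [Matrix.mul_assoc]

end ConnStar

/-! ### The conjugation of the gauge algebra -/

theorem subalgebra_eq_top_of_single_mem {S : Type*} [Finite S] [DecidableEq S] {A : S → Type*}
    [∀ x, Ring (A x)] [∀ x, Algebra ℂ (A x)] (P : Subalgebra ℂ (⨂[ℂ] x, A x))
    (h : ∀ z a, PiTensorProduct.singleAlgHom z a ∈ P) : P = ⊤ := by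
  cases nonempty_fintype S
  have tprod_mem (f : ∀ z, A z) : PiTensorProduct.tprod ℂ f ∈ P := by
    have noncommProd_mem : f ∈ P.toSubmonoid.comap (PiTensorProduct.tprodMonoidHom ℂ) := by
      rw [← Finset.noncommProd_mulSingle f]
      refine Submonoid.noncommProd_mem _ _ _ _ fun z _ => ?_
      have single_mem := h z (f z)
      rwa [PiTensorProduct.singleAlgHom_apply] at single_mem
    exact noncommProd_mem
  refine Algebra.eq_top_iff.2 fun ξ => ?_
  induction ξ using PiTensorProduct.induction_on with
  | smul_tprod r f => exact P.smul_mem (tprod_mem f) r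
  | add X Y hX hY => exact P.add_mem hX hY

section GaugeStar

variable {S : Type*} [Fintype S] [DecidableEq S] {𝒢 : S → Type*}
  [∀ x, Ring (𝒢 x)] [∀ x, HopfAlgebra ℂ (𝒢 x)] [∀ x, StarRing (𝒢 x)]
  [∀ x, StarModule ℂ (𝒢 x)] [∀ x, RibbonHopfStarAlgebra (𝒢 x)]

theorem gaugeStar_smul_tprod (c : ℂ) (f : ∀ x, 𝒢 x) :
    gaugeStar 𝒢 (c • PiTensorProduct.tprod ℂ f) =
      star c • PiTensorProduct.tprod ℂ fun x => star (f x) := by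
  rw [map_smulₛₗ, gaugeStar_tprod]
  rfl

theorem gaugeStar_mul (ξ ξ' : GaugeAlg 𝒢) :
    gaugeStar 𝒢 (ξ * ξ') = gaugeStar 𝒢 ξ' * gaugeStar 𝒢 ξ := by
  induction ξ using PiTensorProduct.induction_on with
  | smul_tprod r f =>
    induction ξ' using PiTensorProduct.induction_on with
    | smul_tprod r' f' =>
      rw [PiTensorProduct.smul_tprod_mul_smul_tprod, gaugeStar_smul_tprod, gaugeStar_smul_tprod,
        gaugeStar_smul_tprod, PiTensorProduct.smul_tprod_mul_smul_tprod, star_mul]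
      simp only [Pi.mul_apply, star_mul]
      rfl
    | add X Y hX hY => rw [mul_add, map_add, hX, hY, map_add, add_mul]
  | add X Y hX hY => rw [add_mul, map_add, hX, hY, map_add, mul_add]

theorem gaugeStar_gaugeStar (ξ : GaugeAlg 𝒢) : gaugeStar 𝒢 (gaugeStar 𝒢 ξ) = ξ := by
  induction ξ using PiTensorProduct.induction_on with
  | smul_tprod r f => rw [gaugeStar_smul_tprod, gaugeStar_smul_tprod]; simp
  | add X Y hX hY => rw [map_add, map_add, hX, hY]

theorem gaugeStar_one : gaugeStar 𝒢 (1 : GaugeAlg 𝒢) = 1 := by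
  rw [PiTensorProduct.one_def, gaugeStar_tprod]
  simp only [Pi.one_apply, star_one]
  rfl

theorem gaugeStar_single (z : S) (a : 𝒢 z) :
    gaugeStar 𝒢 (PiTensorProduct.singleAlgHom z a) = PiTensorProduct.singleAlgHom z (star a) := by
  rw [PiTensorProduct.singleAlgHom_apply, PiTensorProduct.singleAlgHom_apply, gaugeStar_tprod]
  congr 1
  funext y
  by_cases h : y = z
  · subst h; simp
  · simp [h]

end GaugeStar

/-! ### Covariance of the conjugate link matrices -/

section LinkSlice

variable {S : Type*} [Fintype S] [DecidableEq S] {G : SimpleGraph S} {𝒢 : S → Type*}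
  [∀ x, Ring (𝒢 x)] [∀ x, HopfAlgebra ℂ (𝒢 x)] [∀ x, StarRing (𝒢 x)]
  [∀ x, StarModule ℂ (𝒢 x)] [∀ x, RibbonHopfStarAlgebra (𝒢 x)]
  {H : Type*} [Ring H] [HopfAlgebra ℂ H] [StarRing H] [StarModule ℂ H] [RibbonHopfStarAlgebra H]
  {ι : Type*} (tw : ∀ x, TwistEquiv (𝒢 x) H) (D : RepData H ι)

theorem slice_singleTensor (I : ι) (i : G.Dart) (z : S) (X : 𝒢 z ⊗[ℂ] 𝒢 z) (β α : D.Ix I) :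
    slice (linkRep tw D I i) β α (singleTensor z X) =
      PiTensorProduct.singleAlgHom (R := ℂ) (A := 𝒢) z (slice (linkRepAt tw D I i z) β α X) := by
  induction X with
  | zero => rw [map_zero, map_zero, map_zero, map_zero]
  | add X Y hX hY => simp only [map_add, hX, hY]
  | tmul a b =>
    simp only [singleTensor, Algebra.TensorProduct.map_tmul, slice, LinearMap.comp_apply,
      LinearMap.rTensor_tmul, LinearEquiv.coe_coe, TensorProduct.lid_tmul, AlgHom.toLinearMap_apply,
      linkRep, piLift_single, map_smul]

end LinkSlice

section StarCovariance

variable {S : Type*} [Fintype S] [DecidableEq S] {G : SimpleGraph S} (cil : Ciliation G)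
  {𝒢 : S → Type*}
  [∀ x, Ring (𝒢 x)] [∀ x, HopfAlgebra ℂ (𝒢 x)] [∀ x, StarRing (𝒢 x)]
  [∀ x, StarModule ℂ (𝒢 x)] [∀ x, RibbonHopfStarAlgebra (𝒢 x)]
  {H : Type*} [Ring H] [HopfAlgebra ℂ H] [StarRing H] [StarModule ℂ H] [RibbonHopfStarAlgebra H]
  {ι : Type*} [Fintype ι] (tw : ∀ x, TwistEquiv (𝒢 x) H) (D : RepData H ι)

theorem connStar_target_covariance (I : ι) (i : G.Dart) {y : S} (h : i.snd = y) (ζ : 𝒢 y) :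
    connStar cil tw D I i * siteDiag cil tw D y I ζ =
      siteMat cil tw D y I (swap _ (comul (R := ℂ) ζ)) * connStar cil tw D I i := by
  have hx : i.fst ≠ y := h ▸ i.adj.ne
  have siteMat_commute : Commute (siteDiag cil tw D y I ζ) (siteMat cil tw D i.fst I _) :=
    diagHom_commute_iff.2 (gaugeAt_commute_siteMat cil tw D hx.symm I ζ (rMatrixInv _))
  have source_covariance_symm := source_covariance cil tw D I i.symm (x := y) h ζ
  have R_comul := congrArg (siteMat cil tw D y I) (RibbonHopfStarAlgebra.R_comul ζ)
  rw [map_mul, map_mul] at R_comul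
  rw [connStar_of_snd_eq cil tw D I i h, mul_assoc, ← siteMat_commute.eq, ← mul_assoc,
    mul_assoc _ _ (siteDiag _ _ _ _ _ _), ← source_covariance_symm, ← mul_assoc, R_comul]
  simp only [mul_assoc]

theorem connStar_source_covariance (I : ι) (i : G.Dart) {x : S} (h : i.fst = x) (ζ : 𝒢 x) :
    siteDiag cil tw D x I ζ * connStar cil tw D I i =
      connStar cil tw D I i * siteMat cil tw D x I (swap _ (comul (R := ℂ) ζ)) := by
  subst h
  have siteMat_commute : Commute (siteDiag cil tw D i.fst I ζ) (siteMat cil tw D i.snd I _) :=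
    diagHom_commute_iff.2 (gaugeAt_commute_siteMat cil tw D i.adj.ne I ζ (rMatrix _))
  have target_covariance_symm := target_covariance cil tw D I i.symm (y := i.fst) rfl ζ
  have R_comul := congrArg (siteMat cil tw D i.fst I)
    ((isQuasitriangular (𝒢 i.fst)).inv_mul_swap_comul ζ)
  rw [map_mul, map_mul] at R_comul
  rw [connStar, ← mul_assoc, ← mul_assoc, siteMat_commute.eq,
    mul_assoc _ _ (connMat _ _ _ _ _), target_covariance_symm,
    mul_assoc _ _ (siteMat _ _ _ _ _ (swap _ _)), R_comul]
  simp only [mul_assoc]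

theorem connStar_other_covariance (I : ι) (i : G.Dart) {z : S} (h₁ : z ≠ i.fst) (h₂ : z ≠ i.snd)
    (ξ : 𝒢 z) (a b : Fin (D.dim I)) :
    Commute (gaugeAt cil tw D z ξ) (connStar cil tw D I i a b) := by
  refine diagHom_commute_iff.1 (Commute.mul_right (Commute.mul_right ?_ ?_) ?_) a b
  · exact diagHom_commute_iff.2 (gaugeAt_commute_siteMat cil tw D h₂ I ξ _)
  · exact diagHom_commute_iff.2 fun a b => other_covariance cil tw D I i.symm h₂ h₁ ξ (a, b)
  · exact diagHom_commute_iff.2 (gaugeAt_commute_siteMat cil tw D h₁ I ξ _)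

/-- The element `(τ^{I,i}_{βα} ⊗ id)(X)^*` of the lattice algebra, for `X ∈ 𝒢_z ⊗ 𝒢_z`: at
`X = Δ(ξ)` these are the coefficients of the conjugated covariance relation. -/
def starSlice (I : ι) (i : G.Dart) (z : S) (β α : D.Ix I) (X : 𝒢 z ⊗[ℂ] 𝒢 z) :
    LatticeAlg cil tw D :=
  gaugeAt cil tw D z (star (slice (linkRepAt tw D I i z) β α X))

theorem starSlice_add (I : ι) (i : G.Dart) (z : S) (β α : D.Ix I) (X Y : 𝒢 z ⊗[ℂ] 𝒢 z) :
    starSlice cil tw D I i z β α (X + Y) =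
      starSlice cil tw D I i z β α X + starSlice cil tw D I i z β α Y := by
  simp [starSlice]

theorem starSlice_tmul (I : ι) (i : G.Dart) (z : S) (β α : D.Ix I) (a b : 𝒢 z) :
    starSlice cil tw D I i z β α (a ⊗ₜ b) =
      star (linkRepAt tw D I i z a β α) • gaugeAt cil tw D z (star b) := by
  simp [starSlice, slice]

theorem sum_starSlice_target (I : ι) (i : G.Dart) (X : 𝒢 i.snd ⊗[ℂ] 𝒢 i.snd) (α : D.Ix I)
    (W : Matrix (Fin (D.dim I)) (Fin (D.dim I)) (LatticeAlg cil tw D)) :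
    ∑ β, starSlice cil tw D I i i.snd β α X * W β.2 β.1 =
      (siteMat cil tw D i.snd I (star X) * W) α.2 α.1 := by
  induction X with
  | zero => simp [starSlice]
  | add X Y hX hY =>
    simp only [starSlice_add, add_mul, Finset.sum_add_distrib, hX, hY, star_add, map_add,
      Matrix.add_apply]
  | tmul a b =>
    rw [Fintype.sum_prod_type, Finset.sum_eq_single α.1, TensorProduct.star_tmul, Matrix.mul_apply]
    · refine Finset.sum_congr rfl fun c _ => ?_
      rw [starSlice_tmul, linkRepAt_target tw D I i rfl, siteMat, matLift_tmul_apply, repAt_star]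
      simp [targetRep, Matrix.kroneckerMap_apply]
    · intro c _ hc
      refine Finset.sum_eq_zero fun d _ => ?_
      rw [starSlice_tmul, linkRepAt_target tw D I i rfl]
      simp [targetRep, Matrix.kroneckerMap_apply, hc]
    · simp

theorem sum_starSlice_source (I : ι) (i : G.Dart) (X : 𝒢 i.fst ⊗[ℂ] 𝒢 i.fst) (α : D.Ix I)
    (W : Matrix (Fin (D.dim I)) (Fin (D.dim I)) (LatticeAlg cil tw D)) :
    ∑ β, starSlice cil tw D I i i.fst β α X * W β.2 β.1 =
      sandwich (siteDiag cil tw D i.fst I : _ →ₗ[ℂ] _)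
        ((((constHom (LatticeAlg cil tw D) _).comp (repAt tw D i.fst I) : _ →ₐ[ℂ] _) : _ →ₗ[ℂ] _) ∘ₗ
          antipode ℂ) W (swap _ (star X)) α.2 α.1 := by
  induction X with
  | zero => simp [starSlice]
  | add X Y hX hY =>
    simp only [starSlice_add, add_mul, Finset.sum_add_distrib, hX, hY, star_add, map_add,
      Matrix.add_apply]
  | tmul a b =>
    rw [TensorProduct.star_tmul, swap_tmul, sandwich_tmul]
    change _ = (diagHom (LatticeAlg cil tw D) (Fin (D.dim I)) (gaugeAt cil tw D i.fst (star b)) *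
      W * constHom (LatticeAlg cil tw D) (Fin (D.dim I))
        (repAt tw D i.fst I (antipode ℂ (star a)))) α.2 α.1
    rw [Fintype.sum_prod_type, Matrix.mul_apply]
    refine Finset.sum_congr rfl fun c _ => ?_
    rw [Finset.sum_eq_single α.2, diagHom_mul_apply, starSlice_tmul,
      linkRepAt_source tw D I i rfl, RibbonHopfStarAlgebra.antipode_star, repAt_star,
      constHom_apply, ← Algebra.commutes, ← Algebra.smul_def]
    · simp [sourceRep, Matrix.kroneckerMap_apply]
    · intro d _ hd
      rw [starSlice_tmul, linkRepAt_source tw D I i rfl]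
      simp [sourceRep, Matrix.kroneckerMap_apply, hd]
    · simp

theorem starSlice_other (I : ι) (i : G.Dart) {z : S} (h₁ : z ≠ i.fst) (h₂ : z ≠ i.snd)
    (ξ : 𝒢 z) (β α : D.Ix I) :
    starSlice cil tw D I i z β α (comul (R := ℂ) ξ) =
      if β = α then gaugeAt cil tw D z (star ξ) else 0 := by
  have slice_counitHom (X : 𝒢 z ⊗[ℂ] 𝒢 z) :
      slice (counitHom ℂ (𝒢 z) (Matrix (D.Ix I) (D.Ix I) ℂ)) β α X =
      if β = α then TensorProduct.lid ℂ (𝒢 z) ((counit (R := ℂ)).rTensor (𝒢 z) X) else 0 := by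
    induction X with
    | zero => simp
    | add X Y hX hY =>
      simp only [map_add, hX, hY]
      split_ifs <;> simp
    | tmul a b =>
      simp only [slice, counitHom_apply, LinearMap.comp_apply, LinearMap.rTensor_tmul,
        LinearEquiv.coe_coe, TensorProduct.lid_tmul, AlgHom.toLinearMap_apply,
        Matrix.entryLinearMap_apply, Matrix.algebraMap_matrix_apply]
      split_ifs <;> simp
  rw [starSlice, linkRepAt_other tw D I i h₁ h₂, slice_counitHom]
  split_ifs <;> simp

theorem gauge_gaugeStar_slice_single (I : ι) (i : G.Dart) (z : S) (ξ : 𝒢 z) (β α : D.Ix I) :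
    gauge cil tw D (gaugeStar 𝒢 (slice (linkRep tw D I i) β α
      (gaugeComul 𝒢 (PiTensorProduct.singleAlgHom z ξ)))) =
      starSlice cil tw D I i z β α (comul (R := ℂ) ξ) := by
  rw [gaugeComul_single, slice_singleTensor, gaugeStar_single]
  rfl

theorem connStar_covariance_single (I : ι) (i : G.Dart) (z : S) (ξ : 𝒢 z) (α : D.Ix I) :
    connStar cil tw D I i α.2 α.1 * gauge cil tw D (gaugeStar 𝒢 (PiTensorProduct.singleAlgHom z ξ))
        =
      ∑ β, gauge cil tw D (gaugeStar 𝒢 (slice (linkRep tw D I i) β α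
        (gaugeComul 𝒢 (PiTensorProduct.singleAlgHom z ξ)))) *
        connStar cil tw D I i β.2 β.1 := by
  simp only [gauge_gaugeStar_slice_single]
  rw [gaugeStar_single, ← gaugeAt_apply]
  have mul_gaugeAt : connStar cil tw D I i α.2 α.1 * gaugeAt cil tw D z (star ξ) =
      (connStar cil tw D I i * siteDiag cil tw D z I (star ξ)) α.2 α.1 := by
    rw [AlgHom.comp_apply, mul_diagHom_apply]
  by_cases hy : z = i.snd
  · subst hy
    rw [sum_starSlice_target, star_comul, ← connStar_target_covariance cil tw D I i rfl,
      mul_gaugeAt]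
  by_cases hx : z = i.fst
  · subst hx
    rw [sum_starSlice_source, star_comul, swap_swap, mul_gaugeAt]
    refine congrFun (congrFun ?_ α.2) α.1
    refine (sandwich_comul_of_mul_lift
      (f := (constHom (LatticeAlg cil tw D) (Fin (D.dim I))).comp (repAt tw D i.fst I))
      (h := fun _ _ => (constHom_commute_diagHom _ _).symm) (fun a => ?_) (star ξ)).symm
    exact (connStar_source_covariance cil tw D I i rfl a).trans (congrArg _ (lift_swap _ _ _ _))
  · simp only [starSlice_other cil tw D I i hx hy]
    simp [(connStar_other_covariance cil tw D I i hx hy (star ξ) α.2 α.1).eq]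

theorem connStar_covariance (I : ι) (i : G.Dart) (ξ : GaugeAlg 𝒢) (α : D.Ix I) :
    connStar cil tw D I i α.2 α.1 * gauge cil tw D (gaugeStar 𝒢 ξ) =
      ∑ β, gauge cil tw D (gaugeStar 𝒢 (slice (linkRep tw D I i) β α (gaugeComul 𝒢 ξ))) *
        connStar cil tw D I i β.2 β.1 := by
  let φ : GaugeAlg 𝒢 →+ LatticeAlg cil tw D :=
    (gaugeHom cil tw D).toLinearMap.toAddMonoidHom.comp (gaugeStar 𝒢).toAddMonoidHom
  have φ_mul (ξ ξ' : GaugeAlg 𝒢) : φ (ξ * ξ') = φ ξ' * φ ξ :=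
    (congrArg (gaugeHom cil tw D) (gaugeStar_mul ξ ξ')).trans (map_mul _ _ _)
  have φ_algebraMap (c : ℂ) : φ (algebraMap ℂ _ c) = algebraMap ℂ _ (star c) := by
    change gaugeHom cil tw D (gaugeStar 𝒢 (algebraMap ℂ _ c)) = _
    rw [Algebra.algebraMap_eq_smul_one, map_smulₛₗ, gaugeStar_one, ← Algebra.algebraMap_eq_smul_one,
      AlgHom.commutes]
    rfl
  let P : Subalgebra ℂ (GaugeAlg 𝒢) :=
    { carrier := {ξ | ∀ α : D.Ix I, connStar cil tw D I i α.2 α.1 * φ ξ =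
        ∑ β, φ (slice (linkRep tw D I i) β α (gaugeComul 𝒢 ξ)) * connStar cil tw D I i β.2 β.1}
      mul_mem' := fun {ξ ξ'} h h' α => by
        rw [Set.mem_ofPred_eq] at h h'
        rw [φ_mul, ← mul_assoc, h' α, Finset.sum_mul]
        simp only [mul_assoc, h, Finset.mul_sum]
        rw [Finset.sum_comm]
        refine Finset.sum_congr rfl fun γ _ => ?_
        rw [map_mul, slice_mul, map_sum, Finset.sum_mul]
        simp only [φ_mul, mul_assoc]
      add_mem' := fun {ξ ξ'} h h' α => by
        rw [map_add, mul_add, h α, h' α, ← Finset.sum_add_distrib]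
        simp only [map_add, add_mul]
      algebraMap_mem' := fun c α => by
        simp only [φ_algebraMap, AlgHom.commutes, slice_algebraMap, apply_ite φ, map_zero,
          ite_mul, zero_mul]
        simp [Algebra.commutes] }
  have P_eq_top : P = ⊤ := subalgebra_eq_top_of_single_mem P
    fun z a α => connStar_covariance_single cil tw D I i z a α
  exact (P_eq_top ▸ Algebra.mem_top : ξ ∈ P) α

end StarCovariance

/-! ### Conjugate-linear anti-homomorphisms -/

/-- The opposite of a complex algebra, with the conjugate action of the scalars: a conjugate-linear
anti-homomorphism into `B` is an algebra homomorphism into `ConjOp B`. -/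
def ConjOp (B : Type*) := Bᵐᵒᵖ

section ConjOp

variable {B : Type*} [Ring B]

/-- The element of the conjugate opposite algebra given by `b`. -/
def toConjOp (b : B) : ConjOp B := MulOpposite.op b

instance : Ring (ConjOp B) := inferInstanceAs (Ring Bᵐᵒᵖ)

/-- The element of `B` underlying an element of the conjugate opposite algebra. -/
def unConjOp : ConjOp B →+ B where
  toFun x := MulOpposite.unop x
  map_zero' := rfl
  map_add' _ _ := rfl

theorem unConjOp_injective : Function.Injective (unConjOp (B := B)) := MulOpposite.unop_injective

@[simp] theorem unConjOp_toConjOp (b : B) : unConjOp (toConjOp b) = b := rfl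

@[simp] theorem unConjOp_one : unConjOp (1 : ConjOp B) = 1 := rfl

@[simp] theorem unConjOp_mul (x y : ConjOp B) : unConjOp (x * y) = unConjOp y * unConjOp x := rfl

instance [Algebra ℂ B] : Algebra ℂ (ConjOp B) :=
  RingHom.toAlgebra' ((algebraMap ℂ Bᵐᵒᵖ).comp (starRingEnd ℂ)) fun c x =>
    Algebra.commutes (A := Bᵐᵒᵖ) (star c) x

@[simp] theorem unConjOp_smul [Algebra ℂ B] (c : ℂ) (x : ConjOp B) :
    unConjOp (c • x) = star c • unConjOp x := by
  rw [Algebra.smul_def, unConjOp_mul, Algebra.smul_def, Algebra.commutes]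
  rfl

end ConjOp

/-! ### Existence of `θ` -/

section Theta

variable {S : Type*} [Fintype S] [DecidableEq S] {G : SimpleGraph S} (cil : Ciliation G)
  {𝒢 : S → Type*}
  [∀ x, Ring (𝒢 x)] [∀ x, HopfAlgebra ℂ (𝒢 x)] [∀ x, StarRing (𝒢 x)]
  [∀ x, StarModule ℂ (𝒢 x)] [∀ x, RibbonHopfStarAlgebra (𝒢 x)]
  {H : Type*} [Ring H] [HopfAlgebra ℂ H] [StarRing H] [StarModule ℂ H] [RibbonHopfStarAlgebra H]
  {ι : Type*} [Fintype ι] (tw : ∀ x, TwistEquiv (𝒢 x) H) (D : RepData H ι)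

theorem connStar_functoriality_apply (I J : ι) (i : G.Dart) (α : D.Ix I) (β : D.Ix J) :
    connStar cil tw D J i β.2 β.1 * connStar cil tw D I i α.2 α.1 =
      ∑ K, ∑ a : Fin (D.mult I J K), ∑ γ : D.Ix K,
        star (cgAt tw D i.snd I J K a γ.2 (α.2, β.2) *
          (cgAt tw D i.fst I J K a).conjTranspose.transpose γ.1 (α.1, β.1)) •
            connStar cil tw D K i γ.2 γ.1 := by
  have functoriality := congrFun (congrFun (connStar_functoriality cil tw D I J i)
    (α.2, β.2)) (α.1, β.1)
  rw [kronRight_mul_kronLeft_apply] at functoriality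
  refine functoriality.trans ?_
  simp only [Matrix.sum_apply]
  refine Finset.sum_congr rfl fun K _ => Finset.sum_congr rfl fun a _ => ?_
  rw [constMap_mul_mul_constMap_apply]
  refine Eq.trans ?_ (Fintype.sum_prod_type _).symm
  refine Finset.sum_congr rfl fun c _ => Finset.sum_congr rfl fun d _ => ?_
  simp [mul_comm]

theorem connStar_braid_self_apply (I J : ι) (i : G.Dart) (α : D.Ix I) (β : D.Ix J) :
    connStar cil tw D J i β.2 β.1 * connStar cil tw D I i α.2 α.1 =
      ∑ δ : D.Ix I, ∑ γ : D.Ix J,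
        star (tensorMat (repAt tw D i.fst I) (repAt tw D i.fst J) (rMatrix (𝒢 i.fst))
              (α.1, β.1) (δ.1, γ.1) *
            tensorMat (repAt tw D i.snd I) (repAt tw D i.snd J) (swap _ (rMatrixInv (𝒢 i.snd)))
              (δ.2, γ.2) (α.2, β.2)) •
          (connStar cil tw D I i δ.2 δ.1 * connStar cil tw D J i γ.2 γ.1) := by
  have braid := congrFun (congrFun (connStar_braid_self cil tw D I J i) (α.2, β.2)) (α.1, β.1)
  rw [kronRight_mul_kronLeft_apply] at braid
  refine braid.trans ?_
  simp only [star_mul, star_tensorMat_repAt_apply, star_rMatrix, ← swap_star, star_rMatrixInv,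
    swap_swap]
  generalize tensorMat (repAt tw D i.fst I) (repAt tw D i.fst J) (swap _ (rMatrixInv (𝒢 i.fst))) = Q
  generalize tensorMat (repAt tw D i.snd I) (repAt tw D i.snd J) (rMatrix (𝒢 i.snd)) = P
  change (constMap (LatticeAlg cil tw D) P *
    (kronLeft _ (Fin (D.dim I)) (Fin (D.dim J)) (connStar cil tw D I i) *
      kronRight _ (Fin (D.dim I)) (Fin (D.dim J)) (connStar cil tw D J i)) *
    constMap (LatticeAlg cil tw D) Q) (α.2, β.2) (α.1, β.1) = _
  rw [constMap_mul_mul_constMap_apply]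
  simp only [kronLeft_mul_kronRight_apply, Fintype.sum_prod_type]
  exact Finset.sum_congr rfl fun d _ => Finset.sum_comm

theorem connStar_braid_target_apply {i j : G.Dart} (h : cil.Before i j) (I J : ι)
    (α : D.Ix I) (β : D.Ix J) :
    connStar cil tw D J j β.2 β.1 * connStar cil tw D I i α.2 α.1 =
      ∑ δ : D.Ix I, ∑ γ : D.Ix J,
        star (tensorMat (linkRep tw D I i) (linkRep tw D J j)
          (gaugeR 𝒢 : GaugeAlg 𝒢 ⊗[ℂ] GaugeAlg 𝒢) (δ, γ) (α, β)) •
        (connStar cil tw D I i δ.2 δ.1 * connStar cil tw D J j γ.2 γ.1) := by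
  have braid := congrFun (congrFun (connStar_braid_target cil tw D I J h (y := j.snd)
    h.snd_eq rfl) (α.2, β.2)) (α.1, β.1)
  rw [kronRight_mul_kronLeft_apply, Matrix.mul_apply] at braid
  refine braid.trans ?_
  rw [tensorMat_linkRep_gaugeR_of_target tw D I J h.snd_eq rfl h.fst_ne]
  simp only [tensorMat_targetRep, apply_ite star, star_zero, star_tensorMat_repAt_apply,
    star_rMatrix, kronLeft_mul_kronRight_apply, constHom_apply, ite_smul, zero_smul,
    Fintype.sum_prod_type]
  symm
  rw [Finset.sum_eq_single α.1]
  · refine Finset.sum_congr rfl fun c _ => ?_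
    rw [Finset.sum_eq_single β.1]
    · refine Finset.sum_congr rfl fun d _ => ?_
      simp [Algebra.smul_def]
    · intro d _ hd
      simp [hd]
    · simp
  · intro c _ hc
    simp [hc]
  · simp

theorem connStar_commute_apply {i j : G.Dart} (h : NoCommonEnd i j) (I J : ι)
    (α : D.Ix I) (β : D.Ix J) :
    connStar cil tw D J j β.2 β.1 * connStar cil tw D I i α.2 α.1 =
      ∑ δ : D.Ix I, ∑ γ : D.Ix J,
        star (tensorMat (linkRep tw D I i) (linkRep tw D J j)
          (gaugeR 𝒢 : GaugeAlg 𝒢 ⊗[ℂ] GaugeAlg 𝒢) (δ, γ) (α, β)) •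
        (connStar cil tw D I i δ.2 δ.1 * connStar cil tw D J j γ.2 γ.1) := by
  have commute := congrFun (congrFun (connStar_commute cil tw D I J h).eq (α.2, β.2)) (α.1, β.1)
  rw [kronRight_mul_kronLeft_apply, kronLeft_mul_kronRight_apply] at commute
  rw [← commute, tensorMat_linkRep_gaugeR_of_noCommonEnd tw D I J h]
  simp only [Matrix.one_apply, Prod.mk.injEq, ite_and, apply_ite star, star_one, star_zero,
    ite_smul, one_smul, zero_smul]
  simp

/-- The values of `θ` on the generators of the lattice algebra. -/
def genStar : Gen G 𝒢 D → ConjOp (LatticeAlg cil tw D)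
  | .gauge ξ => toConjOp (gauge cil tw D (gaugeStar 𝒢 ξ))
  | .conn I i α => toConjOp (connStar cil tw D I i α.2 α.1)

/-- The anti-homomorphism `θ` before passing to the quotient by the relations. -/
def freeStar : FreeAlgebra ℂ (Gen G 𝒢 D) →ₐ[ℂ] ConjOp (LatticeAlg cil tw D) :=
  FreeAlgebra.lift ℂ (genStar cil tw D)

theorem freeStar_gauge (ξ : GaugeAlg 𝒢) :
    freeStar cil tw D (freeGauge G D ξ) = toConjOp (gauge cil tw D (gaugeStar 𝒢 ξ)) :=
  FreeAlgebra.lift_ι_apply _ _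

theorem freeStar_conn (I : ι) (i : G.Dart) (α : D.Ix I) :
    freeStar cil tw D (freeConn 𝒢 D I i α) = toConjOp (connStar cil tw D I i α.2 α.1) :=
  FreeAlgebra.lift_ι_apply _ _

theorem freeStar_rel {X Y : FreeAlgebra ℂ (Gen G 𝒢 D)} (h : Rel cil tw D X Y) :
    freeStar cil tw D X = freeStar cil tw D Y := by
  apply unConjOp_injective
  cases h with
  | gauge_one => simp [freeStar_gauge, gaugeStar_one, gauge_one]
  | gauge_mul ξ ξ' => simp [freeStar_gauge, gaugeStar_mul, gauge_mul]
  | gauge_add ξ ξ' => simp [freeStar_gauge, gauge_add]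
  | gauge_smul c ξ =>
    simp only [map_smul, freeStar_gauge, unConjOp_smul, unConjOp_toConjOp, map_smulₛₗ]
    exact gauge_smul cil tw D _ _
  | covariance ξ I i α =>
    simp only [map_mul, map_sum, freeStar_gauge, freeStar_conn, unConjOp_mul, unConjOp_toConjOp]
    exact connStar_covariance cil tw D I i ξ α
  | functoriality I J i α β =>
    simp only [map_mul, map_sum, map_smul, freeStar_conn, unConjOp_mul, unConjOp_toConjOp,
      unConjOp_smul]
    exact connStar_functoriality_apply cil tw D I J i α β
  | inverse I i a c =>
    simp only [map_mul, map_sum, freeStar_conn, unConjOp_mul, unConjOp_toConjOp]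
    refine (congrFun (congrFun (connStar_symm_mul_connStar cil tw D I i) c) a).trans ?_
    simp only [Matrix.one_apply, eq_comm (a := c)]
    split_ifs <;> simp
  | braid i j h I J α β =>
    simp only [map_mul, map_sum, map_smul, freeStar_conn, unConjOp_mul, unConjOp_toConjOp,
      unConjOp_smul]
    exact h.elim (connStar_braid_target_apply cil tw D · I J α β)
      (connStar_commute_apply cil tw D · I J α β)
  | braid_self i I J α β =>
    simp only [map_mul (freeStar cil tw D), map_sum, map_smul, freeStar_conn, unConjOp_mul,
      unConjOp_toConjOp, unConjOp_smul]
    exact connStar_braid_self_apply cil tw D I J i α β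

/-- The anti-homomorphism `θ`, as a homomorphism to the conjugate opposite algebra. -/
def thetaHom : LatticeAlg cil tw D →ₐ[ℂ] ConjOp (LatticeAlg cil tw D) :=
  RingQuot.liftAlgHom ℂ ⟨freeStar cil tw D, fun _ _ h => freeStar_rel cil tw D h⟩

/-- The conjugate-linear anti-homomorphism `θ` of the lattice algebra. -/
def theta : LatticeAlg cil tw D →ₗ⋆[ℂ] LatticeAlg cil tw D where
  toFun B := unConjOp (thetaHom cil tw D B)
  map_add' B B' := by rw [map_add, map_add]
  map_smul' c B := by rw [map_smul, unConjOp_smul]; rfl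

theorem theta_mul (B B' : LatticeAlg cil tw D) :
    theta cil tw D (B * B') = theta cil tw D B' * theta cil tw D B :=
  congrArg unConjOp (map_mul (thetaHom cil tw D) B B')

theorem theta_one : theta cil tw D 1 = 1 :=
  congrArg unConjOp (map_one (thetaHom cil tw D))

theorem theta_gauge (ξ : GaugeAlg 𝒢) :
    theta cil tw D (gauge cil tw D ξ) = gauge cil tw D (gaugeStar 𝒢 ξ) :=
  congrArg unConjOp ((RingQuot.liftAlgHom_mkAlgHom_apply ℂ _ _ _).trans
    (freeStar_gauge cil tw D ξ))

theorem theta_conn (I : ι) (i : G.Dart) (α : D.Ix I) :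
    theta cil tw D (conn cil tw D I i α) = connStar cil tw D I i α.2 α.1 :=
  congrArg unConjOp ((RingQuot.liftAlgHom_mkAlgHom_apply ℂ _ _ _).trans
    (freeStar_conn cil tw D I i α))

/-! ### The formula for `θ` on the generators -/

theorem IsQuasitriangular.matLift_counitHom_left_inv {A B m : Type*} [Ring A] [HopfAlgebra ℂ A]
    {R : (A ⊗[ℂ] A)ˣ} [Ring B] [Algebra ℂ B] [Fintype m] [DecidableEq m]
    (hR : IsQuasitriangular R) (g : A →ₐ[ℂ] B) :
    matLift (counitHom ℂ A (Matrix m m ℂ)) g (↑R⁻¹ : A ⊗[ℂ] A) = 1 := by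
  have matLift_counitHom_left : matLift (counitHom ℂ A (Matrix m m ℂ)) g (R : A ⊗[ℂ] A) = 1 :=
    hR.algHom_eq_one_left _ fun a => by
      rw [matLift_tmul, map_one, map_one, mul_one]
      exact (constHom B m).commutes _
  have matLift_mul_inv :=
    congrArg (matLift (counitHom ℂ A (Matrix m m ℂ)) g) (Units.mul_inv R)
  rwa [map_mul, matLift_counitHom_left, one_mul, map_one] at matLift_mul_inv

theorem matLift_linkRep_symm_gaugeR_inv (I : ι) (i : G.Dart) :
    matLift (linkRep tw D I i.symm) (gaugeHom cil tw D)
        (((gaugeR 𝒢)⁻¹ : (GaugeAlg 𝒢 ⊗[ℂ] GaugeAlg 𝒢)ˣ) : GaugeAlg 𝒢 ⊗[ℂ] GaugeAlg 𝒢) =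
      matLift (sourceRep tw D i.snd I) (gaugeAt cil tw D i.snd) (rMatrixInv _) *
        matLift (targetRep tw D i.fst I) (gaugeAt cil tw D i.fst) (rMatrixInv _) := by
  rw [apply_gaugeR_inv, shuffleEval_eq_pair _ _ i.adj.ne.symm, matLift_linkRep_singleTensor,
    matLift_linkRep_singleTensor, linkRepAt_source tw D I i.symm (x := i.snd) rfl,
    linkRepAt_target tw D I i.symm (y := i.fst) rfl]
  intro z h₁ h₂
  rw [matLift_linkRep_singleTensor, linkRepAt_other tw D I i.symm h₁ h₂]
  exact (isQuasitriangular _).matLift_counitHom_left_inv _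

theorem sum_conn_mul_slice (I : ι) (i : G.Dart) (β : D.Ix I) :
    ∑ γ : D.Ix I, conn cil tw D I i.symm γ * gauge cil tw D (slice (linkRep tw D I i.symm) γ β
        (((gaugeR 𝒢)⁻¹ : (GaugeAlg 𝒢 ⊗[ℂ] GaugeAlg 𝒢)ˣ) : GaugeAlg 𝒢 ⊗[ℂ] GaugeAlg 𝒢)) =
      (sourceAct cil tw D i.snd I (connMat cil tw D I i.symm) (rMatrixInv _) *
        siteMat cil tw D i.fst I (rMatrixInv _)) β.1 β.2 := by
  have gauge_slice (γ : D.Ix I) : gauge cil tw D (slice (linkRep tw D I i.symm) γ β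
      (((gaugeR 𝒢)⁻¹ : (GaugeAlg 𝒢 ⊗[ℂ] GaugeAlg 𝒢)ˣ) : GaugeAlg 𝒢 ⊗[ℂ] GaugeAlg 𝒢)) =
      ∑ δ, matLift (sourceRep tw D i.snd I) (gaugeAt cil tw D i.snd) (rMatrixInv _) γ δ *
        matLift (targetRep tw D i.fst I) (gaugeAt cil tw D i.fst) (rMatrixInv _) δ β := by
    rw [← Matrix.mul_apply, ← matLift_linkRep_symm_gaugeR_inv, matLift_apply]
    rfl
  simp only [gauge_slice, Finset.mul_sum, ← mul_assoc]
  rw [Finset.sum_comm]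
  simp only [← Finset.sum_mul, matLift_targetRep]
  rw [Fintype.sum_prod_type, Finset.sum_eq_single β.1, Matrix.mul_apply]
  · simp only [if_true, sourceAct_apply]
    rfl
  · intro c _ hc
    simp [hc]
  · simp

theorem connStar_apply (I : ι) (i : G.Dart) (α : D.Ix I) :
    connStar cil tw D I i α.2 α.1 =
      ∑ γ : D.Ix I, ∑ β : D.Ix I, eta tw D I i β α • (conn cil tw D I i.symm γ *
        gauge cil tw D (slice (linkRep tw D I i.symm) γ β
          (((gaugeR 𝒢)⁻¹ : (GaugeAlg 𝒢 ⊗[ℂ] GaugeAlg 𝒢)ˣ) :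
            GaugeAlg 𝒢 ⊗[ℂ] GaugeAlg 𝒢))) := by
  rw [Finset.sum_comm]
  simp only [← Finset.smul_sum, sum_conn_mul_slice]
  have contraction := (isQuasitriangular (𝒢 i.snd)).antipode_drinfeldElt_mul_sandwich
    (f := (constHom (LatticeAlg cil tw D) _).comp (repAt tw D i.snd I))
    (g := siteDiag cil tw D i.snd I) (fun a b => constHom_commute_diagHom _ _)
    (V := connMat cil tw D I i.symm) (fun a => (source_covariance cil tw D I i.symm rfl a).symm)
  have contraction_mul := congrArg (· * siteMat cil tw D i.fst I (rMatrixInv _)) contraction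
  refine (congrFun (congrFun contraction_mul α.2) α.1).symm.trans ?_
  simp only [mul_assoc]
  rw [Matrix.mul_apply, Fintype.sum_prod_type]
  refine Finset.sum_congr rfl fun c _ => ?_
  rw [Finset.sum_eq_single α.1]
  · simp only [eta, if_true, one_mul, Algebra.smul_def]
    rfl
  · intro b _ hb
    simp [eta, hb]
  · simp

theorem isTheta_theta : IsTheta cil tw D (theta cil tw D) where
  map_one := theta_one cil tw D
  map_mul := theta_mul cil tw D
  map_gauge := theta_gauge cil tw D
  map_conn I i α := (theta_conn cil tw D I i α).trans (connStar_apply cil tw D I i α)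

theorem latticeAlg_induction {P : LatticeAlg cil tw D → Prop}
    (algebraMap : ∀ c, P (algebraMap ℂ _ c)) (gauge : ∀ ξ, P (gauge cil tw D ξ))
    (conn : ∀ I i α, P (conn cil tw D I i α)) (add : ∀ B B', P B → P B' → P (B + B'))
    (mul : ∀ B B', P B → P B' → P (B * B')) (B : LatticeAlg cil tw D) : P B := by
  obtain ⟨X, rfl⟩ := RingQuot.mkAlgHom_surjective ℂ (Rel cil tw D) B
  induction X using FreeAlgebra.induction with
  | grade0 c => rw [AlgHom.commutes]; exact algebraMap c
  | grade1 g =>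
    cases g with
    | gauge ξ => exact gauge ξ
    | conn I i α => exact conn I i α
  | mul X Y hX hY => rw [map_mul]; exact mul _ _ hX hY
  | add X Y hX hY => rw [map_add]; exact add _ _ hX hY

theorem IsTheta.eq {θ θ' : LatticeAlg cil tw D →ₗ⋆[ℂ] LatticeAlg cil tw D}
    (h : IsTheta cil tw D θ) (h' : IsTheta cil tw D θ') : θ' = θ := by
  ext B
  induction B using latticeAlg_induction with
  | algebraMap c =>
    rw [Algebra.algebraMap_eq_smul_one, map_smulₛₗ, map_smulₛₗ, h.map_one, h'.map_one]
  | gauge ξ => rw [h.map_gauge, h'.map_gauge]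
  | conn I i α => rw [h.map_conn, h'.map_conn]
  | add B B' hB hB' => rw [map_add, map_add, hB, hB']
  | mul B B' hB hB' => rw [h.map_mul, h'.map_mul, hB, hB']

end Theta

/-! ### Central elements of the gauge algebra -/

theorem tprod_commute {k ι : Type*} [CommSemiring k] {A : ι → Type*} [∀ i, Semiring (A i)]
    [∀ i, Algebra k (A i)] {m : ∀ i, A i} (h : ∀ i a, Commute (m i) a) (X : ⨂[k] i, A i) :
    Commute (PiTensorProduct.tprod k m) X := by
  induction X using PiTensorProduct.induction_on with
  | smul_tprod r f =>
    refine Commute.smul_right ?_ r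
    rw [commute_iff_eq, PiTensorProduct.tprod_mul_tprod, PiTensorProduct.tprod_mul_tprod]
    exact congrArg _ (funext fun i => (h i (f i)).eq)
  | add X Y hX hY => exact hX.add_right hY

section GaugeUnit

variable {S : Type*} {𝒢 : S → Type*} [∀ x, Ring (𝒢 x)] [∀ x, HopfAlgebra ℂ (𝒢 x)]

/-- The unit `⊗_z g_z` of the gauge algebra; it turns `v` and `κ` into units. -/
def gaugeUnit (g : ∀ z, (𝒢 z)ˣ) : (GaugeAlg 𝒢)ˣ :=
  Units.map (PiTensorProduct.tprodMonoidHom ℂ : (∀ z, 𝒢 z) →* GaugeAlg 𝒢) (MulEquiv.piUnits.symm g)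

theorem val_gaugeUnit (g : ∀ z, (𝒢 z)ˣ) :
    (gaugeUnit g : GaugeAlg 𝒢) = PiTensorProduct.tprod ℂ fun z => (g z : 𝒢 z) := rfl

theorem val_inv_gaugeUnit (g : ∀ z, (𝒢 z)ˣ) :
    ((gaugeUnit g)⁻¹ : (GaugeAlg 𝒢)ˣ) = PiTensorProduct.tprod ℂ fun z => (↑(g z)⁻¹ : 𝒢 z) := rfl

theorem gaugeUnit_pow (g : ∀ z, (𝒢 z)ˣ) (n : ℕ) : gaugeUnit g ^ n = gaugeUnit fun z => g z ^ n := by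
  rw [gaugeUnit, ← map_pow, ← map_pow]
  rfl

end GaugeUnit

section RibbonElement

variable (A : Type*) [Ring A] [HopfAlgebra ℂ A] [StarRing A] [StarModule ℂ A]
  [RibbonHopfStarAlgebra A]

/-- The ribbon element as a unit, with inverse `v^*`. -/
def ribbonUnit : Aˣ where
  val := RibbonHopfStarAlgebra.v
  inv := star RibbonHopfStarAlgebra.v
  val_inv := (RibbonHopfStarAlgebra.v_central _).trans RibbonHopfStarAlgebra.star_v_mul
  inv_val := RibbonHopfStarAlgebra.star_v_mul

theorem swap_rMatrix_mul_rMatrix_mul_comul_v :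
    swap A (rMatrix A) * rMatrix A * comul (R := ℂ) (RibbonHopfStarAlgebra.v : A) =
      RibbonHopfStarAlgebra.v ⊗ₜ RibbonHopfStarAlgebra.v := by
  rw [RibbonHopfStarAlgebra.comul_v]
  exact Units.mul_inv_cancel_left (swapUnit A RibbonHopfStarAlgebra.R * RibbonHopfStarAlgebra.R) _

theorem rMatrixInv_mul_swap_rMatrixInv_mul_v_tmul_v :
    rMatrixInv A * swap A (rMatrixInv A) *
        (RibbonHopfStarAlgebra.v ⊗ₜ RibbonHopfStarAlgebra.v) =
      comul (R := ℂ) (RibbonHopfStarAlgebra.v : A) := by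
  rw [RibbonHopfStarAlgebra.comul_v, mul_inv_rev]
  rfl

end RibbonElement

theorem gaugeV_commute {S : Type*} {𝒢 : S → Type*} [∀ x, Ring (𝒢 x)] [∀ x, HopfAlgebra ℂ (𝒢 x)]
    [∀ x, StarRing (𝒢 x)] [∀ x, StarModule ℂ (𝒢 x)] [∀ x, RibbonHopfStarAlgebra (𝒢 x)]
    (ξ : GaugeAlg 𝒢) : Commute (gaugeV 𝒢) ξ :=
  tprod_commute (fun _ => RibbonHopfStarAlgebra.v_central) ξ

theorem repAt_v {S : Type*} {𝒢 : S → Type*} [∀ x, Ring (𝒢 x)] [∀ x, HopfAlgebra ℂ (𝒢 x)]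
    [∀ x, StarRing (𝒢 x)] [∀ x, StarModule ℂ (𝒢 x)] [∀ x, RibbonHopfStarAlgebra (𝒢 x)]
    {H : Type*} [Ring H] [HopfAlgebra ℂ H] [StarRing H] [StarModule ℂ H] [RibbonHopfStarAlgebra H]
    {ι : Type*} (tw : ∀ x, TwistEquiv (𝒢 x) H) (D : RepData H ι) (x : S) (I : ι) :
    repAt tw D x I RibbonHopfStarAlgebra.v = D.κ I ^ 2 • 1 := by
  rw [← D.κ_sq I, ← (tw x).iso_v]
  rfl

/-! ### The square of `θ` -/

section ThetaSquare

variable {S : Type*} [Fintype S] [DecidableEq S] {G : SimpleGraph S} (cil : Ciliation G)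
  {𝒢 : S → Type*}
  [∀ x, Ring (𝒢 x)] [∀ x, HopfAlgebra ℂ (𝒢 x)] [∀ x, StarRing (𝒢 x)]
  [∀ x, StarModule ℂ (𝒢 x)] [∀ x, RibbonHopfStarAlgebra (𝒢 x)]
  {H : Type*} [Ring H] [HopfAlgebra ℂ H] [StarRing H] [StarModule ℂ H] [RibbonHopfStarAlgebra H]
  {ι : Type*} [Fintype ι] (tw : ∀ x, TwistEquiv (𝒢 x) H) (D : RepData H ι)

/-- The conjugate transpose of a matrix over the lattice algebra, formed with `θ`. -/
def thetaMat {m n : Type*} (X : Matrix m n (LatticeAlg cil tw D)) :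
    Matrix n m (LatticeAlg cil tw D) :=
  Matrix.of fun a b => theta cil tw D (X b a)

theorem thetaMat_mul {l m n : Type*} [Fintype m] (X : Matrix l m (LatticeAlg cil tw D))
    (Y : Matrix m n (LatticeAlg cil tw D)) :
    thetaMat cil tw D (X * Y) = thetaMat cil tw D Y * thetaMat cil tw D X := by
  ext a b
  simp only [thetaMat, Matrix.of_apply, Matrix.mul_apply, map_sum, theta_mul]

theorem thetaMat_siteMat (x : S) (I : ι) (X : 𝒢 x ⊗[ℂ] 𝒢 x) :
    thetaMat cil tw D (siteMat cil tw D x I X) = siteMat cil tw D x I (star X) := by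
  ext p q
  induction X with
  | zero => simp [thetaMat]
  | add X Y hX hY =>
    simp only [thetaMat, Matrix.of_apply, map_add, star_add, Matrix.add_apply] at hX hY ⊢
    rw [hX, hY]
  | tmul a b =>
    rw [thetaMat, Matrix.of_apply, TensorProduct.star_tmul, matLift_tmul_apply, matLift_tmul_apply,
      map_smulₛₗ, gaugeAt_apply, theta_gauge, gaugeStar_single, repAt_star]
    rfl

theorem thetaMat_connMat (I : ι) (i : G.Dart) :
    thetaMat cil tw D (connMat cil tw D I i) = connStar cil tw D I i :=
  Matrix.ext fun a b => theta_conn cil tw D I i (b, a)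

theorem thetaMat_connStar (I : ι) (i : G.Dart) :
    thetaMat cil tw D (connStar cil tw D I i) =
      siteMat cil tw D i.fst I (swap _ (rMatrix _) * rMatrix _) * connMat cil tw D I i *
        siteMat cil tw D i.snd I (rMatrixInv _ * swap _ (rMatrixInv _)) := by
  rw [connStar, thetaMat_mul, thetaMat_mul, thetaMat_siteMat, thetaMat_siteMat, thetaMat_connMat,
    connStar_symm, star_rMatrix, star_rMatrixInv, map_mul, map_mul]
  simp only [mul_assoc]

theorem siteMat_v_tmul_v (x : S) (I : ι) :
    siteMat cil tw D x I (RibbonHopfStarAlgebra.v ⊗ₜ RibbonHopfStarAlgebra.v) =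
      D.κ I ^ 2 • siteDiag cil tw D x I RibbonHopfStarAlgebra.v := by
  rw [matLift_tmul, repAt_v, map_smul, map_one, smul_mul_assoc, one_mul]
  rfl

theorem siteMat_swap_mul_rMatrix_mul_connMat_mul_siteDiag_v (I : ι) (i : G.Dart) :
    siteMat cil tw D i.fst I (swap _ (rMatrix _) * rMatrix _) * connMat cil tw D I i *
        siteDiag cil tw D i.fst I RibbonHopfStarAlgebra.v =
      D.κ I ^ 2 • (siteDiag cil tw D i.fst I RibbonHopfStarAlgebra.v * connMat cil tw D I i) := by
  rw [mul_assoc, ← source_covariance cil tw D I i rfl, ← mul_assoc, ← map_mul,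
    swap_rMatrix_mul_rMatrix_mul_comul_v, siteMat_v_tmul_v, smul_mul_assoc]

theorem connMat_mul_siteMat_rMatrixInv_mul_swap_mul_siteDiag_v (I : ι) (i : G.Dart) :
    D.κ I ^ 2 • (connMat cil tw D I i *
        siteMat cil tw D i.snd I (rMatrixInv _ * swap _ (rMatrixInv _)) *
          siteDiag cil tw D i.snd I RibbonHopfStarAlgebra.v) =
      siteDiag cil tw D i.snd I RibbonHopfStarAlgebra.v * connMat cil tw D I i := by
  rw [target_covariance cil tw D I i rfl, ← rMatrixInv_mul_swap_rMatrixInv_mul_v_tmul_v,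
    map_mul _ (_ * _), siteMat_v_tmul_v, mul_smul_comm, mul_smul_comm, mul_assoc]

theorem gauge_tprod_commute_conn {m : ∀ z, 𝒢 z} (I : ι) (i : G.Dart) (h₁ : m i.fst = 1)
    (h₂ : m i.snd = 1) (α : D.Ix I) :
    Commute (gauge cil tw D (PiTensorProduct.tprod ℂ m)) (conn cil tw D I i α) := by
  let commuting : Submonoid (∀ z, 𝒢 z) := (Submonoid.centralizer {conn cil tw D I i α}).comap
    ((gaugeHom cil tw D : GaugeAlg 𝒢 →* LatticeAlg cil tw D).comp
      (PiTensorProduct.tprodMonoidHom ℂ))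
  have mem_commuting (m' : ∀ z, 𝒢 z) : m' ∈ commuting ↔
      Commute (gauge cil tw D (PiTensorProduct.tprod ℂ m')) (conn cil tw D I i α) :=
    ⟨fun h => (h _ rfl).symm, fun h _ hb => hb ▸ h.symm⟩
  rw [← mem_commuting]
  refine Submonoid.pi_mem_of_mulSingle_mem m fun z => ?_
  by_cases hx : z = i.fst
  · rw [hx, h₁, Pi.mulSingle_one]
    exact one_mem commuting
  by_cases hy : z = i.snd
  · rw [hy, h₂, Pi.mulSingle_one]
    exact one_mem commuting
  exact (mem_commuting _).2 <| other_covariance cil tw D I i hx hy (m z) α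

theorem gauge_tprod_eq_gaugeAt_mul_gaugeAt_mul (m : ∀ z, 𝒢 z) {x y : S} (h : x ≠ y) :
    gauge cil tw D (PiTensorProduct.tprod ℂ m) =
      gaugeAt cil tw D x (m x) * gaugeAt cil tw D y (m y) *
        gauge cil tw D (PiTensorProduct.tprod ℂ (Function.update (Function.update m x 1) y 1)) := by
  rw [gaugeAt_apply, gaugeAt_apply, ← gauge_mul, ← gauge_mul, PiTensorProduct.singleAlgHom_apply,
    PiTensorProduct.singleAlgHom_apply]
  change _ = gauge cil tw D (PiTensorProduct.tprod ℂ _ * PiTensorProduct.tprod ℂ _ * _)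
  rw [PiTensorProduct.tprod_mul_tprod, PiTensorProduct.tprod_mul_tprod]
  congr 2
  funext z
  by_cases hx : z = x
  · subst hx; simp [h]
  by_cases hy : z = y
  · subst hy; simp [hx]
  simp [hx, hy]

theorem thetaMat_connStar_mul_diagHom_gaugeV (I : ι) (i : G.Dart) :
    thetaMat cil tw D (connStar cil tw D I i) * diagHom _ _ (gauge cil tw D (gaugeV 𝒢)) =
      diagHom _ _ (gauge cil tw D (gaugeV 𝒢)) * connMat cil tw D I i := by
  let U := connMat cil tw D I i
  let Vx := siteDiag cil tw D i.fst I RibbonHopfStarAlgebra.v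
  let Vy := siteDiag cil tw D i.snd I RibbonHopfStarAlgebra.v
  let Qx := siteMat cil tw D i.fst I (swap _ (rMatrix _) * rMatrix _)
  let Qy := siteMat cil tw D i.snd I (rMatrixInv _ * swap _ (rMatrixInv _))
  let W := diagHom (LatticeAlg cil tw D) (Fin (D.dim I)) (gauge cil tw D (PiTensorProduct.tprod ℂ
    (Function.update (Function.update
      (fun z => (RibbonHopfStarAlgebra.v : 𝒢 z)) i.fst 1) i.snd 1)))
  have diagHom_gaugeV : diagHom _ _ (gauge cil tw D (gaugeV 𝒢)) = Vx * Vy * W := by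
    rw [gaugeV, gauge_tprod_eq_gaugeAt_mul_gaugeAt_mul cil tw D _ i.adj.ne, map_mul, map_mul]
    rfl
  have W_comm : Commute W U := diagHom_commute_iff.2 fun a b =>
    gauge_tprod_commute_conn cil tw D I i (by simp [i.adj.ne]) (by simp) (a, b)
  have Vx_comm : Commute Vx Qy := diagHom_commute_iff.2 fun a b =>
    gaugeAt_commute_siteMat cil tw D i.adj.ne I _ _ a b
  have at_source : Qx * U * Vx = D.κ I ^ 2 • (Vx * U) :=
    siteMat_swap_mul_rMatrix_mul_connMat_mul_siteDiag_v cil tw D I i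
  have at_target : D.κ I ^ 2 • (U * Qy * Vy) = Vy * U :=
    connMat_mul_siteMat_rMatrixInv_mul_swap_mul_siteDiag_v cil tw D I i
  rw [thetaMat_connStar, diagHom_gaugeV]
  calc Qx * U * Qy * (Vx * Vy * W)
      = Qx * U * (Qy * Vx) * Vy * W := by simp only [mul_assoc]
    _ = Qx * U * Vx * Qy * Vy * W := by rw [← Vx_comm.eq]; simp only [mul_assoc]
    _ = Vx * (D.κ I ^ 2 • (U * Qy * Vy)) * W := by
      rw [at_source]; simp only [smul_mul_assoc, mul_smul_comm, mul_assoc]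
    _ = Vx * Vy * (U * W) := by rw [at_target]; simp only [mul_assoc]
    _ = Vx * Vy * W * U := by rw [← W_comm.eq, mul_assoc (Vx * Vy)]

theorem theta_theta_mul_gaugeV (B : LatticeAlg cil tw D) :
    theta cil tw D (theta cil tw D B) * gauge cil tw D (gaugeV 𝒢) =
      gauge cil tw D (gaugeV 𝒢) * B := by
  induction B using latticeAlg_induction with
  | algebraMap c =>
    simp only [Algebra.algebraMap_eq_smul_one, map_smulₛₗ, theta_one, starRingEnd_self_apply,
      smul_mul_assoc, mul_smul_comm, one_mul, mul_one]
  | gauge ξ =>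
    rw [theta_gauge, theta_gauge, gaugeStar_gaugeStar, ← gauge_mul, ← gauge_mul,
      (gaugeV_commute ξ).eq]
  | conn I i α =>
    have entry :=
      congrFun (congrFun (thetaMat_connStar_mul_diagHom_gaugeV cil tw D I i) α.1) α.2
    rw [mul_diagHom_apply, diagHom_mul_apply] at entry
    rw [theta_conn]
    exact entry
  | add B B' hB hB' => rw [map_add, map_add, add_mul, hB, hB', mul_add]
  | mul B B' hB hB' => rw [theta_mul, theta_mul, mul_assoc, hB', ← mul_assoc, hB, mul_assoc]

theorem theta_theta (B : LatticeAlg cil tw D) :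
    theta cil tw D (theta cil tw D B) = gauge cil tw D (gaugeV 𝒢) * B *
      gauge cil tw D ((gaugeUnit fun z => ribbonUnit (𝒢 z))⁻¹ : (GaugeAlg 𝒢)ˣ) := by
  have gaugeV_mul_inv :
      gaugeV 𝒢 * ((gaugeUnit fun z => ribbonUnit (𝒢 z))⁻¹ : (GaugeAlg 𝒢)ˣ) = 1 :=
    Units.mul_inv (gaugeUnit fun z => ribbonUnit (𝒢 z))
  rw [← theta_theta_mul_gaugeV, mul_assoc, ← gauge_mul, gaugeV_mul_inv, gauge_one, mul_one]

end ThetaSquare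

/-! ### Scalars acting on families of simple modules -/

section SimpleModules

theorem linearMap_pi_single_apply_eq_zero {R ι : Type*} [Ring R] [DecidableEq ι] {M : ι → Type*}
    [∀ i, AddCommGroup (M i)] [∀ i, Module R (M i)] [∀ i, IsSimpleModule R (M i)] {i j : ι}
    (h : IsEmpty (M i ≃ₗ[R] M j)) (φ : (∀ l, M l) →ₗ[R] ∀ l, M l) (x : M i) :
    φ (Pi.single i x) j = 0 := by
  let component : M i →ₗ[R] M j := LinearMap.proj j ∘ₗ φ ∘ₗ LinearMap.single R M i
  rcases component.bijective_or_eq_zero with bijective | eq_zero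
  · exact h.elim (LinearEquiv.ofBijective component bijective)
  · exact LinearMap.congr_fun eq_zero x

/-- By Schur's lemma the componentwise scalars commute with all endomorphisms of `∏ M_i`, so the
density theorem applies. -/
theorem exists_forall_smul_eq_smul {k R ι : Type*} [CommRing k] [Ring R] [Algebra k R] [Finite ι]
    {M : ι → Type*} [∀ i, AddCommGroup (M i)] [∀ i, Module k (M i)] [∀ i, Module R (M i)]
    [∀ i, IsScalarTower k R (M i)] [∀ i, Module.Finite k (M i)] [∀ i, IsSimpleModule R (M i)]
    (h : Pairwise fun i j => IsEmpty (M i ≃ₗ[R] M j)) (c : ι → k) :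
    ∃ r : R, ∀ i (x : M i), r • x = c i • x := by
  classical
  cases nonempty_fintype ι
  have apply_eq (φ : Module.End R (∀ i, M i)) (w : ∀ i, M i) (j : ι) :
      φ w j = φ (Pi.single j (w j)) j := by
    conv_lhs => rw [← Finset.univ_sum_single w, map_sum, Finset.sum_apply]
    exact Finset.sum_eq_single j
      (fun i _ hij => linearMap_pi_single_apply_eq_zero (h hij) φ (w i)) (by simp)
  let scalars : Module.End (Module.End R (∀ i, M i)) (∀ i, M i) :=
    { toFun := fun w i => c i • w i
      map_add' := fun w w' => funext fun i => smul_add _ _ _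
      map_smul' := fun φ w => funext fun j => by
        change c j • φ w j = φ (fun i => c i • w i) j
        rw [apply_eq φ w, apply_eq φ fun i => c i • w i, Pi.single_smul,
          LinearMap.map_smul_of_tower φ, Pi.smul_apply] }
  have : Module.Finite (Module.End R (∀ i, M i)) (∀ i, M i) :=
    Module.Finite.of_restrictScalars_finite k _ _
  obtain ⟨r, hr⟩ := Module.Finite.toModuleEnd_moduleEnd_surjective scalars
  refine ⟨r, fun i x => ?_⟩
  have eq_at := congrFun (LinearMap.congr_fun hr (Pi.single i x)) i
  simpa [scalars] using eq_at

theorem eq_zero_of_forall_mem_annihilator {R : Type*} [Ring R] [IsSemisimpleRing R] {a : R}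
    (h : ∀ W : Submodule R R, IsSimpleModule R W → a ∈ W.annihilator) : a = 0 := by
  have mem_annihilator_top : a ∈ (⊤ : Submodule R R).annihilator := by
    rw [← IsSemisimpleModule.sSup_simples_eq_top R R, sSup_eq_iSup', Submodule.annihilator_iSup,
      Submodule.mem_iInf]
    exact fun W => h W.1 W.2
  rw [← mul_one a]
  exact Submodule.mem_annihilator.1 mem_annihilator_top 1 trivial

end SimpleModules

/-! ### Matrix representations as modules -/

section RepSpace

variable {A : Type*} [Ring A] [Algebra ℂ A] {m n : Type*} [Fintype m] [DecidableEq m] [Fintype n]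
  [DecidableEq n]

/-- The column vectors as a module over an algebra that acts on them by matrices. -/
def RepSpace (_ρ : A →ₐ[ℂ] Matrix m m ℂ) := m → ℂ

variable (ρ : A →ₐ[ℂ] Matrix m m ℂ) {σ : A →ₐ[ℂ] Matrix n n ℂ}

instance : AddCommGroup (RepSpace ρ) := inferInstanceAs (AddCommGroup (m → ℂ))

instance : Module ℂ (RepSpace ρ) := inferInstanceAs (Module ℂ (m → ℂ))

instance : Module.Finite ℂ (RepSpace ρ) := inferInstanceAs (Module.Finite ℂ (m → ℂ))

instance : Module A (RepSpace ρ) :=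
  Module.compHom (m → ℂ) ((Matrix.toLinAlgEquiv'.toAlgHom.comp ρ : A →ₐ[ℂ] Module.End ℂ (m → ℂ)) :
    A →+* Module.End ℂ (m → ℂ))

instance : IsScalarTower ℂ A (RepSpace ρ) where
  smul_assoc c a w := by
    have smul_mulVec (w : m → ℂ) : (ρ (c • a)).mulVec w = c • (ρ a).mulVec w := by
      rw [map_smul, Matrix.smul_mulVec]
    exact smul_mulVec w

variable {ρ}

theorem IsIrred.isSimpleModule (h : IsIrred ρ) : IsSimpleModule A (RepSpace ρ) := by
  have := h.1
  rw [isSimpleModule_iff]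
  have : Nontrivial (RepSpace ρ) := inferInstanceAs (Nontrivial (m → ℂ))
  refine { exists_pair_ne := exists_pair_ne _, eq_bot_or_eq_top := fun W => ?_ }
  refine (h.2 (W.restrictScalars ℂ) fun a w hw => W.smul_mem a hw).imp ?_ ?_
  · exact fun eq_bot => SetLike.ext fun w => SetLike.ext_iff.1 eq_bot w
  · exact fun eq_top => SetLike.ext fun w => SetLike.ext_iff.1 eq_top w

theorem isEquivRep_of_linearEquiv (e : RepSpace ρ ≃ₗ[A] RepSpace σ) : IsEquivRep ρ σ := by
  let f : (m → ℂ) ≃ₗ[ℂ] (n → ℂ) := e.restrictScalars ℂ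
  refine ⟨LinearMap.toMatrix' f.toLinearMap, LinearMap.toMatrix' f.symm.toLinearMap, ?_, ?_,
    fun a => ?_⟩
  · rw [← LinearMap.toMatrix'_comp, LinearEquiv.comp_coe, LinearEquiv.symm_trans_self]
    exact LinearMap.toMatrix'_id
  · rw [← LinearMap.toMatrix'_comp, LinearEquiv.comp_coe, LinearEquiv.self_trans_symm]
    exact LinearMap.toMatrix'_id
  · refine Matrix.toLin'.injective (LinearMap.ext fun w => ?_)
    rw [Matrix.toLin'_mul, Matrix.toLin'_mul, Matrix.toLin'_toMatrix']
    exact e.map_smul a w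

theorem IsEquivRep.refl (ρ : A →ₐ[ℂ] Matrix m m ℂ) : IsEquivRep ρ ρ :=
  ⟨1, 1, mul_one 1, mul_one 1, fun a => (one_mul (ρ a)).trans (mul_one (ρ a)).symm⟩

theorem IsEquivRep.apply_eq_zero (h : IsEquivRep ρ σ) {a : A} (ha : σ a = 0) : ρ a = 0 := by
  obtain ⟨T, T', -, inv_mul, intertwines⟩ := h
  rw [← Matrix.one_mul (ρ a), ← inv_mul, Matrix.mul_assoc, intertwines, ha, Matrix.zero_mul,
    Matrix.mul_zero]

section ModuleRep

variable {V : Type*} [AddCommGroup V] [Module ℂ V] [Module A V] [IsScalarTower ℂ A V]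
  (b : Module.Basis m ℂ V)

/-- The matrix representation on a module with a chosen basis. -/
def moduleRep : A →ₐ[ℂ] Matrix m m ℂ :=
  (LinearMap.toMatrixAlgEquiv b).toAlgHom.comp (Algebra.lsmul ℂ ℂ V)

theorem moduleRep_mulVec (a : A) (w : V) :
    (moduleRep b a).mulVec (b.equivFun w) = b.equivFun (a • w) :=
  LinearMap.toMatrix_mulVec_repr b b (Algebra.lsmul ℂ ℂ V a) w

theorem smul_eq_zero_of_moduleRep_eq_zero {a : A} (h : moduleRep b a = 0) (w : V) : a • w = 0 := by
  rw [← b.equivFun.map_eq_zero_iff, ← moduleRep_mulVec, h, Matrix.zero_mulVec]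

theorem isIrred_moduleRep [IsSimpleModule A V] : IsIrred (moduleRep (A := A) b) := by
  have : Nontrivial V := IsSimpleModule.nontrivial A V
  refine ⟨b.index_nonempty, fun W hW => ?_⟩
  let preimage : Submodule A V :=
    { (W.comap b.equivFun.toLinearMap).toAddSubmonoid with
      smul_mem' := fun a w hw => by
        change b.equivFun (a • w) ∈ W
        rw [← moduleRep_mulVec]
        exact hW a _ hw }
  have mem_iff (w : m → ℂ) : w ∈ W ↔ b.equivFun.symm w ∈ preimage := by
    change _ ↔ b.equivFun (b.equivFun.symm w) ∈ W
    rw [LinearEquiv.apply_symm_apply]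
  refine (eq_bot_or_eq_top preimage).imp (fun eq_bot => ?_) fun eq_top => ?_
  · ext w
    rw [mem_iff, eq_bot, Submodule.mem_bot, Submodule.mem_bot, LinearEquiv.map_eq_zero_iff]
  · ext w
    simp only [mem_iff, eq_top, Submodule.mem_top]

end ModuleRep

end RepSpace

/-! ### The element `κ` -/

section Kappa

variable {H : Type*} [Ring H] [HopfAlgebra ℂ H] [StarRing H] [StarModule ℂ H]
  [RibbonHopfStarAlgebra H] {ι : Type*} (D : RepData H ι)

theorem RepData.eq_of_isEquivRep {I J : ι} (h : IsEquivRep (D.τ I) (D.τ J)) : I = J := by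
  obtain ⟨K, _, unique⟩ := D.complete _ (D.τ I) (D.irred I)
  exact (unique I (.refl _)).trans (unique J h).symm

theorem RepData.ext_of_forall_eq [FiniteDimensional ℂ H] [IsSemisimpleRing H] {a b : H}
    (h : ∀ I, D.τ I a = D.τ I b) : a = b := by
  refine sub_eq_zero.1 (eq_zero_of_forall_mem_annihilator fun W hW => ?_)
  have : FiniteDimensional ℂ W := inferInstanceAs (FiniteDimensional ℂ (W.restrictScalars ℂ))
  let basis := Module.finBasis ℂ W
  obtain ⟨I, equiv, -⟩ := D.complete _ (moduleRep basis) (isIrred_moduleRep (A := H) basis)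
  have moduleRep_eq_zero : moduleRep basis (a - b) = 0 :=
    equiv.apply_eq_zero (by rw [map_sub, h, sub_self])
  exact Submodule.mem_annihilator.2 fun w hw =>
    congrArg Subtype.val (smul_eq_zero_of_moduleRep_eq_zero basis moduleRep_eq_zero ⟨w, hw⟩)

theorem RepData.exists_forall_eq_smul_one [Finite ι] (c : ι → ℂ) :
    ∃ k : H, ∀ I, D.τ I k = c I • 1 := by
  have isSimpleModule (I : ι) := (D.irred I).isSimpleModule
  obtain ⟨k, hk⟩ := exists_forall_smul_eq_smul (R := H) (M := fun I => RepSpace (D.τ I))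
    (fun I J hIJ => ⟨fun e => hIJ (D.eq_of_isEquivRep (isEquivRep_of_linearEquiv e))⟩) c
  refine ⟨k, fun I => Matrix.toLin'.injective (LinearMap.ext fun w => ?_)⟩
  rw [Matrix.toLin'_apply, Matrix.toLin'_apply, Matrix.smul_mulVec, Matrix.one_mulVec]
  exact hk I w

theorem RepData.existsUnique_isKappa [Finite ι] [FiniteDimensional ℂ H] [IsSemisimpleRing H] :
    ∃! k : H, D.IsKappa k := by
  obtain ⟨k, hk⟩ := D.exists_forall_eq_smul_one D.κ
  refine ⟨k, ⟨fun a => D.ext_of_forall_eq fun I => ?_, hk⟩, fun k' hk' =>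
    D.ext_of_forall_eq fun I => (hk'.2 I).trans (hk I).symm⟩
  rw [map_mul, map_mul, hk, smul_mul_assoc, mul_smul_comm, one_mul, mul_one]

theorem RepData.norm_κ (I : ι) : ‖D.κ I‖ = 1 := by
  obtain ⟨j⟩ := (D.irred I).1
  have star_v_mul : D.τ I (star RibbonHopfStarAlgebra.v * RibbonHopfStarAlgebra.v) = 1 := by
    rw [RibbonHopfStarAlgebra.star_v_mul, map_one]
  rw [map_mul, D.unitary, D.κ_sq, Matrix.conjTranspose_smul, Matrix.conjTranspose_one,
    smul_mul_smul_comm, one_mul] at star_v_mul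
  have star_κ_sq_mul : star (D.κ I ^ 2) * D.κ I ^ 2 = 1 := by
    simpa using congrFun (congrFun star_v_mul j) j
  have norm_pow_four : ‖D.κ I‖ ^ 4 = 1 := by
    have norm_eq := congrArg norm star_κ_sq_mul
    rwa [norm_mul, norm_star, norm_pow, norm_one, ← pow_add] at norm_eq
  exact (pow_eq_one_iff_of_nonneg (norm_nonneg _) four_ne_zero).1 norm_pow_four

theorem RepData.star_κ_mul_κ (I : ι) : star (D.κ I) * D.κ I = 1 := by
  rw [Complex.star_def, Complex.conj_mul', D.norm_κ, Complex.ofReal_one, one_pow]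

variable {D} [FiniteDimensional ℂ H] [IsSemisimpleRing H] {k : H}

theorem RepData.IsKappa.sq (h : D.IsKappa k) : k ^ 2 = RibbonHopfStarAlgebra.v :=
  D.ext_of_forall_eq fun I => by rw [map_pow, h.2, D.κ_sq, smul_pow, one_pow]

theorem RepData.IsKappa.star_mul_self (h : D.IsKappa k) : star k * k = 1 :=
  D.ext_of_forall_eq fun I => by
    rw [map_mul, D.unitary, h.2, Matrix.conjTranspose_smul, Matrix.conjTranspose_one,
      smul_mul_smul_comm, one_mul, D.star_κ_mul_κ, one_smul, map_one]

/-- The element `κ_∗` as a unit, with inverse `κ_∗^*`. -/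
def RepData.IsKappa.unit (h : D.IsKappa k) : Hˣ where
  val := k
  inv := star k
  val_inv := (h.1 _).trans h.star_mul_self
  inv_val := h.star_mul_self

variable {S : Type*} {𝒢 : S → Type*} [∀ x, Ring (𝒢 x)] [∀ x, HopfAlgebra ℂ (𝒢 x)]
  [∀ x, StarRing (𝒢 x)] [∀ x, StarModule ℂ (𝒢 x)] [∀ x, RibbonHopfStarAlgebra (𝒢 x)]
  (tw : ∀ x, TwistEquiv (𝒢 x) H)

/-- The element `κ = ⊗_x ι_x⁻¹(κ_∗)` as a unit of the gauge algebra. -/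
def kappaUnit (h : D.IsKappa k) : (GaugeAlg 𝒢)ˣ :=
  gaugeUnit fun x => Units.map ((tw x).iso.symm : H →* 𝒢 x) h.unit

theorem kappaUnit_commute (h : D.IsKappa k) (ξ : GaugeAlg 𝒢) :
    Commute (kappaUnit tw h : GaugeAlg 𝒢) ξ := by
  refine tprod_commute (fun x a => (tw x).iso.injective ?_) ξ
  change (tw x).iso ((tw x).iso.symm k * a) = (tw x).iso (a * (tw x).iso.symm k)
  rw [map_mul, map_mul, AlgEquiv.apply_symm_apply, h.1]

theorem kappaUnit_sq (h : D.IsKappa k) :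
    kappaUnit tw h ^ 2 = gaugeUnit fun z => ribbonUnit (𝒢 z) := by
  rw [kappaUnit, gaugeUnit_pow]
  refine congrArg _ (funext fun x => Units.ext ((tw x).iso.injective ?_))
  change (tw x).iso ((tw x).iso.symm k ^ 2) = (tw x).iso RibbonHopfStarAlgebra.v
  rw [map_pow, AlgEquiv.apply_symm_apply, h.sq, (tw x).iso_v]

theorem gaugeStar_kappaUnit [Fintype S] [DecidableEq S] (h : D.IsKappa k) :
    gaugeStar 𝒢 (kappaUnit tw h) = ((kappaUnit tw h)⁻¹ : (GaugeAlg 𝒢)ˣ) := by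
  rw [kappaUnit, val_gaugeUnit, val_inv_gaugeUnit, gaugeStar_tprod]
  refine congrArg _ (funext fun x => (tw x).iso.injective ?_)
  change (tw x).iso (star ((tw x).iso.symm k)) = (tw x).iso ((tw x).iso.symm (star k))
  rw [(tw x).iso_star, AlgEquiv.apply_symm_apply, AlgEquiv.apply_symm_apply]

end Kappa

/-! ### The `*`-operation of the lattice algebra -/

section StarStructure

variable {S : Type*} [Fintype S] [DecidableEq S] {G : SimpleGraph S} (cil : Ciliation G)
  {𝒢 : S → Type*}
  [∀ x, Ring (𝒢 x)] [∀ x, HopfAlgebra ℂ (𝒢 x)] [∀ x, StarRing (𝒢 x)]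
  [∀ x, StarModule ℂ (𝒢 x)] [∀ x, RibbonHopfStarAlgebra (𝒢 x)]
  {H : Type*} [Ring H] [HopfAlgebra ℂ H] [StarRing H] [StarModule ℂ H] [RibbonHopfStarAlgebra H]
  {ι : Type*} [Fintype ι] (tw : ∀ x, TwistEquiv (𝒢 x) H) (D : RepData H ι)

theorem conjBy_eq (g : (GaugeAlg 𝒢)ˣ) (B : LatticeAlg cil tw D) :
    conjBy cil tw D g B =
      ↑(Units.map (gaugeHom cil tw D : GaugeAlg 𝒢 →* LatticeAlg cil tw D) g)⁻¹ * B *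
        ↑(Units.map (gaugeHom cil tw D : GaugeAlg 𝒢 →* LatticeAlg cil tw D) g) := rfl

theorem conjBy_mul (g : (GaugeAlg 𝒢)ˣ) (B B' : LatticeAlg cil tw D) :
    conjBy cil tw D g (B * B') = conjBy cil tw D g B * conjBy cil tw D g B' := by
  simp only [conjBy_eq, mul_assoc, Units.mul_inv_cancel_left]

theorem conjBy_add (g : (GaugeAlg 𝒢)ˣ) (B B' : LatticeAlg cil tw D) :
    conjBy cil tw D g (B + B') = conjBy cil tw D g B + conjBy cil tw D g B' := by
  simp only [conjBy, mul_add, add_mul]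

theorem conjBy_smul (g : (GaugeAlg 𝒢)ˣ) (c : ℂ) (B : LatticeAlg cil tw D) :
    conjBy cil tw D g (c • B) = c • conjBy cil tw D g B := by
  simp only [conjBy, mul_smul_comm, smul_mul_assoc]

theorem conjBy_gauge {g : (GaugeAlg 𝒢)ˣ} {ξ : GaugeAlg 𝒢} (h : Commute (g : GaugeAlg 𝒢) ξ) :
    conjBy cil tw D g (gauge cil tw D ξ) = gauge cil tw D ξ := by
  rw [conjBy, ← gauge_mul, ← gauge_mul, mul_assoc, ← h.eq, Units.inv_mul_cancel_left]

theorem conjBy_theta_gauge {g : (GaugeAlg 𝒢)ˣ} (h : ∀ ξ, Commute (g : GaugeAlg 𝒢) ξ)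
    (ξ : GaugeAlg 𝒢) :
    conjBy cil tw D g (theta cil tw D (gauge cil tw D ξ)) =
      gauge cil tw D (gaugeStar 𝒢 ξ) := by
  rw [theta_gauge, conjBy_gauge cil tw D (h _)]

section StarOfUnitarySquareRoot

variable {κ : (GaugeAlg 𝒢)ˣ} (hsq : κ ^ 2 = gaugeUnit fun z => ribbonUnit (𝒢 z))
  (hstar : gaugeStar 𝒢 κ = (κ⁻¹ : (GaugeAlg 𝒢)ˣ))

include hsq hstar

theorem conjBy_theta_conjBy_theta (B : LatticeAlg cil tw D) :
    conjBy cil tw D κ (theta cil tw D (conjBy cil tw D κ (theta cil tw D B))) = B := by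
  let K : (LatticeAlg cil tw D)ˣ :=
    Units.map (gaugeHom cil tw D : GaugeAlg 𝒢 →* LatticeAlg cil tw D) κ
  have theta_K : theta cil tw D (K : LatticeAlg cil tw D) = ↑K⁻¹ :=
    (theta_gauge cil tw D κ).trans (congrArg (gauge cil tw D) hstar)
  have theta_K_inv : theta cil tw D (↑K⁻¹ : LatticeAlg cil tw D) = K := by
    rw [← theta_K]
    exact (congrArg _ (theta_gauge cil tw D _)).trans <| (theta_gauge cil tw D _).trans <|
      congrArg (gauge cil tw D) (gaugeStar_gaugeStar _)
  have theta_theta_eq : theta cil tw D (theta cil tw D B) = ↑(K ^ 2) * B * ↑(K ^ 2)⁻¹ := by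
    rw [theta_theta, ← hsq, ← map_pow, ← map_inv, hsq]
    rfl
  calc conjBy cil tw D κ (theta cil tw D (conjBy cil tw D κ (theta cil tw D B)))
      = ↑K⁻¹ * (theta cil tw D K * (theta cil tw D (theta cil tw D B) * theta cil tw D ↑K⁻¹)) *
          K := by
        rw [conjBy_eq, conjBy_eq, theta_mul, theta_mul]
    _ = ↑K⁻¹ * (↑K⁻¹ * (↑(K ^ 2) * B * ↑(K ^ 2)⁻¹ * K)) * K := by
        rw [theta_K, theta_K_inv, theta_theta_eq]
    _ = B := by
        simp only [pow_two, mul_inv_rev, Units.val_mul, mul_assoc, Units.inv_mul_cancel_left,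
          Units.inv_mul, mul_one]

/-- The `*`-operation `B ↦ κ⁻¹ θ(B) κ` of the lattice algebra, for a square root `κ` of the ribbon
element with `κ^* = κ⁻¹`. -/
@[reducible]
def latticeStarRing : StarRing (LatticeAlg cil tw D) where
  star B := conjBy cil tw D κ (theta cil tw D B)
  star_involutive := conjBy_theta_conjBy_theta cil tw D hsq hstar
  star_mul B B' := by rw [theta_mul, conjBy_mul]
  star_add B B' := by rw [map_add, conjBy_add]

theorem latticeStarRing_starModule :
    let _ := latticeStarRing cil tw D hsq hstar
    StarModule ℂ (LatticeAlg cil tw D) := by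
  refine @StarModule.mk _ _ _ (latticeStarRing cil tw D hsq hstar).toStar _ fun c B => ?_
  change conjBy cil tw D κ (theta cil tw D (c • B)) = _
  rw [map_smulₛₗ, conjBy_smul]
  rfl

end StarOfUnitarySquareRoot

end StarStructure

end LatticeGauge

end

theorem mainTheorem1
    {S : Type*} [Fintype S] [DecidableEq S] (G : SimpleGraph S) (cil : LatticeGauge.Ciliation G)
    (H : Type*) [Ring H] [HopfAlgebra ℂ H] [StarRing H] [StarModule ℂ H]
    [LatticeGauge.RibbonHopfStarAlgebra H] [FiniteDimensional ℂ H] [IsSemisimpleRing H]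
    (𝒢 : S → Type*) [∀ x, Ring (𝒢 x)] [∀ x, HopfAlgebra ℂ (𝒢 x)] [∀ x, StarRing (𝒢 x)]
    [∀ x, StarModule ℂ (𝒢 x)] [∀ x, LatticeGauge.RibbonHopfStarAlgebra (𝒢 x)]
    (tw : ∀ x, LatticeGauge.TwistEquiv (𝒢 x) H)
    {ι : Type*} [Fintype ι] (D : LatticeGauge.RepData H ι) :
    (∃! k : H, D.IsKappa k) ∧
    ∃ θ : LatticeGauge.LatticeAlg cil tw D →ₗ⋆[ℂ] LatticeGauge.LatticeAlg cil tw D,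
      LatticeGauge.IsTheta cil tw D θ ∧
      (∀ θ', LatticeGauge.IsTheta cil tw D θ' → θ' = θ) ∧
      ∃ v : (LatticeGauge.GaugeAlg 𝒢)ˣ,
        (v : LatticeGauge.GaugeAlg 𝒢) = LatticeGauge.gaugeV 𝒢 ∧
        (∀ B, θ (θ B) = LatticeGauge.gauge cil tw D (v : LatticeGauge.GaugeAlg 𝒢) * B *
          LatticeGauge.gauge cil tw D
            ((v⁻¹ : (LatticeGauge.GaugeAlg 𝒢)ˣ) : LatticeGauge.GaugeAlg 𝒢)) ∧
        ∀ k : H, D.IsKappa k →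
          ∃ κ : (LatticeGauge.GaugeAlg 𝒢)ˣ,
            (κ : LatticeGauge.GaugeAlg 𝒢) = LatticeGauge.gaugeKappa tw k ∧
            (∀ ξ : LatticeGauge.GaugeAlg 𝒢, (κ : LatticeGauge.GaugeAlg 𝒢) * ξ = ξ * κ) ∧
            κ ^ 2 = v ∧
            LatticeGauge.gaugeStar 𝒢 (κ : LatticeGauge.GaugeAlg 𝒢) =
              ((κ⁻¹ : (LatticeGauge.GaugeAlg 𝒢)ˣ) : LatticeGauge.GaugeAlg 𝒢) ∧
            (∀ B, LatticeGauge.conjBy cil tw D κ (θ (LatticeGauge.conjBy cil tw D κ (θ B))) = B) ∧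
            ∃ _ : StarRing (LatticeGauge.LatticeAlg cil tw D),
              StarModule ℂ (LatticeGauge.LatticeAlg cil tw D) ∧
              (∀ B : LatticeGauge.LatticeAlg cil tw D,
                star B = LatticeGauge.conjBy cil tw D κ (θ B)) ∧
              ∀ ξ : LatticeGauge.GaugeAlg 𝒢,
                star (LatticeGauge.gauge cil tw D ξ) =
                  LatticeGauge.gauge cil tw D (LatticeGauge.gaugeStar 𝒢 ξ) := by
  refine ⟨D.existsUnique_isKappa, LatticeGauge.theta cil tw D, LatticeGauge.isTheta_theta cil tw D,
    fun θ' hθ' => (LatticeGauge.isTheta_theta cil tw D).eq cil tw D hθ',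
    LatticeGauge.gaugeUnit fun z => LatticeGauge.ribbonUnit (𝒢 z), rfl,
    LatticeGauge.theta_theta cil tw D, fun k hk => ?_⟩
  have central := LatticeGauge.kappaUnit_commute tw hk
  have sq_eq := LatticeGauge.kappaUnit_sq tw hk
  have star_eq := LatticeGauge.gaugeStar_kappaUnit tw hk
  exact ⟨LatticeGauge.kappaUnit tw hk, rfl, central, sq_eq, star_eq,
    LatticeGauge.conjBy_theta_conjBy_theta cil tw D sq_eq star_eq,
    LatticeGauge.latticeStarRing cil tw D sq_eq star_eq,
    LatticeGauge.latticeStarRing_starModule cil tw D sq_eq star_eq, fun _ => rfl,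
    LatticeGauge.conjBy_theta_gauge cil tw D central⟩
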